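/- Let $d\ge 1$, let $(A,\mu)$ be a measure space and let $\pi_y = d\,p_y\hat\pi_y$ $(y\in A)$ be a POVM on $\mathbb C^d$: $p$ is a probability density with respect to $\mu$, $y\mapsto\hat\pi_y$ is a measurable family of density matrices, and $d\int d\mu(y)\,p_y\hat\pi_y=\mathbb 1$. Let $t\ge 1$ and let $\pi$ be a mixed $t$-design with seed state $\hat\chi$, i.e. $\hat\chi$ is a density matrix with $$\int d\mu(y)\,p_y\,\hat\pi_y^{\otimes t}=\int_{U(d)}dg\,(U_g\hat\chi U_g^\dagger)^{\otimes t}$$ ($dg$ the Haar probability measure). Let $C(\pi)=\lim_{n\to\infty}\frac1n\sup_\rho I(\rho,\pi^{\otimes n})$ be the unassisted classical capacity of $\pi$ (in nats), where $\rho$ runs over all ensembles of states on $(\mathbb C^d)^{\otimes n}$ and $I$ is the mutual information between preparation and outcome. For a unit vector $\phi$ let $\gamma_k=\int d\mu(y)\,p_y\langle\phi|\hat\pi_y|\phi\rangle^k$ be the indices of coincidence. For $k\le t$ they do not depend on $\phi$ and are fixed by the moments $m_k=\operatorname{Tr}[\hat\chi^k]$: as far as $k\le t$, one has $\gamma_1=\frac1d$,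 $\gamma_2=\frac{1+m_2}{d(d+1)}$, $\gamma_3=\frac{1+3m_2+2m_3}{d(d+1)(d+2)}$, $\gamma_4=\frac{1+6m_2+3m_2^2+8m_3+6m_4}{d(d+1)(d+2)(d+3)}$ and $\gamma_5=\frac{1+10m_2+15m_2^2+20m_3+30m_4+20m_2m_3+24m_5}{d(d+1)(d+2)(d+3)(d+4)}$. Moreover, for $t\in\{1,\dots,5\}$, $C(\pi)\le C_t$, where $$C_1=\ln d,\qquad C_2=\ln d+\ln\frac{\gamma_2}{\gamma_1},\qquad C_3=\ln d+\frac{d(\gamma_1-\gamma_2)^2}{\gamma_1-2\gamma_2+\gamma_3}\ln\frac{\gamma_2-\gamma_3}{\gamma_1-\gamma_2},$$ $$C_4=\ln d+\frac12\ln\frac{\gamma_3^2-\gamma_2\gamma_4}{\gamma_2^2-\gamma_1\gamma_3}+\frac{d(\gamma_1^2\gamma_4-3\gamma_1\gamma_2\gamma_3+2\gamma_2^3)}{2\sqrt{\Delta_4}}\ln\frac{\gamma_2\gamma_3-\gamma_1\gamma_4+\sqrt{\Delta_4}}{\gamma_2\gamma_3-\gamma_1\gamma_4-\sqrt{\Delta_4}},$$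 $$\Delta_4=-3\gamma_2^2\gamma_3^2+4\gamma_1\gamma_3^3+4\gamma_2^3\gamma_4-6\gamma_1\gamma_2\gamma_3\gamma_4+\gamma_1^2\gamma_4^2,$$ and $C_5=\ln d-d\sum_{i=1}^5a_i\gamma_i$, where $r(x)=\sum_{i=0}^5a_ix^i$ is the Hermite interpolating polynomial of $\eta(x)=-x\ln x$ of degree at most $5$ with simple nodes $0,1$ (value) and double nodes $x_1,x_2$ (value and derivative), $$x_{1,2}=\frac{\gamma_2\gamma_3-\gamma_3^2-\gamma_1\gamma_4+\gamma_3\gamma_4+\gamma_1\gamma_5-\gamma_2\gamma_5\pm\sqrt{\Delta_5}}{2E},\qquad E=\gamma_2^2+\gamma_3^2+\gamma_1(\gamma_4-\gamma_3)-\gamma_2(\gamma_3+\gamma_4),$$ $$\Delta_5=\bigl(\gamma_3(\gamma_3-\gamma_2-\gamma_4)+\gamma_1(\gamma_4-\gamma_5)+\gamma_2\gamma_5\bigr)^2+4E\bigl(\gamma_4(\gamma_2-\gamma_4)-\gamma_3^2-\gamma_2\gamma_5+\gamma_3(\gamma_4+\gamma_5)\bigr).$$ The expressions $C_1,C_2$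 are always well defined, $C_3$ is well defined for $d\ge2$, and $C_4,C_5$ are well defined for $\hat\chi\ne\mathbb 1/d$; that is, $\gamma_1,\gamma_2>0$ for $t=2$; $\gamma_1-2\gamma_2+\gamma_3$, $\gamma_1-\gamma_2$, $\gamma_2-\gamma_3>0$ for $t=3$; $\gamma_1\gamma_3-\gamma_2^2>0$, $\gamma_2\gamma_4-\gamma_3^2>0$, $\Delta_4>0$ and $\sqrt{\Delta_4}<\gamma_1\gamma_4-\gamma_2\gamma_3$ for $t=4$; $E<0$, $\Delta_5>0$ and $0<x_1<x_2<1$ for $t=5$. In the excluded degenerate cases ($t=3$ and $d=1$; $t=4,5$ and $\hat\chi=\mathbb 1/d$), where the expression reads $0/0$, one has $C(\pi)=0$. -/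

import Mathlib

open MeasureTheory
open scoped NNReal ENNReal ComplexOrder

noncomputable section

namespace MixedDesign

/-! ### States, ensembles and measurements -/

/-- A density matrix on the Hilbert space `ℂ^ι`. -/
def IsState {ι : Type*} [Fintype ι] (ρ : Matrix ι ι ℂ) : Prop :=
  ρ.PosSemidef ∧ ρ.trace = 1

/-- A normalized family `x ↦ p_x χ̂_x`: a probability density `p` with respect to a measure `μ`,
and a measurable family `χ̂` of density matrices on `ℂ^ι`.  An ensemble of states is such a family;
a positive operator-valued measure in dimension `d` is `y ↦ d p_y χ̂_y` for such a family that is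
subject to the normalization `IsPOVM` below. -/
structure StateFamily (ι : Type*) [Fintype ι] {A : Type*} [MeasurableSpace A]
    (μ : Measure A) where
  /-- the probability density `p` -/
  p : A → ℝ≥0
  /-- the states `χ̂_x` -/
  hat : A → Matrix ι ι ℂ
  measurable_p : Measurable p
  lintegral_p : ∫⁻ x, (p x : ℝ≥0∞) ∂μ = 1
  measurable_hat : ∀ i j, Measurable fun x => hat x i j
  isState_hat : ∀ x, IsState (hat x)

namespace StateFamily

variable {ι : Type*} [Fintype ι] {A : Type*} [MeasurableSpace A] {μ : Measure A}

/-- The probability measure `p_x dμ(x)`. -/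
def law (χ : StateFamily ι μ) : Measure A :=
  μ.withDensity fun x => (χ.p x : ℝ≥0∞)

end StateFamily

/-- `y ↦ d p_y π̂_y` is a POVM: `d ∫ dμ(y) p_y π̂_y = 1`. -/
def IsPOVM {d : ℕ} {A : Type*} [MeasurableSpace A] {μ : Measure A}
    (π : StateFamily (Fin d) μ) : Prop :=
  ∀ i j, (d : ℂ) * ∫ y, π.hat y i j ∂π.law = (1 : Matrix (Fin d) (Fin d) ℂ) i j

/-- The tensor product `M_0 ⊗ ⋯ ⊗ M_{n-1}` of operators on `ℂ^ι`, as an operator on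
`(ℂ^ι)^{⊗ n}`, in the product basis. -/
def tensorProd {ι : Type*} {n : ℕ} (M : Fin n → Matrix ι ι ℂ) :
    Matrix (Fin n → ι) (Fin n → ι) ℂ :=
  Matrix.of fun f g => ∏ k, M k (f k) (g k)

/-- The index of coincidence `γ_k(χ, φ) = ∫ dμ(x) p_x ⟨φ|χ̂_x|φ⟩^k`. -/
def coincidence {ι : Type*} [Fintype ι] {A : Type*} [MeasurableSpace A] {μ : Measure A}
    (χ : StateFamily ι μ) (φ : ι → ℂ) (k : ℕ) : ℝ :=
  ∫ x, (star φ ⬝ᵥ (χ.hat x).mulVec φ).re ^ k ∂χ.law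

/-! ### Mixed designs -/

instance unitaryMeasurableSpace (d : ℕ) : MeasurableSpace (Matrix.unitaryGroup (Fin d) ℂ) :=
  borel _

instance unitaryBorelSpace (d : ℕ) : BorelSpace (Matrix.unitaryGroup (Fin d) ℂ) := ⟨rfl⟩

instance unitaryCompactSpace (d : ℕ) : CompactSpace (Matrix.unitaryGroup (Fin d) ℂ) := by
  have hK : IsCompact (Set.pi Set.univ fun _ : Fin d =>
      Set.pi Set.univ fun _ : Fin d => Metric.closedBall (0 : ℂ) 1) :=
    isCompact_univ_pi fun _ => isCompact_univ_pi fun _ => isCompact_closedBall 0 1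
  have hclosed : IsClosed ((Matrix.unitaryGroup (Fin d) ℂ : Set (Matrix (Fin d) (Fin d) ℂ))) := by
    have h : (Matrix.unitaryGroup (Fin d) ℂ : Set (Matrix (Fin d) (Fin d) ℂ))
        = {U | U * star U = 1} := by
      ext U
      exact Matrix.mem_unitaryGroup_iff
    rw [h]
    exact isClosed_eq (by fun_prop) continuous_const
  refine isCompact_iff_compactSpace.mp (hK.of_isClosed_subset hclosed fun U hU => ?_)
  intro i _ j _
  simpa using entry_norm_bound_of_unitary hU i j

/-- The Haar probability measure on the unitary group `U(d)`. -/
def haarUnitary (d : ℕ) : Measure (Matrix.unitaryGroup (Fin d) ℂ) :=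
  Measure.haarMeasure ⊤

/-- `χ` is a mixed `t`-design with seed state `χ̂`:
`∫ dμ(x) p_x χ̂_x^{⊗ t} = ∫ dg (U_g χ̂ U_g†)^{⊗ t}` (an identity of matrices, stated
entrywise). -/
def IsMixedDesign {d : ℕ} {A : Type*} [MeasurableSpace A] {μ : Measure A} (t : ℕ)
    (χ : StateFamily (Fin d) μ) (seed : Matrix (Fin d) (Fin d) ℂ) : Prop :=
  IsState seed ∧
    ∀ f g : Fin t → Fin d,
      ∫ x, tensorProd (fun _ : Fin t => χ.hat x) f g ∂χ.law
        = ∫ U : Matrix.unitaryGroup (Fin d) ℂ,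
            tensorProd (fun _ : Fin t =>
              (U : Matrix (Fin d) (Fin d) ℂ) * seed * star (U : Matrix (Fin d) (Fin d) ℂ)) f g
            ∂(haarUnitary d)

/-! ### Classical capacity -/

/-- The joint law on `X × Y` with density `(x, y) ↦ Tr[ρ_x E_y]` with respect to `P ⊗ Q`. -/
def jointLaw {κ X Y : Type*} [Fintype κ] [MeasurableSpace X] [MeasurableSpace Y]
    (P : Measure X) (ρ : X → Matrix κ κ ℂ) (Q : Measure Y) (E : Y → Matrix κ κ ℂ) :
    Measure (X × Y) :=
  (P.prod Q).withDensity fun z => ENNReal.ofReal ((ρ z.1 * E z.2).trace.re)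

/-- The mutual information (in nats) of a joint law: the relative entropy of the joint law with
respect to the product of its marginals. -/
def mutualInfo {X Y : Type*} [MeasurableSpace X] [MeasurableSpace Y]
    (J : Measure (X × Y)) : ℝ≥0∞ :=
  InformationTheory.klDiv J ((J.map Prod.fst).prod (J.map Prod.snd))

/-- The supremum over all ensembles `ρ` on `(ℂ^d)^{⊗ n}` of the mutual information
`I(ρ, π^{⊗ n})`.  The POVM `π^{⊗ n}` lives on `A^n` and is `y ↦ ⨂_k d p_{y_k} π̂_{y_k}`; its
weight `∏_k p_{y_k}` is absorbed in the product of the laws `p_y dμ(y)`, and the weight of the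
ensemble in the law of the ensemble. -/
def blockInfo {d : ℕ} {A : Type*} [MeasurableSpace A] {μ : Measure A}
    (π : StateFamily (Fin d) μ) (n : ℕ) : ℝ≥0∞ :=
  ⨆ (X : Type) (_ : MeasurableSpace X) (ν : Measure X) (ρ : StateFamily (Fin n → Fin d) ν),
    mutualInfo (jointLaw ρ.law ρ.hat (Measure.pi fun _ : Fin n => π.law)
      fun y => tensorProd fun k => (d : ℂ) • π.hat (y k))

/-- The unassisted classical capacity `C(π) = lim_n (1/n) sup_ρ I(ρ, π^{⊗ n})`.  The sequence
`sup_ρ I(ρ, π^{⊗ n})` is superadditive in `n`, so that the limit exists in `[0, ∞]` and the upper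
limit is the limit. -/
def capacity {d : ℕ} {A : Type*} [MeasurableSpace A] {μ : Measure A}
    (π : StateFamily (Fin d) μ) : ℝ≥0∞ :=
  Filter.limsup (fun n : ℕ => blockInfo π n / (n : ℝ≥0∞)) Filter.atTop

/-! ### The bounds, as functions of `d` and of the indices of coincidence `γ` -/

/-- `C_1`. -/
def bound1 (d : ℕ) : ℝ := Real.log d

/-- `C_2`. -/
def bound2 (d : ℕ) (γ : ℕ → ℝ) : ℝ := Real.log d + Real.log (γ 2 / γ 1)

/-- `C_3`. -/
def bound3 (d : ℕ) (γ : ℕ → ℝ) : ℝ :=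
  Real.log d + d * (γ 1 - γ 2) ^ 2 / (γ 1 - 2 * γ 2 + γ 3)
    * Real.log ((γ 2 - γ 3) / (γ 1 - γ 2))

/-- `Δ_4`. -/
def disc4 (γ : ℕ → ℝ) : ℝ :=
  -3 * γ 2 ^ 2 * γ 3 ^ 2 + 4 * γ 1 * γ 3 ^ 3 + 4 * γ 2 ^ 3 * γ 4
    - 6 * γ 1 * γ 2 * γ 3 * γ 4 + γ 1 ^ 2 * γ 4 ^ 2

/-- `C_4`. -/
def bound4 (d : ℕ) (γ : ℕ → ℝ) : ℝ :=
  Real.log d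
    + 1 / 2 * Real.log ((γ 3 ^ 2 - γ 2 * γ 4) / (γ 2 ^ 2 - γ 1 * γ 3))
    + d * (γ 1 ^ 2 * γ 4 - 3 * γ 1 * γ 2 * γ 3 + 2 * γ 2 ^ 3) / (2 * √(disc4 γ))
      * Real.log ((γ 2 * γ 3 - γ 1 * γ 4 + √(disc4 γ)) / (γ 2 * γ 3 - γ 1 * γ 4 - √(disc4 γ)))

/-- Numerator (without the root) of the two interior nodes for `t = 5`. -/
def num5 (γ : ℕ → ℝ) : ℝ :=
  γ 2 * γ 3 - γ 3 ^ 2 - γ 1 * γ 4 + γ 3 * γ 4 + γ 1 * γ 5 - γ 2 * γ 5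

/-- Half the denominator of the two interior nodes for `t = 5`. -/
def den5 (γ : ℕ → ℝ) : ℝ :=
  γ 2 ^ 2 + γ 3 ^ 2 + γ 1 * (γ 4 - γ 3) - γ 2 * (γ 3 + γ 4)

/-- `Δ_5`. -/
def disc5 (γ : ℕ → ℝ) : ℝ :=
  (γ 3 * (γ 3 - γ 2 - γ 4) + γ 1 * (γ 4 - γ 5) + γ 2 * γ 5) ^ 2
    + 4 * (γ 2 ^ 2 + γ 3 ^ 2 + γ 1 * (γ 4 - γ 3) - γ 2 * (γ 3 + γ 4))
      * (γ 4 * (γ 2 - γ 4) - γ 3 ^ 2 - γ 2 * γ 5 + γ 3 * (γ 4 + γ 5))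

/-- The interior node for `t = 5` with the sign `+` of the root. -/
def node5p (γ : ℕ → ℝ) : ℝ := (num5 γ + √(disc5 γ)) / (2 * den5 γ)

/-- The interior node for `t = 5` with the sign `-` of the root. -/
def node5m (γ : ℕ → ℝ) : ℝ := (num5 γ - √(disc5 γ)) / (2 * den5 γ)

/-- `r` is the Hermite interpolating polynomial of `η(x) = -x ln x`, of degree at most `5`, with
simple nodes `0, 1` and double nodes `x₁, x₂`. -/
def IsHermite5 (r : Polynomial ℝ) (x₁ x₂ : ℝ) : Prop :=
  r.natDegree ≤ 5 ∧ r.eval 0 = Real.negMulLog 0 ∧ r.eval 1 = Real.negMulLog 1 ∧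
    (r.eval x₁ = Real.negMulLog x₁ ∧ r.derivative.eval x₁ = deriv Real.negMulLog x₁) ∧
    (r.eval x₂ = Real.negMulLog x₂ ∧ r.derivative.eval x₂ = deriv Real.negMulLog x₂)

/-- The closed form of the `k`-th index of coincidence of a mixed design (for `1 ≤ k ≤ 5`), in
the moments `m k = Tr[χ̂^k]` of its seed state. -/
def coincidenceFormula (d : ℝ) (m : ℕ → ℝ) : ℕ → ℝ
  | 1 => 1 / d
  | 2 => (1 + m 2) / (d * (d + 1))
  | 3 => (1 + 3 * m 2 + 2 * m 3) / (d * (d + 1) * (d + 2))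
  | 4 => (1 + 6 * m 2 + 3 * m 2 ^ 2 + 8 * m 3 + 6 * m 4) / (d * (d + 1) * (d + 2) * (d + 3))
  | 5 => (1 + 10 * m 2 + 15 * m 2 ^ 2 + 20 * m 3 + 30 * m 4 + 20 * m 2 * m 3 + 24 * m 5)
      / (d * (d + 1) * (d + 2) * (d + 3) * (d + 4))
  | _ => 0

end MixedDesign

end

open MixedDesign

/-! The capacity reduces to one copy and pure states. If f(x, y) is the density of the joint law
relative to P ⊗ Q, where Q is the law used as reference on outcomes, the mutual information is ∫ f
ln f − ∫ m ln m with m the average of f over x. The subtracted term is nonnegative because m is a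
probability density relative to a probability measure (`mutualInfo_withDensity_le`), so a bound on ∫
f ln f for each single state suffices. Convexity of x ln x carries such a bound from pure states to
all positive matrices (`IsEffectFamily.integral_density_mul_log_le`). Conditioning on the first
outcome then makes it additive for product measurements, entangled inputs included
(`IsEffectFamily.integral_tensor_density_mul_log_le`). Hence C(π) is at most any common upper bound
of ln d − d ∫ η(⟨v|π̂_y|v⟩) over unit vectors v (`capacity_le_of_entropy`).

A polynomial r = x q of degree at most t that lies below η on [0, 1] gives ∫ η ≥ Σ a_i γ_i, and for
a mixed t-design the right side does not depend on v. As η = x(−ln x), it is enough that q lies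
below −ln x. The chosen q interpolates −ln at quadrature nodes: Gauss nodes for the weight x if t =
2, 4, and Gauss–Radau nodes with the fixed node 1 if t = 3, 5. At the remaining nodes it also
matches the derivative. For t = 3, 4 orthogonality of the node polynomial removes every unknown
except a short Newton part of q, which produces the closed forms C_3 and C_4. The inequality q ≤ −ln
follows from counting zeros: N = 1 + x q' satisfies N(0) = 1 and, by the derivative conditions and
Rolle, has as many positive zeros as its degree allows. So it factors completely and the sign of the
derivative −N/x of the error is known everywhere.

For t = 4, 5 the nodes are admissible because the moment functional is strictly positive: if the
seed is not scalar, ⟨φ|Uχ̂U†|φ⟩ takes infinitely many values as U varies, and Haar measure charges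
open sets (`integral_eval_diagForm_pos`). The closed form of γ_k comes from a recursion for moments
of Σ l_i |u_i|² on the complex sphere, obtained by differentiating the invariance under plane
rotations (`integral_normSq_mul_pow`). -/

namespace MixedDesign

/-! ### Hermite interpolation of the logarithm -/

section Hermite

open Polynomial

/-- The logarithmic derivative of the interpolation error, up to the factor `-1/x`. -/
theorem hasDerivAt_neg_log_sub_eval (q : ℝ[X]) {x : ℝ} (hx : 0 < x) :
    HasDerivAt (fun x => -Real.log x - q.eval x)
      (-((1 + X * derivative q : ℝ[X]).eval x) / x) x := by
  have h := (Real.hasDerivAt_log hx.ne').neg.sub (q.hasDerivAt x)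
  refine h.congr_deriv ?_
  simp only [eval_add, eval_one, eval_mul, eval_X]
  field_simp
  ring

theorem nonneg_of_deriv_nonpos {g g' : ℝ → ℝ} {a b : ℝ} (ha : 0 < a)
    (hg : ∀ x, 0 < x → HasDerivAt g (g' x) x) (hab : a ≤ b)
    (hs : ∀ x, a < x → x < b → g' x ≤ 0) (hb : 0 ≤ g b) : 0 ≤ g a := by
  have hanti : AntitoneOn g (Set.Icc a b) := by
    refine antitoneOn_of_deriv_nonpos (convex_Icc a b)
      (fun x hx => (hg x (ha.trans_le hx.1)).continuousAt.continuousWithinAt)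
      (fun x hx => ?_) (fun x hx => ?_)
    · rw [interior_Icc] at hx
      exact (hg x (ha.trans hx.1)).differentiableAt.differentiableWithinAt
    · rw [interior_Icc] at hx
      rw [(hg x (ha.trans hx.1)).deriv]
      exact hs x hx.1 hx.2
  exact hb.trans (hanti ⟨le_rfl, hab⟩ ⟨hab, le_rfl⟩ hab)

theorem nonneg_of_deriv_nonneg {g g' : ℝ → ℝ} {a b : ℝ} (ha : 0 < a)
    (hg : ∀ x, 0 < x → HasDerivAt g (g' x) x) (hab : a ≤ b)
    (hs : ∀ x, a < x → x < b → 0 ≤ g' x) (hb : 0 ≤ g a) : 0 ≤ g b := by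
  have hmono : MonotoneOn g (Set.Icc a b) := by
    refine monotoneOn_of_deriv_nonneg (convex_Icc a b)
      (fun x hx => (hg x (ha.trans_le hx.1)).continuousAt.continuousWithinAt)
      (fun x hx => ?_) (fun x hx => ?_)
    · rw [interior_Icc] at hx
      exact (hg x (ha.trans hx.1)).differentiableAt.differentiableWithinAt
    · rw [interior_Icc] at hx
      rw [(hg x (ha.trans hx.1)).deriv]
      exact hs x hx.1 hx.2
  exact hb.trans (hmono ⟨le_rfl, hab⟩ ⟨hab, le_rfl⟩ hab)

theorem nonneg_of_hill {g g' : ℝ → ℝ} {a b c : ℝ} (ha : 0 < a)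
    (hg : ∀ x, 0 < x → HasDerivAt g (g' x) x)
    (hl : ∀ x, a < x → x < c → 0 ≤ g' x) (hr : ∀ x, c < x → x < b → g' x ≤ 0)
    (hga : 0 ≤ g a) (hgb : 0 ≤ g b) {x : ℝ} (hax : a ≤ x) (hxb : x ≤ b) : 0 ≤ g x := by
  rcases le_total x c with h | h
  · exact nonneg_of_deriv_nonneg ha hg hax (fun y hy hy' => hl y hy (hy'.trans_le h)) hga
  · exact nonneg_of_deriv_nonpos (ha.trans_le hax) hg hxb
      (fun y hy hy' => hr y (h.trans_lt hy) hy') hgb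

theorem exists_root_between (q : ℝ[X]) {a b : ℝ} (ha : 0 < a) (hab : a < b)
    (hqa : q.eval a = -Real.log a) (hqb : q.eval b = -Real.log b) :
    ∃ c, a < c ∧ c < b ∧ (1 + X * derivative q : ℝ[X]).eval c = 0 := by
  obtain ⟨c, hc, h⟩ := exists_hasDerivAt_eq_zero (f := fun x => -Real.log x - q.eval x)
    (f' := fun x => -((1 + X * derivative q : ℝ[X]).eval x) / x) hab
    (fun x hx => (hasDerivAt_neg_log_sub_eval q
      (ha.trans_le hx.1)).continuousAt.continuousWithinAt) (by simp [hqa, hqb])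
    (fun x hx => hasDerivAt_neg_log_sub_eval q (ha.trans hx.1))
  refine ⟨c, hc.1, hc.2, ?_⟩
  have hc0 : c ≠ 0 := (ha.trans hc.1).ne'
  rw [div_eq_zero_iff, neg_eq_zero] at h
  exact h.resolve_right hc0

theorem eval_one_add_X_mul_derivative_eq_zero (q : ℝ[X]) {a : ℝ} (ha : 0 < a)
    (h : (derivative q).eval a = -a⁻¹) : (1 + X * derivative q : ℝ[X]).eval a = 0 := by
  simp [h, ha.ne']

theorem natDegree_one_add_X_mul_derivative_le (q : ℝ[X]) {n : ℕ} (hq : q.natDegree ≤ n) :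
    (1 + X * derivative q : ℝ[X]).natDegree ≤ n := by
  rcases Nat.eq_zero_or_pos q.natDegree with h | h
  · rw [derivative_of_natDegree_zero h]
    simp
  · refine (natDegree_add_le _ _).trans (max_le (by simp) ?_)
    refine natDegree_mul_le.trans ?_
    have := natDegree_derivative_lt h.ne'
    rw [natDegree_X]
    omega

/-- Besides the zero of 1 + x q' at the double node x₁, Rolle gives a zero c between x₁ and 1. The
error falls to 0 at x₁, rises up to c, and falls again to 0 at 1. -/
theorem eval_le_neg_log_of_radau (q : ℝ[X]) (hq : q.natDegree ≤ 2) {x₁ : ℝ} (h0 : 0 < x₁)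
    (h1 : x₁ < 1) (e : q.eval 1 = 0) (e₁ : q.eval x₁ = -Real.log x₁)
    (d₁ : (derivative q).eval x₁ = -x₁⁻¹) {x : ℝ} (hx : 0 < x) (hx1 : x ≤ 1) :
    q.eval x ≤ -Real.log x := by
  obtain ⟨c, hc, hc', hN⟩ := exists_root_between q h0 h1 e₁ (by simp [e])
  have hc0 : 0 < c := h0.trans hc
  -- Both sides have degree at most 2 and agree at three points: the value 1 at 0 and the two zeros.
  have hfac : (1 + X * derivative q : ℝ[X]) = (1 - C x₁⁻¹ * X) * (1 - C c⁻¹ * X) := by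
    refine eq_of_natDegree_lt_card_of_eval_eq' _ _ {0, x₁, c} ?_ ?_
    · have := eval_one_add_X_mul_derivative_eq_zero q h0 d₁
      intro i hi
      simp only [Finset.mem_insert, Finset.mem_singleton] at hi
      rcases hi with rfl | rfl | rfl
      · simp
      · rw [this]; simp [h0.ne']
      · rw [hN]; simp [hc0.ne']
    · rw [Finset.card_eq_three.mpr ⟨0, x₁, c, h0.ne, hc0.ne, hc.ne, rfl⟩]
      refine (max_le (natDegree_one_add_X_mul_derivative_le q hq) ?_).trans_lt (by norm_num)
      compute_degree
  have hev : ∀ y, (1 + X * derivative q : ℝ[X]).eval y = (1 - y / x₁) * (1 - y / c) := by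
    intro y; rw [hfac]; simp; ring
  have hg := fun y (hy : 0 < y) => hasDerivAt_neg_log_sub_eval q hy
  simp only [hev] at hg
  obtain ⟨g, hgd⟩ : ∃ g : ℝ → ℝ, g = fun x => -Real.log x - q.eval x := ⟨_, rfl⟩
  rw [← hgd] at hg
  suffices 0 ≤ g x by
    rw [hgd] at this
    linarith
  have hlt : ∀ {a y : ℝ}, 0 < a → y < a → 0 ≤ 1 - y / a := fun ha hy => by
    rw [sub_nonneg, div_le_one ha]; exact hy.le
  have hgt : ∀ {a y : ℝ}, 0 < a → a < y → 0 ≤ -(1 - y / a) := fun ha hy => by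
    rw [neg_sub, sub_nonneg, one_le_div ha]; exact hy.le
  rcases le_total x x₁ with h | h
  · refine nonneg_of_deriv_nonpos hx hg h (fun y hy hy' => ?_) (by simp [hgd, e₁])
    have := mul_nonneg (hlt h0 hy') (hlt hc0 (hy'.trans hc))
    exact div_nonpos_of_nonpos_of_nonneg (by linarith) (hx.trans hy).le
  · refine nonneg_of_hill (c := c) h0 hg (fun y hy hy' => ?_) (fun y hy hy' => ?_)
      (by simp [hgd, e₁]) (by simp [hgd, e]) h hx1
    · have := mul_nonneg (hgt h0 hy) (hlt hc0 hy')
      exact div_nonneg (by linarith) (h0.trans hy).le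
    · have := mul_nonneg (hgt h0 (hc.trans hy)) (hgt hc0 hy)
      exact div_nonpos_of_nonpos_of_nonneg (by linarith) (hc0.trans hy).le

/-- The three zeros of 1 + x q' are x₁, x₂ and a Rolle point between them. With no simple node, the
error is increasing beyond x₂, so no upper bound on x is needed. -/
theorem eval_le_neg_log_of_gauss (q : ℝ[X]) (hq : q.natDegree ≤ 3) {x₁ x₂ : ℝ} (h0 : 0 < x₁)
    (h12 : x₁ < x₂) (e₁ : q.eval x₁ = -Real.log x₁)
    (d₁ : (derivative q).eval x₁ = -x₁⁻¹) (e₂ : q.eval x₂ = -Real.log x₂)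
    (d₂ : (derivative q).eval x₂ = -x₂⁻¹) {x : ℝ} (hx : 0 < x) :
    q.eval x ≤ -Real.log x := by
  obtain ⟨c, hc, hc', hN⟩ := exists_root_between q h0 h12 e₁ e₂
  have hc0 : 0 < c := h0.trans hc
  have h2 : 0 < x₂ := h0.trans h12
  have hfac : (1 + X * derivative q : ℝ[X])
      = (1 - C x₁⁻¹ * X) * (1 - C c⁻¹ * X) * (1 - C x₂⁻¹ * X) := by
    refine eq_of_natDegree_lt_card_of_eval_eq' _ _ {0, x₁, c, x₂} ?_ ?_
    · have t1 := eval_one_add_X_mul_derivative_eq_zero q h0 d₁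
      have t2 := eval_one_add_X_mul_derivative_eq_zero q h2 d₂
      intro i hi
      simp only [Finset.mem_insert, Finset.mem_singleton] at hi
      rcases hi with rfl | rfl | rfl | rfl
      · simp
      · rw [t1]; simp [h0.ne']
      · rw [hN]; simp [hc0.ne']
      · rw [t2]; simp [h2.ne']
    · have hcard : ({0, x₁, c, x₂} : Finset ℝ).card = 4 := by
        rw [Finset.card_insert_of_notMem, Finset.card_eq_three.mpr
          ⟨x₁, c, x₂, hc.ne, h12.ne, hc'.ne, rfl⟩]
        simp [h0.ne, hc0.ne, h2.ne]
      rw [hcard]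
      refine (max_le (natDegree_one_add_X_mul_derivative_le q hq) ?_).trans_lt (by norm_num)
      compute_degree
  have hev : ∀ y, (1 + X * derivative q : ℝ[X]).eval y
      = (1 - y / x₁) * (1 - y / c) * (1 - y / x₂) := by
    intro y; rw [hfac]; simp; ring
  have hg := fun y (hy : 0 < y) => hasDerivAt_neg_log_sub_eval q hy
  simp only [hev] at hg
  obtain ⟨g, hgd⟩ : ∃ g : ℝ → ℝ, g = fun x => -Real.log x - q.eval x := ⟨_, rfl⟩
  rw [← hgd] at hg
  suffices 0 ≤ g x by
    rw [hgd] at this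
    linarith
  have hlt : ∀ {a y : ℝ}, 0 < a → y < a → 0 ≤ 1 - y / a := fun ha hy => by
    rw [sub_nonneg, div_le_one ha]; exact hy.le
  have hgt : ∀ {a y : ℝ}, 0 < a → a < y → 0 ≤ -(1 - y / a) := fun ha hy => by
    rw [neg_sub, sub_nonneg, one_le_div ha]; exact hy.le
  rcases le_total x x₁ with h | h
  · refine nonneg_of_deriv_nonpos hx hg h (fun y hy hy' => ?_) (by simp [hgd, e₁])
    have := mul_nonneg (mul_nonneg (hlt h0 hy') (hlt hc0 (hy'.trans hc)))
      (hlt h2 (hy'.trans h12))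
    exact div_nonpos_of_nonpos_of_nonneg (by linarith) (hx.trans hy).le
  · rcases le_total x x₂ with h' | h'
    · refine nonneg_of_hill (c := c) h0 hg (fun y hy hy' => ?_) (fun y hy hy' => ?_)
        (by simp [hgd, e₁]) (by simp [hgd, e₂]) h h'
      · have := mul_nonneg (mul_nonneg (hgt h0 hy) (hlt hc0 hy')) (hlt h2 (hy'.trans hc'))
        exact div_nonneg (by linarith) (h0.trans hy).le
      · have := mul_nonneg (mul_nonneg (hgt h0 (hc.trans hy)) (hgt hc0 hy)) (hlt h2 hy')
        exact div_nonpos_of_nonpos_of_nonneg (by linarith) (hc0.trans hy).le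
    · refine nonneg_of_deriv_nonneg h2 hg h' (fun y hy hy' => ?_) (by simp [hgd, e₂])
      have := mul_nonneg (mul_nonneg (hgt h0 (h12.trans hy)) (hgt hc0 (hc'.trans hy)))
        (hgt h2 hy)
      exact div_nonneg (by linarith) (h2.trans hy).le

/-- Rolle now supplies two zeros of 1 + x q', one in (x₁, x₂) and one in (x₂, 1), so the error has a
hill over each of these intervals. -/
theorem eval_le_neg_log_of_gauss_radau (q : ℝ[X]) (hq : q.natDegree ≤ 4) {x₁ x₂ : ℝ}
    (h0 : 0 < x₁) (h12 : x₁ < x₂) (h21 : x₂ < 1) (e : q.eval 1 = 0)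
    (e₁ : q.eval x₁ = -Real.log x₁)
    (d₁ : (derivative q).eval x₁ = -x₁⁻¹) (e₂ : q.eval x₂ = -Real.log x₂)
    (d₂ : (derivative q).eval x₂ = -x₂⁻¹) {x : ℝ} (hx : 0 < x) (hx1 : x ≤ 1) :
    q.eval x ≤ -Real.log x := by
  obtain ⟨c, hc, hc', hN⟩ := exists_root_between q h0 h12 e₁ e₂
  have h2 : 0 < x₂ := h0.trans h12
  obtain ⟨b, hb, hb', hM⟩ := exists_root_between q h2 h21 e₂ (by simp [e])
  have hc0 : 0 < c := h0.trans hc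
  have hb0 : 0 < b := h2.trans hb
  have hfac : (1 + X * derivative q : ℝ[X])
      = (1 - C x₁⁻¹ * X) * (1 - C c⁻¹ * X) * (1 - C x₂⁻¹ * X) * (1 - C b⁻¹ * X) := by
    refine eq_of_natDegree_lt_card_of_eval_eq' _ _ {0, x₁, c, x₂, b} ?_ ?_
    · have t1 := eval_one_add_X_mul_derivative_eq_zero q h0 d₁
      have t2 := eval_one_add_X_mul_derivative_eq_zero q h2 d₂
      intro i hi
      simp only [Finset.mem_insert, Finset.mem_singleton] at hi
      rcases hi with rfl | rfl | rfl | rfl | rfl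
      · simp
      · rw [t1]; simp [h0.ne']
      · rw [hN]; simp [hc0.ne']
      · rw [t2]; simp [h2.ne']
      · rw [hM]; simp [hb0.ne']
    · have hcard : ({0, x₁, c, x₂, b} : Finset ℝ).card = 5 := by
        rw [Finset.card_insert_of_notMem, Finset.card_insert_of_notMem, Finset.card_eq_three.mpr
          ⟨c, x₂, b, hc'.ne, (hc'.trans hb).ne, hb.ne, rfl⟩]
        · simp [hc.ne, h12.ne, (h12.trans hb).ne]
        · simp [h0.ne, hc0.ne, h2.ne, hb0.ne]
      rw [hcard]
      refine (max_le (natDegree_one_add_X_mul_derivative_le q hq) ?_).trans_lt (by norm_num)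
      compute_degree
  have hev : ∀ y, (1 + X * derivative q : ℝ[X]).eval y
      = (1 - y / x₁) * (1 - y / c) * (1 - y / x₂) * (1 - y / b) := by
    intro y; rw [hfac]; simp; ring
  have hg := fun y (hy : 0 < y) => hasDerivAt_neg_log_sub_eval q hy
  simp only [hev] at hg
  obtain ⟨g, hgd⟩ : ∃ g : ℝ → ℝ, g = fun x => -Real.log x - q.eval x := ⟨_, rfl⟩
  rw [← hgd] at hg
  suffices 0 ≤ g x by
    rw [hgd] at this
    linarith
  have hlt : ∀ {a y : ℝ}, 0 < a → y < a → 0 ≤ 1 - y / a := fun ha hy => by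
    rw [sub_nonneg, div_le_one ha]; exact hy.le
  have hgt : ∀ {a y : ℝ}, 0 < a → a < y → 0 ≤ -(1 - y / a) := fun ha hy => by
    rw [neg_sub, sub_nonneg, one_le_div ha]; exact hy.le
  rcases le_total x x₁ with h | h
  · refine nonneg_of_deriv_nonpos hx hg h (fun y hy hy' => ?_) (by simp [hgd, e₁])
    have := mul_nonneg (mul_nonneg (mul_nonneg (hlt h0 hy') (hlt hc0 (hy'.trans hc)))
      (hlt h2 (hy'.trans h12))) (hlt hb0 (hy'.trans (h12.trans hb)))
    exact div_nonpos_of_nonpos_of_nonneg (by linarith) (hx.trans hy).le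
  · rcases le_total x x₂ with h' | h'
    · refine nonneg_of_hill (c := c) h0 hg (fun y hy hy' => ?_) (fun y hy hy' => ?_)
        (by simp [hgd, e₁]) (by simp [hgd, e₂]) h h'
      · have := mul_nonneg (mul_nonneg (mul_nonneg (hgt h0 hy) (hlt hc0 hy'))
          (hlt h2 (hy'.trans hc'))) (hlt hb0 (hy'.trans (hc'.trans hb)))
        exact div_nonneg (by linarith) (h0.trans hy).le
      · have := mul_nonneg (mul_nonneg (mul_nonneg (hgt h0 (hc.trans hy)) (hgt hc0 hy))
          (hlt h2 hy')) (hlt hb0 (hy'.trans hb))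
        exact div_nonpos_of_nonpos_of_nonneg (by linarith) (hc0.trans hy).le
    · refine nonneg_of_hill (c := b) h2 hg (fun y hy hy' => ?_) (fun y hy hy' => ?_)
        (by simp [hgd, e₂]) (by simp [hgd, e]) h' hx1
      · have := mul_nonneg (mul_nonneg (mul_nonneg (hgt h0 (h12.trans hy))
          (hgt hc0 (hc'.trans hy))) (hgt h2 hy)) (hlt hb0 hy')
        exact div_nonneg (by linarith) (h2.trans hy).le
      · have := mul_nonneg (mul_nonneg (mul_nonneg (hgt h0 (h12.trans (hb.trans hy)))
          (hgt hc0 (hc'.trans (hb.trans hy)))) (hgt h2 (hb.trans hy))) (hgt hb0 hy)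
        exact div_nonpos_of_nonpos_of_nonneg (by linarith) (hb0.trans hy).le

/-- Existence of the polynomial of degree at most `4` with simple node `1` (value `0`) and
two double nodes. -/
theorem exists_hermite_gauss_radau {x₁ x₂ : ℝ} (h12 : x₁ < x₂) (h21 : x₂ < 1)
    (v₁ w₁ v₂ w₂ : ℝ) :
    ∃ q : ℝ[X], q.natDegree ≤ 4 ∧ q.eval 1 = 0 ∧ q.eval x₁ = v₁ ∧
      (derivative q).eval x₁ = w₁ ∧ q.eval x₂ = v₂ ∧ (derivative q).eval x₂ = w₂ := by
  have k1 : x₁ - 1 ≠ 0 := by linarith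
  have k2 : x₂ - 1 ≠ 0 := by linarith
  have k3 : x₂ - x₁ ≠ 0 := by linarith
  -- In Newton form the interpolation conditions are triangular: each one involves a single new
  -- coefficient, with a nonzero factor.
  have solve : ∀ {k : ℝ} (c v : ℝ), k ≠ 0 → ∃ a, c + k * a = v := fun {k} c v hk =>
    ⟨(v - c) / k, by field_simp; ring⟩
  obtain ⟨α, hα⟩ := solve 0 v₁ k1
  obtain ⟨β, hβ⟩ := solve α w₁ k1
  obtain ⟨δ, hδ⟩ := solve ((x₂ - 1) * (α + β * (x₂ - x₁))) v₂
    (mul_ne_zero k2 (pow_ne_zero 2 k3))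
  obtain ⟨ε, hε⟩ := solve (α + β * (x₂ - x₁) + δ * (x₂ - x₁) ^ 2
    + (x₂ - 1) * (β + 2 * δ * (x₂ - x₁))) w₂ (mul_ne_zero k2 (pow_ne_zero 2 k3))
  refine ⟨(X - 1) * (C α + C β * (X - C x₁) + (X - C x₁) ^ 2 * (C δ + C ε * (X - C x₂))),
    ?_, ?_, ?_, ?_, ?_, ?_⟩
  · compute_degree
  · simp
  · simp; linarith
  · simp [derivative_pow]; linarith
  · simp; linarith
  · simp [derivative_pow]; linarith

end Hermite

/-! ### Quadrature bounds on the entropy in terms of moments -/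

section Quadrature

variable {γ : ℕ → ℝ}

/-- This is Jensen's inequality for −ln under the weight x: the minorant is the tangent at the
weighted mean γ₂/γ₁. In the application K is the integral of η over the outcomes. -/
theorem log_sub_le_bound2 {d : ℕ} (hd : 0 < d) (h1 : γ 1 = 1 / d) (h2 : 0 < γ 2) {K : ℝ}
    (hK : ∀ c₁ c₂ : ℝ, (∀ x, 0 < x → x ≤ 1 → c₁ + c₂ * x ≤ -Real.log x) →
      c₁ * γ 1 + c₂ * γ 2 ≤ K) :
    Real.log d - d * K ≤ bound2 d γ := by
  have hd' : (0 : ℝ) < d := by exact_mod_cast hd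
  have h1p : 0 < γ 1 := by rw [h1]; positivity
  have hx : 0 < γ 2 / γ 1 := div_pos h2 h1p
  have h := hK (-Real.log (γ 2 / γ 1) + 1) (-(γ 2 / γ 1)⁻¹) (fun x hx0 _ => by
    have := Real.log_le_sub_one_of_pos (div_pos hx0 hx)
    rw [Real.log_div hx0.ne' hx.ne', div_eq_inv_mul x] at this
    linarith)
  have e : (-(γ 2 / γ 1)⁻¹) * γ 2 = -γ 1 := by field_simp
  have h' : (-Real.log (γ 2 / γ 1)) * γ 1 ≤ K := by linarith
  have h3 := mul_le_mul_of_nonneg_left h' hd'.le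
  have e3 : d * ((-Real.log (γ 2 / γ 1)) * γ 1) = -Real.log (γ 2 / γ 1) := by
    rw [h1]; field_simp
  unfold bound2
  linarith

/-- The node x₁ is the mean of x under the weight x(1 − x). Therefore (x − 1)(x − x₁) has integral
zero against the weight x, and only α(x − 1) contributes to the bound. -/
theorem log_sub_le_bound3 {d : ℕ} (h12 : 0 < γ 1 - γ 2)
    (h23 : 0 < γ 2 - γ 3) (h123 : 0 < γ 1 - 2 * γ 2 + γ 3) {K : ℝ}
    (hK : ∀ c₁ c₂ c₃ : ℝ,
      (∀ x, 0 < x → x ≤ 1 → c₁ + c₂ * x + c₃ * x ^ 2 ≤ -Real.log x) →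
      c₁ * γ 1 + c₂ * γ 2 + c₃ * γ 3 ≤ K) :
    Real.log d - d * K ≤ bound3 d γ := by
  obtain ⟨x₁, hx₁⟩ : ∃ x₁, x₁ = (γ 2 - γ 3) / (γ 1 - γ 2) := ⟨_, rfl⟩
  have hx0 : 0 < x₁ := hx₁ ▸ div_pos h23 h12
  have hx1 : x₁ < 1 := by rw [hx₁, div_lt_one h12]; linarith
  have hk : x₁ - 1 ≠ 0 := by linarith
  obtain ⟨α, hα⟩ : ∃ α, (x₁ - 1) * α = -Real.log x₁ :=
    ⟨-Real.log x₁ / (x₁ - 1), by field_simp⟩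
  obtain ⟨β, hβ⟩ : ∃ β, α + (x₁ - 1) * β = -x₁⁻¹ :=
    ⟨(-x₁⁻¹ - α) / (x₁ - 1), by field_simp; ring⟩
  -- These are the monomial coefficients of (x − 1)(α + β(x − x₁)).
  have h := hK (-α + x₁ * β) (α - (1 + x₁) * β) β (fun x hx hx' => by
    have := eval_le_neg_log_of_radau
      ((Polynomial.X - 1) * (Polynomial.C α + Polynomial.C β * (Polynomial.X - Polynomial.C x₁)))
      (by compute_degree) hx0 hx1 (by simp) (by simpa using hα)
      (by simpa using hβ) hx hx'
    refine le_trans (le_of_eq ?_) this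
    simp
    ring)
  have e : x₁ * (γ 1 - γ 2) = γ 2 - γ 3 := by rw [hx₁]; field_simp
  have h' : -α * (γ 1 - γ 2) ≤ K := by
    refine le_trans (le_of_eq ?_) h
    linear_combination (-β) * e
  have h3 := mul_le_mul_of_nonneg_left h' (Nat.cast_nonneg d : (0 : ℝ) ≤ d)
  have e3 : (γ 1 - γ 2) ^ 2 / (γ 1 - 2 * γ 2 + γ 3) * Real.log x₁ = α * (γ 1 - γ 2) := by
    have hw : (γ 1 - γ 2) * (1 - x₁) = γ 1 - 2 * γ 2 + γ 3 := by linear_combination -e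
    rw [div_mul_eq_mul_div, div_eq_iff h123.ne', ← hw]
    linear_combination ((γ 1 - γ 2) ^ 2) * hα
  unfold bound3
  rw [← hx₁, mul_div_assoc, mul_assoc, e3]
  linarith

/-- A quadratic with a negative value has positive discriminant. -/
theorem discrim_pos_of_neg {a b c z : ℝ} (ha : 0 < a) (hz : a * z ^ 2 - b * z + c < 0) :
    0 < b ^ 2 - 4 * a * c := by
  nlinarith [mul_neg_of_pos_of_neg ha hz, sq_nonneg (2 * a * z - b)]

/-- The nodes are the roots of P(z) = a z² − b z + c, the quadratic orthogonal to 1 and z under the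
weight x. Positivity of the functional on suitable squares gives a, c > 0. Positive roots then
follow once P is negative somewhere on the half line. -/
theorem quadrature4
    (hpos : ∀ c₁ c₂ c₃ c₄ : ℝ, (c₁ ≠ 0 ∨ c₂ ≠ 0 ∨ c₃ ≠ 0 ∨ c₄ ≠ 0) →
      (∀ x, 0 ≤ x → x ≤ 1 → 0 ≤ c₁ * x + c₂ * x ^ 2 + c₃ * x ^ 3 + c₄ * x ^ 4) →
      0 < c₁ * γ 1 + c₂ * γ 2 + c₃ * γ 3 + c₄ * γ 4) :
    0 < γ 1 * γ 3 - γ 2 ^ 2 ∧ 0 < γ 2 * γ 4 - γ 3 ^ 2 ∧ 0 < disc4 γ ∧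
      √(disc4 γ) < γ 1 * γ 4 - γ 2 * γ 3 := by
  have g1 : 0 < γ 1 := by simpa using hpos 1 0 0 0 (by simp) (fun x hx _ => by simpa using hx)
  have g2 : 0 < γ 2 := by
    simpa using hpos 0 1 0 0 (by simp) (fun x hx _ => by simpa using pow_nonneg hx 2)
  have ha : 0 < γ 1 * γ 3 - γ 2 ^ 2 := by
    -- The test polynomial x(γ₁x − γ₂)² has integral γ₁(γ₁γ₃ − γ₂²).
    have h := hpos (γ 2 ^ 2) (-2 * γ 1 * γ 2) (γ 1 ^ 2) 0 (Or.inl (by positivity))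
      (fun x hx _ => by
        have : 0 ≤ x * (γ 1 * x - γ 2) ^ 2 := by positivity
        linarith)
    refine pos_of_mul_pos_right (a := γ 1) ?_ g1.le
    linarith
  have hc : 0 < γ 2 * γ 4 - γ 3 ^ 2 := by
    have h := hpos 0 (γ 3 ^ 2) (-2 * γ 2 * γ 3) (γ 2 ^ 2)
      (Or.inr (Or.inr (Or.inr (by positivity))))
      (fun x hx _ => by
        have : 0 ≤ x ^ 2 * (γ 2 * x - γ 3) ^ 2 := by positivity
        linarith)
    refine pos_of_mul_pos_right (a := γ 2) ?_ g2.le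
    linarith
  obtain ⟨a, ea⟩ : ∃ a, a = γ 1 * γ 3 - γ 2 ^ 2 := ⟨_, rfl⟩
  obtain ⟨b, eb⟩ : ∃ b, b = γ 1 * γ 4 - γ 2 * γ 3 := ⟨_, rfl⟩
  obtain ⟨c, ec⟩ : ∃ c, c = γ 2 * γ 4 - γ 3 ^ 2 := ⟨_, rfl⟩
  have hd : disc4 γ = b ^ 2 - 4 * a * c := by rw [ea, eb, ec]; unfold disc4; ring
  rw [hd]
  rw [← ea] at ha ⊢
  rw [← ec] at hc ⊢
  rw [← eb]
  -- Otherwise x P(x) would be nonnegative with strictly positive integral, while c γ₁ − b γ₂ + a γ₃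
  -- = 0 identically.
  obtain ⟨z, hz0, hz⟩ : ∃ z, 0 ≤ z ∧ a * z ^ 2 - b * z + c < 0 := by
    by_contra! hcon
    have h := hpos c (-b) a 0 (Or.inl hc.ne') (fun x hx _ => by
      have := mul_nonneg hx (hcon x hx)
      linarith)
    rw [ea, eb, ec] at h
    linarith
  have hdisc := discrim_pos_of_neg ha hz
  have hb : 0 < b := by
    refine pos_of_mul_pos_left (b := z) ?_ hz0
    nlinarith [sq_nonneg z]
  refine ⟨ha, hc, hdisc, ?_⟩
  rw [Real.sqrt_lt' hb]
  nlinarith [mul_pos ha hc]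

/-- The cubic interpolant is a chord plus (x − x₁)(x − x₂) times a linear factor. The two
orthogonality relations `o₁` and `o₂` remove the second part, so only the chord through the two
points on the graph of −ln enters C_4. -/
theorem log_sub_le_bound4 {d : ℕ} (hd : 0 < d) (h1 : γ 1 = 1 / d)
    (ha : 0 < γ 1 * γ 3 - γ 2 ^ 2) (hdisc : 0 < disc4 γ)
    (hs : √(disc4 γ) < γ 1 * γ 4 - γ 2 * γ 3) {K : ℝ}
    (hK : ∀ c₁ c₂ c₃ c₄ : ℝ,
      (∀ x, 0 < x → x ≤ 1 → c₁ + c₂ * x + c₃ * x ^ 2 + c₄ * x ^ 3 ≤ -Real.log x) →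
      c₁ * γ 1 + c₂ * γ 2 + c₃ * γ 3 + c₄ * γ 4 ≤ K) :
    Real.log d - d * K ≤ bound4 d γ := by
  have hd' : (0 : ℝ) < d := by exact_mod_cast hd
  obtain ⟨a, ea⟩ : ∃ a, a = γ 1 * γ 3 - γ 2 ^ 2 := ⟨_, rfl⟩
  obtain ⟨b, eb⟩ : ∃ b, b = γ 1 * γ 4 - γ 2 * γ 3 := ⟨_, rfl⟩
  obtain ⟨c, ec⟩ : ∃ c, c = γ 2 * γ 4 - γ 3 ^ 2 := ⟨_, rfl⟩
  obtain ⟨s, es⟩ : ∃ s, s = √(disc4 γ) := ⟨_, rfl⟩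
  have hs0 : 0 < s := es ▸ Real.sqrt_pos.mpr hdisc
  have hs2 : s ^ 2 = b ^ 2 - 4 * a * c := by
    rw [es, Real.sq_sqrt hdisc.le, ea, eb, ec]; unfold disc4; ring
  rw [← ea] at ha
  rw [← es, ← eb] at hs
  obtain ⟨x₁, e₁⟩ : ∃ x₁, x₁ = (b - s) / (2 * a) := ⟨_, rfl⟩
  obtain ⟨x₂, e₂⟩ : ∃ x₂, x₂ = (b + s) / (2 * a) := ⟨_, rfl⟩
  have p₁ : 0 < x₁ := e₁ ▸ div_pos (by linarith) (by linarith)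
  have p₂ : 0 < x₂ := e₂ ▸ div_pos (by linarith) (by linarith)
  have m₁ : 2 * a * x₁ = b - s := by rw [e₁]; field_simp
  have m₂ : 2 * a * x₂ = b + s := by rw [e₂]; field_simp
  have h12 : x₁ < x₂ := by rw [e₁, e₂]; gcongr; linarith
  have mS : a * (x₁ + x₂) = b := by linarith
  have mD : a * (x₂ - x₁) = s := by linarith
  have mP : a * (x₁ * x₂) = c := by
    have : 4 * a * (a * (x₁ * x₂)) = 4 * a * c := by
      linear_combination (2 * a * x₂) * m₁ + (b - s) * m₂ - hs2
    exact mul_left_cancel₀ (by positivity) this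
  have hk : x₂ - x₁ ≠ 0 := by linarith
  obtain ⟨β, hβ⟩ : ∃ β, -Real.log x₁ + (x₂ - x₁) * β = -Real.log x₂ :=
    ⟨(Real.log x₁ - Real.log x₂) / (x₂ - x₁), by field_simp; ring⟩
  obtain ⟨δ, hδ⟩ : ∃ δ, β + (x₁ - x₂) * δ = -x₁⁻¹ :=
    ⟨(x₁⁻¹ + β) / (x₂ - x₁), by field_simp; ring⟩
  obtain ⟨ε, hε⟩ : ∃ ε, β + (x₂ - x₁) * (δ + ε * (x₂ - x₁)) = -x₂⁻¹ :=
    ⟨((-x₂⁻¹ - β) / (x₂ - x₁) - δ) / (x₂ - x₁), by field_simp; ring⟩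
  -- Monomial coefficients of −ln x₁ + β(x − x₁) + (x − x₁)(x − x₂)(δ + ε(x − x₁)).
  have h := hK (-Real.log x₁ - β * x₁ + x₁ * x₂ * (δ - ε * x₁))
    (β + x₁ * x₂ * ε - (x₁ + x₂) * (δ - ε * x₁)) (δ - ε * x₁ - (x₁ + x₂) * ε) ε
    (fun x hx _ => by
      have := eval_le_neg_log_of_gauss
        (Polynomial.C (-Real.log x₁) + Polynomial.C β * (Polynomial.X - Polynomial.C x₁)
          + (Polynomial.X - Polynomial.C x₁) * (Polynomial.X - Polynomial.C x₂)
            * (Polynomial.C δ + Polynomial.C ε * (Polynomial.X - Polynomial.C x₁)))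
        (by compute_degree) p₁ h12 (by simp) (by simp; linarith)
        (by simp; linarith) (by simp; linarith) hx
      refine le_trans (le_of_eq ?_) this
      simp
      ring)
  have o₁ : x₁ * x₂ * γ 1 - (x₁ + x₂) * γ 2 + γ 3 = 0 := by
    refine mul_left_cancel₀ ha.ne' ?_
    have : c * γ 1 - b * γ 2 + a * γ 3 = 0 := by rw [ea, eb, ec]; ring
    linear_combination γ 1 * mP - γ 2 * mS + this
  have o₂ : x₁ * x₂ * γ 2 - (x₁ + x₂) * γ 3 + γ 4 = 0 := by
    refine mul_left_cancel₀ ha.ne' ?_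
    have : c * γ 2 - b * γ 3 + a * γ 4 = 0 := by rw [ea, eb, ec]; ring
    linear_combination γ 2 * mP - γ 3 * mS + this
  have h' : -Real.log x₁ * γ 1 + β * (γ 2 - x₁ * γ 1) ≤ K := by
    refine le_trans (le_of_eq ?_) h
    linear_combination (-(δ - ε * x₁)) * o₁ - ε * o₂
  have h3 := mul_le_mul_of_nonneg_left h' hd'.le
  have hd1 : (d : ℝ) * γ 1 = 1 := by rw [h1]; field_simp
  have l₁ : Real.log ((γ 3 ^ 2 - γ 2 * γ 4) / (γ 2 ^ 2 - γ 1 * γ 3))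
      = Real.log x₁ + Real.log x₂ := by
    rw [← Real.log_mul p₁.ne' p₂.ne']
    congr 1
    rw [show γ 3 ^ 2 - γ 2 * γ 4 = -c by rw [ec]; ring,
      show γ 2 ^ 2 - γ 1 * γ 3 = -a by rw [ea]; ring, neg_div_neg_eq, ← mP]
    field_simp
  have l₂ : Real.log ((γ 2 * γ 3 - γ 1 * γ 4 + √(disc4 γ)) / (γ 2 * γ 3 - γ 1 * γ 4 - √(disc4 γ)))
      = Real.log x₁ - Real.log x₂ := by
    rw [← Real.log_div p₁.ne' p₂.ne', ← es]
    congr 1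
    rw [show γ 2 * γ 3 - γ 1 * γ 4 + s = -(b - s) by rw [eb]; ring,
      show γ 2 * γ 3 - γ 1 * γ 4 - s = -(b + s) by rw [eb]; ring, neg_div_neg_eq, ← m₁, ← m₂]
    field_simp
  have hN : (d : ℝ) * (γ 1 ^ 2 * γ 4 - 3 * γ 1 * γ 2 * γ 3 + 2 * γ 2 ^ 3)
      = b - 2 * (d * γ 2 * a) := by
    rw [ea, eb]
    linear_combination (γ 1 * γ 4 - γ 2 * γ 3) * hd1
  unfold bound4
  rw [l₁, l₂, ← es, hN]
  have key : 1 / 2 * (Real.log x₁ + Real.log x₂)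
      + (b - 2 * (d * γ 2 * a)) / (2 * s) * (Real.log x₁ - Real.log x₂)
      = -(d * (-Real.log x₁ * γ 1 + β * (γ 2 - x₁ * γ 1))) := by
    have hβ' : Real.log x₁ - Real.log x₂ = (x₂ - x₁) * β := by linarith
    have e : (b - 2 * (d * γ 2 * a)) / (2 * s) * (Real.log x₁ - Real.log x₂)
        = (b - 2 * (d * γ 2 * a)) * β / (2 * a) := by
      rw [hβ', ← mD]; field_simp
    rw [e, ← mS]
    field_simp
    linear_combination -hβ' - 2 * Real.log x₁ * hd1 - 2 * β * x₁ * hd1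
  linarith

/-- Factoring out the fixed node 1 leaves two Gauss nodes for the weight x(1 − x), whose moments are
the differences ν_k = γ_{k+1} − γ_{k+2}. The argument of `quadrature4` is repeated with these; the
value a − b + c of the node polynomial at 1 must also be positive to keep the nodes below 1. -/
theorem quadrature5
    (hpos : ∀ c₁ c₂ c₃ c₄ c₅ : ℝ, (c₁ ≠ 0 ∨ c₂ ≠ 0 ∨ c₃ ≠ 0 ∨ c₄ ≠ 0 ∨ c₅ ≠ 0) →
      (∀ x, 0 ≤ x → x ≤ 1 →
        0 ≤ c₁ * x + c₂ * x ^ 2 + c₃ * x ^ 3 + c₄ * x ^ 4 + c₅ * x ^ 5) →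
      0 < c₁ * γ 1 + c₂ * γ 2 + c₃ * γ 3 + c₄ * γ 4 + c₅ * γ 5) :
    den5 γ < 0 ∧ 0 < disc5 γ ∧ 0 < node5p γ ∧ node5p γ < node5m γ ∧ node5m γ < 1 := by
  obtain ⟨ν₀, e₀⟩ : ∃ ν, ν = γ 1 - γ 2 := ⟨_, rfl⟩
  obtain ⟨ν₁, e₁⟩ : ∃ ν, ν = γ 2 - γ 3 := ⟨_, rfl⟩
  obtain ⟨ν₂, e₂⟩ : ∃ ν, ν = γ 3 - γ 4 := ⟨_, rfl⟩
  obtain ⟨ν₃, e₃⟩ : ∃ ν, ν = γ 4 - γ 5 := ⟨_, rfl⟩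
  have hν : ∀ c₀ c₁ c₂ c₃ : ℝ, (c₀ ≠ 0 ∨ c₃ ≠ 0) →
      (∀ x, 0 ≤ x → x ≤ 1 → 0 ≤ x * (1 - x) * (c₀ + c₁ * x + c₂ * x ^ 2 + c₃ * x ^ 3)) →
      0 < c₀ * ν₀ + c₁ * ν₁ + c₂ * ν₂ + c₃ * ν₃ := by
    intro c₀ c₁ c₂ c₃ hne h
    have := hpos c₀ (c₁ - c₀) (c₂ - c₁) (c₃ - c₂) (-c₃)
      (hne.elim Or.inl fun h => Or.inr (Or.inr (Or.inr (Or.inr (neg_ne_zero.mpr h)))))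
      (fun x hx hx' => by linarith [h x hx hx'])
    rw [e₀, e₁, e₂, e₃]
    linarith
  have n₀ : 0 < ν₀ := by
    simpa using hν 1 0 0 0 (by simp) (fun x hx hx' => by
      simpa using mul_nonneg hx (sub_nonneg.mpr hx'))
  have n₁ : 0 < ν₁ := by
    have := hpos 0 1 (-1) 0 0 (by simp) (fun x hx hx' => by
      have : 0 ≤ x * (x * (1 - x)) := mul_nonneg hx (mul_nonneg hx (sub_nonneg.mpr hx'))
      linarith)
    linarith
  have n₀₁ : 0 < ν₀ - ν₁ := by
    have := hpos 1 (-2) 1 0 0 (by simp) (fun x hx hx' => by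
      have : 0 ≤ x * (1 - x) ^ 2 := mul_nonneg hx (sq_nonneg _)
      linarith)
    linarith
  obtain ⟨a, ea⟩ : ∃ a, a = ν₀ * ν₂ - ν₁ ^ 2 := ⟨_, rfl⟩
  obtain ⟨b, eb⟩ : ∃ b, b = ν₀ * ν₃ - ν₁ * ν₂ := ⟨_, rfl⟩
  obtain ⟨c, ec⟩ : ∃ c, c = ν₁ * ν₃ - ν₂ ^ 2 := ⟨_, rfl⟩
  have ha : 0 < a := by
    have h := hν (ν₁ ^ 2) (-2 * ν₀ * ν₁) (ν₀ ^ 2) 0 (Or.inl (by positivity))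
      (fun x hx hx' => by
        have : 0 ≤ x * (1 - x) * (ν₀ * x - ν₁) ^ 2 :=
          mul_nonneg (mul_nonneg hx (sub_nonneg.mpr hx')) (sq_nonneg _)
        linarith)
    refine pos_of_mul_pos_right (a := ν₀) ?_ n₀.le
    rw [ea]
    linarith
  have hc : 0 < c := by
    have h := hν 0 (ν₂ ^ 2) (-2 * ν₁ * ν₂) (ν₁ ^ 2) (Or.inr (by positivity))
      (fun x hx hx' => by
        have : 0 ≤ x * (1 - x) * (x * (ν₁ * x - ν₂) ^ 2) :=
          mul_nonneg (mul_nonneg hx (sub_nonneg.mpr hx')) (mul_nonneg hx (sq_nonneg _))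
        linarith)
    refine pos_of_mul_pos_right (a := ν₁) ?_ n₁.le
    rw [ec]
    linarith
  have habc : 0 < a - b + c := by
    obtain ⟨u, hu⟩ : ∃ u, u = ν₀ - ν₁ := ⟨_, rfl⟩
    obtain ⟨v, hv⟩ : ∃ v, v = ν₁ - ν₂ := ⟨_, rfl⟩
    rw [← hu] at n₀₁
    -- The coefficients are those of (1 − x)(u x − v)², whose integral against x(1 − x) is u(a − b +
    -- c).
    have h := hν (v ^ 2) (-(v ^ 2) - 2 * u * v) (u ^ 2 + 2 * u * v) (-u ^ 2)
      (Or.inr (by simpa using n₀₁.ne'))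
      (fun x hx hx' => by
        have : 0 ≤ x * (1 - x) * ((1 - x) * (u * x - v) ^ 2) :=
          mul_nonneg (mul_nonneg hx (sub_nonneg.mpr hx'))
            (mul_nonneg (sub_nonneg.mpr hx') (sq_nonneg _))
        linarith)
    refine pos_of_mul_pos_right (a := u) ?_ n₀₁.le
    refine lt_of_lt_of_eq h ?_
    rw [ea, eb, ec, hv, hu]
    ring
  obtain ⟨z, hz0, hz1, hz⟩ : ∃ z, 0 ≤ z ∧ z ≤ 1 ∧ a * z ^ 2 - b * z + c < 0 := by
    by_contra! hcon
    have h := hν c (-b) a 0 (Or.inl hc.ne') (fun x hx hx' => by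
      have := mul_nonneg (mul_nonneg hx (sub_nonneg.mpr hx')) (hcon x hx hx')
      linarith)
    rw [ea, eb, ec] at h
    linarith
  have hb : 0 < b := by
    refine pos_of_mul_pos_left (b := z) ?_ hz0
    nlinarith [sq_nonneg z]
  have hb' : 0 < 2 * a - b := by
    refine pos_of_mul_pos_left (b := 1 - z) ?_ (sub_nonneg.mpr hz1)
    nlinarith [sq_nonneg (1 - z)]
  have hdisc := discrim_pos_of_neg ha hz
  have hden : den5 γ = -a := by rw [ea, e₀, e₁, e₂]; unfold den5; ring
  have hnum : num5 γ = -b := by rw [eb, e₀, e₁, e₂, e₃]; unfold num5; ring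
  have hd5 : disc5 γ = b ^ 2 - 4 * a * c := by
    rw [ea, eb, ec, e₀, e₁, e₂, e₃]; unfold disc5; ring
  have hac := mul_pos ha hc
  -- The denominator is −2a, so the sign + of the root yields the smaller node.
  have hp : node5p γ = (b - √(b ^ 2 - 4 * a * c)) / (2 * a) := by
    unfold node5p
    rw [hden, hnum, hd5, ← neg_div_neg_eq]
    ring_nf
  have hm : node5m γ = (b + √(b ^ 2 - 4 * a * c)) / (2 * a) := by
    unfold node5m
    rw [hden, hnum, hd5, ← neg_div_neg_eq]
    ring_nf
  have hs : 0 < √(b ^ 2 - 4 * a * c) := Real.sqrt_pos.mpr hdisc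
  have hsb : √(b ^ 2 - 4 * a * c) < b := by
    rw [Real.sqrt_lt' hb]
    linarith
  have hsb' : √(b ^ 2 - 4 * a * c) < 2 * a - b := by
    rw [Real.sqrt_lt' hb']
    -- The difference of the squares is (2a − b)² − (b² − 4ac) = 4a(a − b + c).
    nlinarith [mul_pos ha habc]
  rw [hden, hp, hm, hd5]
  refine ⟨by linarith, hdisc, div_pos (by linarith) (by linarith), ?_, ?_⟩
  · gcongr
    linarith
  · rw [div_lt_one (by linarith)]
    linarith

/-- Multiplying a Gauss–Radau interpolant of −ln by x yields the node 0 for free and preserves the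
inequality on [0, 1]. -/
theorem exists_isHermite5 {x₁ x₂ : ℝ} (h0 : 0 < x₁) (h12 : x₁ < x₂) (h21 : x₂ < 1) :
    ∃ r : Polynomial ℝ, IsHermite5 r x₁ x₂ ∧ r.coeff 0 = 0 ∧
      ∀ x, 0 ≤ x → x ≤ 1 → r.eval x ≤ Real.negMulLog x := by
  have h2 : 0 < x₂ := h0.trans h12
  obtain ⟨q, hq, q1, v₁, w₁, v₂, w₂⟩ := exists_hermite_gauss_radau h12 h21
    (-Real.log x₁) (-x₁⁻¹) (-Real.log x₂) (-x₂⁻¹)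
  have hdeg : (Polynomial.X * q).natDegree ≤ 5 :=
    Polynomial.natDegree_mul_le.trans (by rw [Polynomial.natDegree_X]; omega)
  refine ⟨Polynomial.X * q, ⟨hdeg, by simp, by simp [q1], ⟨?_, ?_⟩, ?_, ?_⟩, by simp,
    fun x hx hx' => ?_⟩
  · simp [v₁, Real.negMulLog]
  · rw [Real.deriv_negMulLog h0.ne']
    simp [v₁, w₁, h0.ne']
    ring
  · simp [v₂, Real.negMulLog]
  · rw [Real.deriv_negMulLog h2.ne']
    simp [v₂, w₂, h2.ne']
    ring
  · rcases hx.eq_or_lt with rfl | hx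
    · simp
    · have := eval_le_neg_log_of_gauss_radau q hq h0 h12 h21 q1 v₁ w₁ v₂ w₂ hx hx'
      have := mul_le_mul_of_nonneg_left this hx.le
      simpa [Real.negMulLog] using this

end Quadrature

/-! ### Tensor products and partial traces -/

section Tensor

open Matrix

theorem exists_conjTranspose_mul_self {ι : Type*} [Fintype ι] {M : Matrix ι ι ℂ}
    (hM : M.PosSemidef) : ∃ B : Matrix ι ι ℂ, M = Bᴴ * B := by
  classical
  open scoped MatrixOrder in
  exact CStarAlgebra.nonneg_iff_eq_star_mul_self.mp hM.nonneg

theorem tensorProd_conjTranspose {ι : Type*} {n : ℕ} (M : Fin n → Matrix ι ι ℂ) :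
    (tensorProd M)ᴴ = tensorProd fun k => (M k)ᴴ := by
  ext f g
  simp [tensorProd, conjTranspose_apply]

variable {ι : Type*} [Fintype ι]

theorem tensorProd_mul {n : ℕ} (M N : Fin n → Matrix ι ι ℂ) :
    tensorProd M * tensorProd N = tensorProd fun k => M k * N k := by
  classical
  ext f g
  simp only [tensorProd, mul_apply, of_apply, ← Finset.prod_mul_distrib]
  rw [Finset.prod_univ_sum]
  simp

theorem posSemidef_tensorProd {n : ℕ} {M : Fin n → Matrix ι ι ℂ}
    (hM : ∀ k, (M k).PosSemidef) : (tensorProd M).PosSemidef := by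
  classical
  choose B hB using fun k => exists_conjTranspose_mul_self (hM k)
  rw [show M = fun k => (B k)ᴴ * B k from funext hB, ← tensorProd_mul,
    ← tensorProd_conjTranspose]
  exact posSemidef_conjTranspose_mul_self _

/-- The partial trace of `ρ (M ⊗ 1)` over the first factor. -/
def contractLeft {α β : Type*} [Fintype α] (ρ : Matrix (α × β) (α × β) ℂ) (M : Matrix α α ℂ) :
    Matrix β β ℂ :=
  of fun f g => ∑ i, ∑ j, ρ (i, f) (j, g) * M j i

/-- Contraction with a rank one operator is a compression W†ρW, where W tensors with a fixed vector
of the first factor. General positive M follow by writing M = B†B as a sum over the rows of B. -/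
theorem posSemidef_contractLeft_vecMulVec {α β : Type*} [Fintype α] [Fintype β]
    {ρ : Matrix (α × β) (α × β) ℂ} (hρ : ρ.PosSemidef) (b : α → ℂ) :
    (contractLeft ρ (vecMulVec (star b) b)).PosSemidef := by
  classical
  have h : contractLeft ρ (vecMulVec (star b) b)
      = (of fun (x : α × β) f => if x.2 = f then star (b x.1) else 0 : Matrix (α × β) β ℂ)ᴴ * ρ
        * (of fun (x : α × β) f => if x.2 = f then star (b x.1) else 0) := by
    ext f g
    simp only [contractLeft, of_apply, mul_apply, conjTranspose_apply, vecMulVec_apply,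
      Fintype.sum_prod_type, apply_ite star, star_star, star_zero, ite_mul, zero_mul, mul_ite,
      mul_zero, Finset.sum_ite_eq', Finset.mem_univ, if_true, Finset.sum_mul, Pi.star_apply]
    rw [Finset.sum_comm]
    refine Finset.sum_congr rfl fun j _ => Finset.sum_congr rfl fun i _ => ?_
    ring
  rw [h]
  exact hρ.conjTranspose_mul_mul_same _

theorem posSemidef_contractLeft {α β : Type*} [Fintype α] [Fintype β]
    {ρ : Matrix (α × β) (α × β) ℂ} {M : Matrix α α ℂ} (hρ : ρ.PosSemidef) (hM : M.PosSemidef) :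
    (contractLeft ρ M).PosSemidef := by
  obtain ⟨B, rfl⟩ := exists_conjTranspose_mul_self hM
  have h : contractLeft ρ (Bᴴ * B) = ∑ k, contractLeft ρ (vecMulVec (star (B k)) (B k)) := by
    ext f g
    rw [Matrix.sum_apply]
    simp only [contractLeft, of_apply, mul_apply, conjTranspose_apply, vecMulVec_apply,
      Pi.star_apply, Finset.mul_sum]
    rw [Finset.sum_comm]
    conv_rhs => rw [Finset.sum_comm]
    rw [Finset.sum_comm]
    refine Finset.sum_congr rfl fun i _ => ?_
    rw [Finset.sum_comm]
  rw [h]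
  exact posSemidef_sum _ fun k _ => posSemidef_contractLeft_vecMulVec hρ _

/-- An operator on `(ℂ^ι)^{⊗ (n + 1)}` as an operator on `ℂ^ι ⊗ (ℂ^ι)^{⊗ n}`. -/
def splitFirst {n : ℕ} (ρ : Matrix (Fin (n + 1) → ι) (Fin (n + 1) → ι) ℂ) :
    Matrix (ι × (Fin n → ι)) (ι × (Fin n → ι)) ℂ :=
  ρ.submatrix (fun x => Fin.cons x.1 x.2) fun x => Fin.cons x.1 x.2

theorem sum_fin_cons {n : ℕ} {R : Type*} [AddCommMonoid R] (F : (Fin (n + 1) → ι) → R) :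
    ∑ f, F f = ∑ i, ∑ f : Fin n → ι, F (Fin.cons i f) := by
  rw [← Fintype.sum_prod_type' fun i (f : Fin n → ι) => F (Fin.cons i f)]
  exact (Equiv.sum_comp (Fin.consEquiv fun _ : Fin (n + 1) => ι) F).symm

/-- The contraction is the unnormalized state of the last n factors, conditioned on the effect M in
the first. This identity drives the induction over the number of copies. -/
theorem trace_mul_tensorProd_cons {n : ℕ} (ρ : Matrix (Fin (n + 1) → ι) (Fin (n + 1) → ι) ℂ)
    (M : Matrix ι ι ℂ) (N : Fin n → Matrix ι ι ℂ) :
    (ρ * tensorProd (Fin.cons M N : Fin (n + 1) → Matrix ι ι ℂ)).trace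
      = (contractLeft (splitFirst ρ) M * tensorProd N).trace := by
  simp only [trace, diag_apply, mul_apply, sum_fin_cons, tensorProd, of_apply, contractLeft,
    splitFirst, submatrix_apply, Fin.prod_univ_succ, Fin.cons_zero, Fin.cons_succ,
    Finset.sum_mul]
  rw [Finset.sum_comm]
  refine Finset.sum_congr rfl fun f _ => ?_
  simp only [← mul_assoc]
  conv_rhs => rw [Finset.sum_comm]
  refine Finset.sum_congr rfl fun i _ => ?_
  rw [Finset.sum_comm]

/-- The partial trace over all factors but the first. -/
def reduceFirst {n : ℕ} (ρ : Matrix (Fin (n + 1) → ι) (Fin (n + 1) → ι) ℂ) : Matrix ι ι ℂ :=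
  of fun i j => ∑ f : Fin n → ι, ρ (Fin.cons i f) (Fin.cons j f)

theorem trace_contractLeft_splitFirst {n : ℕ}
    (ρ : Matrix (Fin (n + 1) → ι) (Fin (n + 1) → ι) ℂ) (M : Matrix ι ι ℂ) :
    (contractLeft (splitFirst ρ) M).trace = (reduceFirst ρ * M).trace := by
  simp only [trace, diag_apply, mul_apply, contractLeft, of_apply, splitFirst, submatrix_apply,
    reduceFirst, Finset.sum_mul]
  rw [Finset.sum_comm]
  refine Finset.sum_congr rfl fun f _ => ?_
  rw [Finset.sum_comm]

theorem trace_reduceFirst {n : ℕ} (ρ : Matrix (Fin (n + 1) → ι) (Fin (n + 1) → ι) ℂ) :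
    (reduceFirst ρ).trace = ρ.trace := by
  simp only [trace, diag_apply, reduceFirst, of_apply]
  exact (sum_fin_cons fun f => ρ f f).symm

theorem posSemidef_reduceFirst {n : ℕ} {ρ : Matrix (Fin (n + 1) → ι) (Fin (n + 1) → ι) ℂ}
    (hρ : ρ.PosSemidef) : (reduceFirst ρ).PosSemidef := by
  classical
  have h : reduceFirst ρ = contractLeft ((splitFirst ρ).submatrix Prod.swap Prod.swap) 1 := by
    ext i j
    simp [reduceFirst, contractLeft, splitFirst, one_apply]
  rw [h]
  exact posSemidef_contractLeft ((hρ.submatrix _ : (splitFirst ρ).PosSemidef).submatrix _) PosSemidef.one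

end Tensor

/-! ### Spectral decomposition of positive matrices -/

section Spectral

open Matrix

variable {ι : Type*} [Fintype ι]

theorem exists_unitary_diagonal [DecidableEq ι] {M : Matrix ι ι ℂ} (hM : M.PosSemidef) :
    ∃ (V : Matrix.unitaryGroup ι ℂ) (l : ι → ℝ), (∀ i, 0 ≤ l i) ∧
      M = (V : Matrix ι ι ℂ) * diagonal (fun i => (l i : ℂ)) * star (V : Matrix ι ι ℂ) := by
  refine ⟨hM.1.eigenvectorUnitary, hM.1.eigenvalues, hM.eigenvalues_nonneg, ?_⟩
  have h := hM.1.spectral_theorem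
  rw [Unitary.conjStarAlgAut_apply] at h
  exact h

theorem trace_unitary_conj [DecidableEq ι] (V : Matrix.unitaryGroup ι ℂ) (N : Matrix ι ι ℂ) :
    ((V : Matrix ι ι ℂ) * N * star (V : Matrix ι ι ℂ)).trace = N.trace := by
  rw [trace_mul_cycle, Unitary.coe_star_mul_self, one_mul]

theorem norm_apply_le_one_of_isState {M : Matrix ι ι ℂ} (hM : IsState M) (i j : ι) :
    ‖M i j‖ ≤ 1 := by
  classical
  obtain ⟨V, l, hl, rfl⟩ := exists_unitary_diagonal hM.1
  have ht := hM.2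
  rw [trace_unitary_conj, trace_diagonal] at ht
  have ht' : ∑ k, l k = 1 := by exact_mod_cast ht
  rw [mul_apply]
  refine (norm_sum_le _ _).trans ?_
  rw [← ht']
  refine Finset.sum_le_sum fun k _ => ?_
  rw [mul_diagonal, norm_mul, norm_mul, star_apply, norm_star, Complex.norm_real,
    Real.norm_of_nonneg (hl k)]
  have h1 := entry_norm_bound_of_unitary V.2 i k
  have h2 := entry_norm_bound_of_unitary V.2 j k
  calc ‖(V : Matrix ι ι ℂ) i k‖ * l k * ‖(V : Matrix ι ι ℂ) j k‖ ≤ 1 * l k * 1 := by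
        gcongr
        exact mul_nonneg zero_le_one (hl k)
        exact hl k
    _ = l k := by ring

theorem trace_mul_nonneg {M N : Matrix ι ι ℂ} (hM : M.PosSemidef) (hN : N.PosSemidef) :
    0 ≤ (M * N).trace := by
  obtain ⟨B, rfl⟩ := exists_conjTranspose_mul_self hN
  rw [← mul_assoc, trace_mul_comm, ← mul_assoc]
  exact (hM.mul_mul_conjTranspose_same B).trace_nonneg

/-- The expectation value in a positive matrix is a positive combination of expectation values in
pure states. -/
theorem exists_trace_mul_eq_sum {M : Matrix ι ι ℂ} (hM : M.PosSemidef) :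
    ∃ (l : ι → ℝ) (v : ι → ι → ℂ), (∀ i, 0 ≤ l i) ∧ (∑ i, l i = M.trace.re) ∧
      (∀ i, star (v i) ⬝ᵥ v i = 1) ∧
      ∀ N : Matrix ι ι ℂ, (M * N).trace.re = ∑ i, l i * (star (v i) ⬝ᵥ N *ᵥ v i).re := by
  classical
  obtain ⟨V, l, hl, rfl⟩ := exists_unitary_diagonal hM
  refine ⟨l, fun i k => (V : Matrix ι ι ℂ) k i, hl, ?_, fun i => ?_, fun N => ?_⟩
  · rw [trace_unitary_conj, trace_diagonal]
    simp
  · have h := congrFun (congrFun (Unitary.coe_star_mul_self V) i) i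
    rw [one_apply_eq] at h
    rw [← h]
    simp [mul_apply, dotProduct, star_apply]
  · rw [mul_assoc, mul_assoc, ← mul_assoc, trace_mul_comm, ← mul_assoc, trace_mul_comm, ← mul_assoc]
    rw [trace, Complex.re_sum]
    refine Finset.sum_congr rfl fun i _ => ?_
    rw [diag_apply, mul_assoc, diagonal_mul, Complex.re_ofReal_mul]
    simp only [mul_apply, dotProduct, mulVec, star_apply, Pi.star_apply, Finset.sum_mul,
      Finset.mul_sum]
    rw [Finset.sum_comm]
    simp only [mul_assoc]

end Spectral

/-! ### Relative entropy of a joint law -/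

section Entropy

theorem integrable_comp_of_bounded {Y : Type*} [MeasurableSpace Y] {Q : Measure Y}
    [IsFiniteMeasure Q] {F : ℝ → ℝ} (hF : Continuous F) {f : Y → ℝ} (hf : Measurable f) {B : ℝ}
    (hB : ∀ y, |f y| ≤ B) : Integrable (fun y => F (f y)) Q := by
  obtain ⟨C, hC⟩ := (isCompact_Icc (a := -B) (b := B)).exists_bound_of_continuousOn hF.continuousOn
  exact Integrable.of_bound (hF.measurable.comp hf).aestronglyMeasurable C
    (Filter.Eventually.of_forall fun y => hC _ (abs_le.mp (hB y)))

theorem integrable_of_bounded {Y : Type*} [MeasurableSpace Y] {Q : Measure Y}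
    [IsFiniteMeasure Q] {f : Y → ℝ} (hf : Measurable f) {B : ℝ}
    (hB : ∀ y, |f y| ≤ B) : Integrable f Q :=
  integrable_comp_of_bounded continuous_id hf hB

variable {X Y : Type*} [MeasurableSpace X] [MeasurableSpace Y]

/-- The marginals are P and m Q with m(y) = ∫ f(x, y) dP(x), so the mutual information equals ∫ f ln
f − ∫ m ln m. The second integral is nonnegative, since t ln t ≥ t − 1 and m integrates to 1. -/
theorem mutualInfo_withDensity_le {P : Measure X} {Q : Measure Y} [IsProbabilityMeasure P]
    [IsProbabilityMeasure Q] {f : X × Y → ℝ} (hf : Measurable f) (h0 : ∀ z, 0 ≤ f z) {B : ℝ}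
    (hB : ∀ z, f z ≤ B) (h1 : ∀ x, ∫ y, f (x, y) ∂Q = 1) {K : ℝ}
    (hK : ∀ x, ∫ y, f (x, y) * Real.log (f (x, y)) ∂Q ≤ K) :
    mutualInfo ((P.prod Q).withDensity fun z => ENNReal.ofReal (f z)) ≤ ENNReal.ofReal K := by
  have habs : ∀ z, |f z| ≤ B := fun z => by rw [abs_of_nonneg (h0 z)]; exact hB z
  have hfx : ∀ x, Measurable fun y => f (x, y) := fun x => hf.comp (by fun_prop)
  have hfy : ∀ y, Measurable fun x => f (x, y) := fun y => hf.comp (by fun_prop)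
  have hfi : Integrable f (P.prod Q) := integrable_of_bounded hf habs
  obtain ⟨m, hm⟩ : ∃ m : Y → ℝ, m = fun y => ∫ x, f (x, y) ∂P := ⟨_, rfl⟩
  have hmm : Measurable m := by
    rw [hm]
    exact (hf.stronglyMeasurable.integral_prod_left' (μ := P)).measurable
  have hm0 : ∀ y, 0 ≤ m y := fun y => by rw [hm]; exact integral_nonneg fun x => h0 _
  have hmB : ∀ y, |m y| ≤ B := fun y => by
    rw [abs_of_nonneg (hm0 y), hm]
    calc ∫ x, f (x, y) ∂P ≤ ∫ _, B ∂P :=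
          integral_mono (integrable_of_bounded (hfy y) fun x => habs _) (integrable_const B)
            fun x => hB _
      _ = B := by simp
  have hmE : ∀ y, ∫⁻ x, ENNReal.ofReal (f (x, y)) ∂P = ENNReal.ofReal (m y) := fun y => by
    rw [hm, ofReal_integral_eq_lintegral_ofReal
      (integrable_of_bounded (hfy y) fun x => habs _) (Filter.Eventually.of_forall fun x => h0 _)]
  have hE1 : ∀ x, ∫⁻ y, ENNReal.ofReal (f (x, y)) ∂Q = 1 := fun x => by
    rw [← ofReal_integral_eq_lintegral_ofReal
      (integrable_of_bounded (hfx x) fun y => habs _) (Filter.Eventually.of_forall fun y => h0 _),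
      h1, ENNReal.ofReal_one]
  obtain ⟨J, hJ⟩ : ∃ J, J = (P.prod Q).withDensity fun z => ENNReal.ofReal (f z) := ⟨_, rfl⟩
  have hfst : J.map Prod.fst = P := by
    ext s hs
    rw [Measure.map_apply measurable_fst hs, hJ, withDensity_apply _ (measurable_fst hs),
      ← Set.prod_univ, ← Measure.prod_restrict, lintegral_prod _ (by fun_prop)]
    simp [hE1]
  have hsnd : J.map Prod.snd = Q.withDensity fun y => ENNReal.ofReal (m y) := by
    ext s hs
    rw [Measure.map_apply measurable_snd hs, hJ, withDensity_apply _ (measurable_snd hs),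
      ← Set.univ_prod, ← Measure.prod_restrict, lintegral_prod_symm _ (by fun_prop),
      withDensity_apply _ hs]
    simp [hmE]
  have hJ1 : J Set.univ = 1 := by
    rw [← Set.preimage_univ (f := Prod.fst), ← Measure.map_apply measurable_fst .univ, hfst]
    simp
  have : IsProbabilityMeasure J := ⟨hJ1⟩
  have hm1 : IsProbabilityMeasure (Q.withDensity fun y => ENNReal.ofReal (m y)) := by
    rw [← hsnd]
    exact Measure.isProbabilityMeasure_map measurable_snd.aemeasurable
  have hR : (J.map Prod.fst).prod (J.map Prod.snd)
      = (P.prod Q).withDensity fun z => ENNReal.ofReal (m z.2) := by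
    rw [hfst, hsnd, prod_withDensity_right (by fun_prop)]
  -- This gives absolute continuity with respect to the product of the marginals and makes the
  -- convention f/0 = 0 harmless.
  have hzero : ∀ᵐ z ∂(P.prod Q), m z.2 = 0 → f z = 0 := by
    have hset : MeasurableSet {z : X × Y | m z.2 = 0 → f z = 0} := by
      have e : {z : X × Y | m z.2 = 0 → f z = 0}
          = {z | m z.2 = 0}ᶜ ∪ {z | f z = 0} := by
        ext z
        simp [imp_iff_not_or]
      rw [e]
      exact (measurableSet_eq_fun (by fun_prop) measurable_const).compl.union
        (measurableSet_eq_fun hf measurable_const)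
    rw [← Measure.prod_swap, ae_map_iff measurable_swap.aemeasurable hset]
    refine (Measure.ae_prod_iff_ae_ae (measurable_swap hset)).mpr ?_
    refine Filter.Eventually.of_forall fun y => ?_
    by_cases hy : m y = 0
    · have h := hy
      rw [hm, integral_eq_zero_iff_of_nonneg (fun x => h0 _)
        (integrable_of_bounded (hfy y) fun x => habs _)] at h
      filter_upwards [h] with x hx _
      exact hx
    · exact Filter.Eventually.of_forall fun x h => absurd h hy
  have hJR : J = ((P.prod Q).withDensity fun z => ENNReal.ofReal (m z.2)).withDensity
      fun z => ENNReal.ofReal (f z / m z.2) := by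
    rw [hJ, ← withDensity_mul _ (by fun_prop) (by fun_prop)]
    refine withDensity_congr_ae ?_
    filter_upwards [hzero] with z hz
    rw [Pi.mul_apply, ← ENNReal.ofReal_mul (hm0 _)]
    congr 1
    by_cases h : m z.2 = 0
    · rw [hz h, h]; simp
    · field_simp
  unfold mutualInfo
  rw [← hJ, hR]
  have hRp : IsProbabilityMeasure ((P.prod Q).withDensity fun z => ENNReal.ofReal (m z.2)) := by
    rw [← hR, hfst, hsnd]
    infer_instance
  have hac : J ≪ (P.prod Q).withDensity fun z => ENNReal.ofReal (m z.2) := by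
    rw [hJR]
    exact withDensity_absolutelyContinuous _ _
  rw [InformationTheory.klDiv_eq_lintegral_klFun_of_ac hac]
  have hrn : J.rnDeriv ((P.prod Q).withDensity fun z => ENNReal.ofReal (m z.2))
      =ᵐ[(P.prod Q).withDensity fun z => ENNReal.ofReal (m z.2)]
      fun z => ENNReal.ofReal (f z / m z.2) := by
    rw [hJR]
    exact Measure.rnDeriv_withDensity _ (by fun_prop)
  rw [lintegral_congr_ae (g := fun z => ENNReal.ofReal
    (InformationTheory.klFun (f z / m z.2))) (by
      filter_upwards [hrn] with z hz
      rw [hz, ENNReal.toReal_ofReal (div_nonneg (h0 z) (hm0 _))])]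
  rw [lintegral_withDensity_eq_lintegral_mul _ (by fun_prop) (by fun_prop)]
  have hpt : ∀ᵐ z ∂(P.prod Q), ((fun z : X × Y => ENNReal.ofReal (m z.2)) * fun z =>
      ENNReal.ofReal (InformationTheory.klFun (f z / m z.2))) z
      = ENNReal.ofReal (f z * Real.log (f z) - f z * Real.log (m z.2) + m z.2 - f z) := by
    filter_upwards [hzero] with z hz
    rw [Pi.mul_apply, ← ENNReal.ofReal_mul (hm0 _)]
    congr 1
    by_cases h : m z.2 = 0
    · rw [hz h, h]; simp
    · by_cases h' : f z = 0
      · simp [h', InformationTheory.klFun]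
      · rw [InformationTheory.klFun, Real.log_div h' h]
        field_simp
  have hpos : ∀ᵐ z ∂(P.prod Q),
      0 ≤ f z * Real.log (f z) - f z * Real.log (m z.2) + m z.2 - f z := by
    filter_upwards [hzero] with z hz
    by_cases h : m z.2 = 0
    · rw [hz h, h]; simp
    · have e : f z * Real.log (f z) - f z * Real.log (m z.2) + m z.2 - f z
          = m z.2 * InformationTheory.klFun (f z / m z.2) := by
        by_cases h' : f z = 0
        · simp [h', InformationTheory.klFun]
        · rw [InformationTheory.klFun, Real.log_div h' h]
          field_simp
      rw [e]
      exact mul_nonneg (hm0 _) (InformationTheory.klFun_nonneg (div_nonneg (h0 z) (hm0 _)))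
  have i1 : Integrable (fun z => f z * Real.log (f z)) (P.prod Q) :=
    integrable_comp_of_bounded Real.continuous_mul_log hf habs
  have i3 : Integrable (fun z : X × Y => m z.2) (P.prod Q) :=
    integrable_of_bounded (by fun_prop) fun z => hmB _
  have hmeas2 : Measurable fun z : X × Y => f z * Real.log (m z.2) := by fun_prop
  -- The factor ln m may be unbounded where m is small; integrating the absolute value over x first
  -- gives |m ln m|, which is bounded.
  have i2 : Integrable (fun z : X × Y => f z * Real.log (m z.2)) (P.prod Q) := by
    rw [integrable_prod_iff' hmeas2.aestronglyMeasurable]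
    refine ⟨Filter.Eventually.of_forall fun y =>
      (integrable_of_bounded (hfy y) fun x => habs _).mul_const (Real.log (m y)), ?_⟩
    have e : (fun y => ∫ x, ‖f (x, y) * Real.log (m y)‖ ∂P)
        = fun y => |m y * Real.log (m y)| := by
      funext y
      simp only [norm_mul, Real.norm_of_nonneg (h0 _)]
      rw [integral_mul_const, abs_mul, abs_of_nonneg (hm0 y), hm, Real.norm_eq_abs]
    rw [e]
    exact integrable_comp_of_bounded (F := fun x => |x * Real.log x|)
      Real.continuous_mul_log.abs hmm hmB
  have i4 : Integrable (fun z => f z * Real.log (f z) - f z * Real.log (m z.2) + m z.2 - f z)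
      (P.prod Q) := ((i1.sub i2).add i3).sub hfi
  rw [lintegral_congr_ae hpt, ← ofReal_integral_eq_lintegral_ofReal i4 hpos]
  refine ENNReal.ofReal_le_ofReal ?_
  rw [integral_sub (f := fun z => f z * Real.log (f z) - f z * Real.log (m z.2) + m z.2)
      ((i1.sub i2).add i3) hfi,
    integral_add (f := fun z => f z * Real.log (f z) - f z * Real.log (m z.2)) (i1.sub i2) i3,
    integral_sub i1 i2]
  have e0 : ∫ z, f z ∂(P.prod Q) = 1 := by
    rw [integral_prod _ hfi]
    simp [h1]
  have e3 : ∫ z : X × Y, m z.2 ∂(P.prod Q) = ∫ y, m y ∂Q := by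
    rw [integral_prod _ i3]
    simp
  have e3' : ∫ y, m y ∂Q = 1 := by
    rw [← e0, integral_prod_symm _ hfi, hm]
  have e2 : ∫ z : X × Y, f z * Real.log (m z.2) ∂(P.prod Q) = ∫ y, m y * Real.log (m y) ∂Q := by
    rw [integral_prod_symm _ i2]
    simp only [integral_mul_const]
    rw [hm]
  have e1 : ∫ z, f z * Real.log (f z) ∂(P.prod Q) ≤ K := by
    rw [integral_prod _ i1]
    calc _ ≤ ∫ _, K ∂P := integral_mono i1.integral_prod_left (integrable_const K) hK
      _ = K := by simp
  have hge : 0 ≤ ∫ y, m y * Real.log (m y) ∂Q := by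
    have im : Integrable m Q := integrable_of_bounded hmm hmB
    have hmono : ∫ y, (m y - 1) ∂Q ≤ ∫ y, m y * Real.log (m y) ∂Q := by
      refine integral_mono (im.sub (integrable_const 1))
        (integrable_comp_of_bounded Real.continuous_mul_log hmm hmB) fun y => ?_
      have := InformationTheory.klFun_nonneg (hm0 y)
      rw [InformationTheory.klFun] at this
      simp only
      linarith
    rw [integral_sub im (integrable_const 1), e3'] at hmono
    simpa using hmono
  rw [e0, e2, e3, e3']
  linarith

end Entropy

/-! ### The entropy of outcome densities of a product measurement -/

section Chain

open Matrix

/-- A bounded measurable density, with respect to the probability measure `Q`, of a positive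
operator-valued measure on `ℂ^κ`. -/
structure IsEffectFamily {κ Y : Type*} [Fintype κ] [DecidableEq κ] [MeasurableSpace Y]
    (Q : Measure Y) (F : Y → Matrix κ κ ℂ) : Prop where
  posSemidef : ∀ y, (F y).PosSemidef
  measurable : ∀ i j, Measurable fun y => F y i j
  bounded : ∃ B : ℝ, ∀ y i j, ‖F y i j‖ ≤ B
  integral_apply : ∀ i j, ∫ y, F y i j ∂Q = (1 : Matrix κ κ ℂ) i j

namespace IsEffectFamily

variable {κ Y : Type*} [Fintype κ] [DecidableEq κ] [MeasurableSpace Y] {Q : Measure Y}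
  {F : Y → Matrix κ κ ℂ}

theorem measurable_density (hF : IsEffectFamily Q F) (ρ : Matrix κ κ ℂ) :
    Measurable fun y => (ρ * F y).trace.re := by
  have := hF.measurable
  simp only [trace, diag_apply, mul_apply]
  fun_prop

theorem exists_density_bound (hF : IsEffectFamily Q F) (R : ℝ) :
    ∃ B : ℝ, ∀ (ρ : Matrix κ κ ℂ), (∀ i j, ‖ρ i j‖ ≤ R) → ∀ y, |(ρ * F y).trace.re| ≤ B := by
  obtain ⟨B, hB⟩ := hF.bounded
  refine ⟨∑ _i : κ, ∑ _j : κ, R * B, fun ρ hρ y => (Complex.abs_re_le_norm _).trans ?_⟩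
  rw [trace]
  refine (norm_sum_le _ _).trans (Finset.sum_le_sum fun i _ => ?_)
  rw [diag_apply, mul_apply]
  refine (norm_sum_le _ _).trans (Finset.sum_le_sum fun j _ => ?_)
  rw [norm_mul]
  exact mul_le_mul (hρ i j) (hB y j i) (norm_nonneg _) ((norm_nonneg _).trans (hρ i j))

theorem exists_density_bound_single (hF : IsEffectFamily Q F) (ρ : Matrix κ κ ℂ) :
    ∃ B : ℝ, ∀ y, |(ρ * F y).trace.re| ≤ B := by
  obtain ⟨B, hB⟩ := hF.exists_density_bound (∑ i, ∑ j, ‖ρ i j‖)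
  refine ⟨B, hB ρ fun i j => ?_⟩
  refine (Finset.single_le_sum (f := fun j => ‖ρ i j‖) (fun _ _ => norm_nonneg _)
    (Finset.mem_univ j)).trans ?_
  exact Finset.single_le_sum (f := fun i => ∑ j, ‖ρ i j‖)
    (fun _ _ => Finset.sum_nonneg fun _ _ => norm_nonneg _) (Finset.mem_univ i)

theorem density_nonneg (hF : IsEffectFamily Q F) {ρ : Matrix κ κ ℂ} (hρ : ρ.PosSemidef) (y : Y) :
    0 ≤ (ρ * F y).trace.re :=
  (Complex.le_def.mp (trace_mul_nonneg hρ (hF.posSemidef y))).1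

theorem integrable_apply [IsFiniteMeasure Q] (hF : IsEffectFamily Q F) (i j : κ) :
    Integrable (fun y => F y i j) Q := by
  obtain ⟨B, hB⟩ := hF.bounded
  exact Integrable.of_bound (hF.measurable i j).aestronglyMeasurable B
    (Filter.Eventually.of_forall fun y => hB y i j)

theorem integral_density [IsFiniteMeasure Q] (hF : IsEffectFamily Q F) (ρ : Matrix κ κ ℂ) :
    ∫ y, (ρ * F y).trace.re ∂Q = ρ.trace.re := by
  have hi : ∀ i j, Integrable (fun y => ρ i j * F y j i) Q := fun i j =>
    (hF.integrable_apply j i).const_mul _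
  have h : Integrable (fun y => (ρ * F y).trace) Q := by
    simp only [trace, diag_apply, mul_apply]
    exact integrable_finsetSum _ fun i _ => integrable_finsetSum _ fun j _ => hi i j
  have h2 : ∫ y, (ρ * F y).trace ∂Q = ρ.trace := by
    simp only [trace, diag_apply, mul_apply]
    rw [integral_finsetSum _ fun i _ => integrable_finsetSum _ fun j _ => hi i j]
    refine Finset.sum_congr rfl fun i _ => ?_
    rw [integral_finsetSum _ fun j _ => hi i j]
    simp only [integral_const_mul, hF.integral_apply, one_apply, mul_ite, mul_one, mul_zero,
      Finset.sum_ite_eq', Finset.mem_univ, if_true]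
  rw [← h2]
  exact integral_re h

theorem tensor [IsProbabilityMeasure Q] (hF : IsEffectFamily Q F) (n : ℕ) :
    IsEffectFamily (Measure.pi fun _ : Fin n => Q) fun y => tensorProd fun k => F (y k) where
  posSemidef y := posSemidef_tensorProd fun k => hF.posSemidef _
  measurable f g := by
    simp only [tensorProd, of_apply]
    exact Finset.measurable_prod _ fun k _ =>
      (hF.measurable _ _).comp (measurable_pi_apply k)
  bounded := by
    obtain ⟨B, hB⟩ := hF.bounded
    refine ⟨B ^ n, fun y f g => ?_⟩
    simp only [tensorProd, of_apply, norm_prod]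
    refine (Finset.prod_le_prod (fun _ _ => norm_nonneg _) fun k _ => hB _ _ _).trans ?_
    simp
  integral_apply f g := by
    simp only [tensorProd, of_apply]
    rw [integral_fintype_prod_eq_prod (μ := fun _ : Fin n => Q)
      (f := fun k y => F y (f k) (g k))]
    simp only [hF.integral_apply, one_apply]
    split_ifs with h
    · simp [h]
    · obtain ⟨k, hk⟩ := Function.ne_iff.mp h
      exact Finset.prod_eq_zero (Finset.mem_univ k) (if_neg hk)

/-- A bound on the entropy functional in pure states extends to positive matrices. -/
theorem integral_density_mul_log_le [IsProbabilityMeasure Q] (hF : IsEffectFamily Q F) {C : ℝ}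
    (hC : ∀ v : κ → ℂ, star v ⬝ᵥ v = 1 →
      ∫ y, (star v ⬝ᵥ F y *ᵥ v).re * Real.log (star v ⬝ᵥ F y *ᵥ v).re ∂Q ≤ C)
    {ρ : Matrix κ κ ℂ} (hρ : ρ.PosSemidef) :
    ∫ y, (ρ * F y).trace.re * Real.log (ρ * F y).trace.re ∂Q
      ≤ ρ.trace.re * Real.log ρ.trace.re + C * ρ.trace.re := by
  obtain ⟨l, v, hl, hls, hv, htr⟩ := exists_trace_mul_eq_sum hρ
  obtain ⟨g, hg⟩ : ∃ g : κ → Y → ℝ, g = fun i y => (star (v i) ⬝ᵥ F y *ᵥ v i).re := ⟨_, rfl⟩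
  have hgv : ∀ i y, (vecMulVec (v i) (star (v i)) * F y).trace.re = g i y := by
    intro i y
    rw [hg, vecMulVec_mul, trace_vecMulVec, dotProduct_comm, ← dotProduct_mulVec]
  have hg0 : ∀ i y, 0 ≤ g i y := fun i y => by
    rw [← hgv]; exact hF.density_nonneg (posSemidef_vecMulVec_self_star _) y
  have hgm : ∀ i, Measurable (g i) := fun i => by
    have := hF.measurable_density (vecMulVec (v i) (star (v i)))
    simpa only [hgv] using this
  have hgb : ∀ i, ∃ B, ∀ y, |g i y| ≤ B := fun i => by
    obtain ⟨B, hB⟩ := hF.exists_density_bound_single (vecMulVec (v i) (star (v i)))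
    exact ⟨B, fun y => by rw [← hgv]; exact hB y⟩
  have hgi : ∀ i, Integrable (fun y => g i y * Real.log (g i y)) Q := fun i => by
    obtain ⟨B, hB⟩ := hgb i
    exact integrable_comp_of_bounded Real.continuous_mul_log (hgm i) hB
  obtain ⟨s, hs⟩ : ∃ s, s = ρ.trace.re := ⟨_, rfl⟩
  rw [← hs] at hls ⊢
  have hs0 : 0 ≤ s := hls ▸ Finset.sum_nonneg fun i _ => hl i
  obtain ⟨f, hf⟩ : ∃ f : Y → ℝ, f = fun y => (ρ * F y).trace.re := ⟨_, rfl⟩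
  have hfs : ∀ y, f y = ∑ i, l i * g i y := fun y => by rw [hf, hg]; exact htr _
  have hfm : Measurable f := hf ▸ hF.measurable_density ρ
  obtain ⟨B, hB⟩ := hF.exists_density_bound_single ρ
  have hfb : ∀ y, |f y| ≤ B := hf ▸ hB
  have hfi : Integrable f Q := integrable_of_bounded hfm hfb
  have hfs1 : ∫ y, f y ∂Q = s := by rw [hf, hs]; exact hF.integral_density ρ
  change ∫ y, (fun y => (ρ * F y).trace.re) y
    * Real.log ((fun y => (ρ * F y).trace.re) y) ∂Q ≤ _
  rw [← hf]
  -- Jensen for x ln x with the normalized weights l_i / s, multiplied back by s. If s = 0, all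
  -- weights vanish and both sides are zero.
  have hpt : ∀ y, f y * Real.log (f y)
      ≤ f y * Real.log s + ∑ i, l i * (g i y * Real.log (g i y)) := by
    intro y
    rcases hs0.eq_or_lt with h | h
    · have hl0 : ∀ i, l i = 0 := fun i =>
        (Finset.sum_eq_zero_iff_of_nonneg fun i _ => hl i).mp (hls.trans h.symm) i
          (Finset.mem_univ i)
      simp [hfs, hl0]
    · have hj := Real.convexOn_mul_log.map_sum_le (t := Finset.univ) (w := fun i => l i / s)
        (p := fun i => g i y) (fun i _ => div_nonneg (hl i) h.le)
        (by rw [← Finset.sum_div, hls, div_self h.ne']) (fun i _ => hg0 i y)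
      simp only [smul_eq_mul] at hj
      have e : ∑ i, l i / s * g i y = f y / s := by
        rw [hfs, Finset.sum_div]
        exact Finset.sum_congr rfl fun i _ => by ring
      have e' : ∑ i, l i / s * (g i y * Real.log (g i y))
          = (∑ i, l i * (g i y * Real.log (g i y))) / s := by
        rw [Finset.sum_div]
        exact Finset.sum_congr rfl fun i _ => by ring
      rw [e, e', div_mul_eq_mul_div, div_le_div_iff_of_pos_right h] at hj
      by_cases h0 : f y = 0
      · rw [h0] at hj ⊢
        simpa using hj
      · rw [Real.log_div h0 h.ne'] at hj
        linarith
  have hsi : Integrable (fun y => ∑ i, l i * (g i y * Real.log (g i y))) Q :=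
    integrable_finsetSum _ fun i _ => (hgi i).const_mul _
  calc ∫ y, f y * Real.log (f y) ∂Q
      ≤ ∫ y, (f y * Real.log s + ∑ i, l i * (g i y * Real.log (g i y))) ∂Q :=
        integral_mono (integrable_comp_of_bounded Real.continuous_mul_log hfm hfb)
          ((hfi.mul_const _).add hsi) hpt
    _ = s * Real.log s + ∑ i, l i * ∫ y, g i y * Real.log (g i y) ∂Q := by
        rw [integral_add (hfi.mul_const _) hsi, integral_mul_const, hfs1,
          integral_finsetSum _ fun i _ => (hgi i).const_mul _]
        simp only [integral_const_mul]
    _ ≤ s * Real.log s + ∑ i, l i * C := by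
        gcongr with i _
        · exact hl i
        · have := hC (v i) (hv i)
          rw [hg]
          exact this
    _ = s * Real.log s + C * s := by rw [← Finset.sum_mul, hls]; ring

/-- The entropy functional of a product measurement is bounded additively. -/
theorem integral_tensor_density_mul_log_le [IsProbabilityMeasure Q] (hF : IsEffectFamily Q F)
    {C : ℝ}
    (hC : ∀ ρ : Matrix κ κ ℂ, ρ.PosSemidef →
      ∫ y, (ρ * F y).trace.re * Real.log (ρ * F y).trace.re ∂Q
        ≤ ρ.trace.re * Real.log ρ.trace.re + C * ρ.trace.re) :
    ∀ (n : ℕ) (ρ : Matrix (Fin n → κ) (Fin n → κ) ℂ), ρ.PosSemidef →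
      ∫ y, (ρ * tensorProd fun k => F (y k)).trace.re
          * Real.log (ρ * tensorProd fun k => F (y k)).trace.re ∂(Measure.pi fun _ : Fin n => Q)
        ≤ ρ.trace.re * Real.log ρ.trace.re + n * C * ρ.trace.re := by
  intro n
  induction n with
  | zero =>
    intro ρ _
    have h1 : ∀ y : Fin 0 → Y, (tensorProd fun k => F (y k)) = 1 := by
      intro y
      ext f g
      rw [Subsingleton.elim f g]
      simp [tensorProd]
    simp [h1]
  | succ n ih =>
    intro ρ hρ
    have hT := hF.tensor (n + 1)
    obtain ⟨B, hB⟩ := hT.exists_density_bound_single ρ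
    rw [← ((measurePreserving_piFinSuccAbove (fun _ : Fin (n + 1) => Q) 0).symm).integral_comp']
    have e : ∀ z : Y × (Fin n → Y),
        (ρ * tensorProd fun k =>
          F ((MeasurableEquiv.piFinSuccAbove (fun _ : Fin (n + 1) => Y) 0).symm z k)).trace
        = (contractLeft (splitFirst ρ) (F z.1) * tensorProd fun k => F (z.2 k)).trace := by
      intro z
      rw [← trace_mul_tensorProd_cons]
      congr 3
      funext k
      refine Fin.cases ?_ (fun k => ?_) k
      · simp [MeasurableEquiv.piFinSuccAbove_symm_apply, Fin.insertNthEquiv]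
      · simp [MeasurableEquiv.piFinSuccAbove_symm_apply, Fin.insertNthEquiv]
    have hint : Integrable (fun z : Y × (Fin n → Y) =>
        (contractLeft (splitFirst ρ) (F z.1) * tensorProd fun k => F (z.2 k)).trace.re
        * Real.log (contractLeft (splitFirst ρ) (F z.1)
          * tensorProd fun k => F (z.2 k)).trace.re)
        (Q.prod (Measure.pi fun _ : Fin n => Q)) := by
      simp only [← e]
      exact integrable_comp_of_bounded Real.continuous_mul_log
        ((hT.measurable_density ρ).comp (MeasurableEquiv.measurable _)) fun z => hB _
    simp only [e]
    have hR := posSemidef_reduceFirst hρ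
    obtain ⟨B', hB'⟩ := hF.exists_density_bound_single (reduceFirst ρ)
    have hRm := hF.measurable_density (reduceFirst ρ)
    have i1 := integrable_comp_of_bounded (Q := Q) Real.continuous_mul_log hRm hB'
    have i2 : Integrable (fun y => n * C * (reduceFirst ρ * F y).trace.re) Q :=
      (integrable_of_bounded hRm hB').const_mul _
    calc _ = ∫ y, ∫ y' : Fin n → Y,
          (contractLeft (splitFirst ρ) (F y) * tensorProd fun k => F (y' k)).trace.re
            * Real.log (contractLeft (splitFirst ρ) (F y)
              * tensorProd fun k => F (y' k)).trace.re ∂(Measure.pi fun _ : Fin n => Q) ∂Q :=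
          integral_prod _ hint
      -- With the first outcome y fixed, the induction hypothesis applies to the unnormalized
      -- conditional state. Its trace is the first-outcome density, so the term trace · ln trace is
      -- exactly the one-copy integrand for the reduced state. This is why the estimate is
      -- formulated for all positive matrices.
      _ ≤ ∫ y, ((reduceFirst ρ * F y).trace.re * Real.log (reduceFirst ρ * F y).trace.re
            + n * C * (reduceFirst ρ * F y).trace.re) ∂Q := by
          refine integral_mono hint.integral_prod_left (i1.add i2) fun y => ?_
          have hsplit : (splitFirst ρ).PosSemidef := hρ.submatrix _
          have := ih _ (posSemidef_contractLeft hsplit (hF.posSemidef y))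
          rw [trace_contractLeft_splitFirst] at this
          exact this
      _ ≤ ρ.trace.re * Real.log ρ.trace.re + C * ρ.trace.re + n * C * ρ.trace.re := by
          rw [integral_add i1 i2, integral_const_mul, hF.integral_density, trace_reduceFirst]
          have := hC _ hR
          rw [trace_reduceFirst] at this
          linarith
      _ = _ := by push_cast; ring

end IsEffectFamily

end Chain

/-! ### The capacity bound -/

section Capacity

open Matrix

theorem law_isProbabilityMeasure {ι A : Type*} [Fintype ι] [MeasurableSpace A] {μ : Measure A}
    (χ : StateFamily ι μ) : IsProbabilityMeasure χ.law := by
  refine ⟨?_⟩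
  rw [StateFamily.law, withDensity_apply _ .univ, Measure.restrict_univ]
  exact χ.lintegral_p

variable {d : ℕ} {A : Type*} [MeasurableSpace A] {μ : Measure A} {π : StateFamily (Fin d) μ}

theorem isEffectFamily_of_isPOVM (hπ : IsPOVM π) :
    IsEffectFamily π.law fun y => (d : ℂ) • π.hat y where
  posSemidef y := (π.isState_hat y).1.smul (Nat.cast_nonneg d)
  measurable i j := by
    simp only [Matrix.smul_apply, smul_eq_mul]
    exact (π.measurable_hat i j).const_mul _
  bounded := ⟨d, fun y i j => by
    rw [Matrix.smul_apply, smul_eq_mul, norm_mul, Complex.norm_natCast]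
    exact mul_le_of_le_one_right (Nat.cast_nonneg d)
      (norm_apply_le_one_of_isState (π.isState_hat y) i j)⟩
  integral_apply i j := by
    simp only [Matrix.smul_apply, smul_eq_mul, integral_const_mul]
    exact hπ i j

/-- For states the term trace · ln trace vanishes, so the additive bound leaves n C for every
preparation separately. -/
theorem blockInfo_le (hπ : IsPOVM π) {C : ℝ}
    (hC : ∀ v : Fin d → ℂ, star v ⬝ᵥ v = 1 →
      ∫ y, (d * (star v ⬝ᵥ π.hat y *ᵥ v).re) * Real.log (d * (star v ⬝ᵥ π.hat y *ᵥ v).re) ∂π.law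
        ≤ C) (n : ℕ) :
    blockInfo π n ≤ ENNReal.ofReal (n * C) := by
  have := law_isProbabilityMeasure π
  have hF := isEffectFamily_of_isPOVM hπ
  have hT := hF.tensor n
  have hC' : ∀ v : Fin d → ℂ, star v ⬝ᵥ v = 1 →
      ∫ y, (star v ⬝ᵥ ((d : ℂ) • π.hat y) *ᵥ v).re
        * Real.log (star v ⬝ᵥ ((d : ℂ) • π.hat y) *ᵥ v).re ∂π.law ≤ C := by
    intro v hv
    have e : ∀ y, (star v ⬝ᵥ ((d : ℂ) • π.hat y) *ᵥ v).re
        = d * (star v ⬝ᵥ π.hat y *ᵥ v).re := by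
      intro y
      rw [smul_mulVec, dotProduct_smul, smul_eq_mul]
      simp
    simp only [e]
    exact hC v hv
  have hchain := hF.integral_tensor_density_mul_log_le
    (fun ρ hρ => hF.integral_density_mul_log_le hC' hρ) n
  -- Entries of a state have modulus at most 1, which makes the density bound uniform over the whole
  -- ensemble.
  obtain ⟨B, hB⟩ := hT.exists_density_bound 1
  unfold blockInfo
  refine iSup_le fun X => iSup_le fun _ => iSup_le fun ν => iSup_le fun ρ => ?_
  have := law_isProbabilityMeasure ρ
  have hstate := ρ.isState_hat
  unfold jointLaw
  refine mutualInfo_withDensity_le (B := B) ?_ (fun z => hT.density_nonneg (hstate z.1).1 z.2)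
    (fun z => (le_abs_self _).trans
      (hB _ (norm_apply_le_one_of_isState (hstate z.1)) z.2)) (fun x => ?_) fun x => ?_
  · have h1 : ∀ i j, Measurable fun z : X × (Fin n → A) => ρ.hat z.1 i j := fun i j =>
      (ρ.measurable_hat i j).comp measurable_fst
    have h2 : ∀ i j, Measurable fun z : X × (Fin n → A) =>
        (tensorProd fun k => (d : ℂ) • π.hat (z.2 k)) i j := fun i j =>
      (hT.measurable i j).comp measurable_snd
    simp only [trace, diag_apply, mul_apply]
    exact Complex.measurable_re.comp (Finset.measurable_sum _ fun i _ =>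
      Finset.measurable_sum _ fun j _ => (h1 i j).mul (h2 j i))
  · have := hT.integral_density (ρ.hat x)
    rw [(hstate x).2, Complex.one_re] at this
    exact this
  · have := hchain (ρ.hat x) (hstate x).1
    rw [(hstate x).2] at this
    simpa using this

theorem capacity_le (hd : 0 < d) (hπ : IsPOVM π) {C : ℝ}
    (hC : ∀ v : Fin d → ℂ, star v ⬝ᵥ v = 1 →
      ∫ y, (d * (star v ⬝ᵥ π.hat y *ᵥ v).re) * Real.log (d * (star v ⬝ᵥ π.hat y *ᵥ v).re) ∂π.law
        ≤ C) :
    (capacity π : EReal) ≤ (C : EReal) := by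
  have := law_isProbabilityMeasure π
  -- Needed because `ENNReal.ofReal` truncates negative numbers. It follows from t ln t ≥ t − 1 for
  -- the outcome density of one basis vector.
  have hC0 : 0 ≤ C := by
    obtain ⟨v, hv⟩ : ∃ v : Fin d → ℂ, v = Pi.single ⟨0, hd⟩ 1 := ⟨_, rfl⟩
    have hF := isEffectFamily_of_isPOVM hπ
    have e : ∀ y, (vecMulVec v (star v) * ((d : ℂ) • π.hat y)).trace.re
        = d * (star v ⬝ᵥ π.hat y *ᵥ v).re := by
      intro y
      rw [vecMulVec_mul, trace_vecMulVec, dotProduct_comm, ← dotProduct_mulVec, smul_mulVec,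
        dotProduct_smul, smul_eq_mul]
      simp
    obtain ⟨B, hB⟩ := hF.exists_density_bound_single (vecMulVec v (star v))
    have hm := hF.measurable_density (vecMulVec v (star v))
    have h0 := fun y => hF.density_nonneg (posSemidef_vecMulVec_self_star v) y
    have h1 := hF.integral_density (vecMulVec v (star v))
    simp only [e] at hB hm h0 h1
    have hi := integrable_of_bounded (Q := π.law) hm hB
    refine le_trans ?_ (hC v (by simp [hv]))
    have hmono : ∫ y, (d * (star v ⬝ᵥ π.hat y *ᵥ v).re - 1) ∂π.law
        ≤ ∫ y, (d * (star v ⬝ᵥ π.hat y *ᵥ v).re)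
          * Real.log (d * (star v ⬝ᵥ π.hat y *ᵥ v).re) ∂π.law := by
      refine integral_mono (hi.sub (integrable_const 1))
        (integrable_comp_of_bounded Real.continuous_mul_log hm hB) fun y => ?_
      have := InformationTheory.klFun_nonneg (h0 y)
      rw [InformationTheory.klFun] at this
      simp only
      linarith
    rw [integral_sub hi (integrable_const 1), h1, trace_vecMulVec] at hmono
    simpa [hv] using hmono
  have hcap : capacity π ≤ ENNReal.ofReal C := by
    refine Filter.limsup_le_of_le (by isBoundedDefault) ?_
    filter_upwards [Filter.eventually_gt_atTop 0] with n hn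
    refine ENNReal.div_le_of_le_mul' ((blockInfo_le hπ hC n).trans_eq ?_)
    rw [ENNReal.ofReal_mul (Nat.cast_nonneg n), ENNReal.ofReal_natCast]
  calc (capacity π : EReal) ≤ ((ENNReal.ofReal C : ℝ≥0∞) : EReal) := by exact_mod_cast hcap
    _ = (C : EReal) := by rw [EReal.coe_ennreal_ofReal, max_eq_left hC0]

end Capacity

/-! ### Moments of the Haar measure on the unitary group -/

section Haar

open Matrix

variable {d : ℕ}

instance isHaarMeasure_haarUnitary (d : ℕ) : (haarUnitary d).IsHaarMeasure := by
  unfold haarUnitary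
  infer_instance

instance isProbabilityMeasure_haarUnitary (d : ℕ) : IsProbabilityMeasure (haarUnitary d) :=
  ⟨Measure.haarMeasure_self⟩

theorem integral_haarUnitary_mul_right (F : Matrix.unitaryGroup (Fin d) ℂ → ℝ)
    (V : Matrix.unitaryGroup (Fin d) ℂ) :
    ∫ U, F (U * V) ∂(haarUnitary d) = ∫ U, F U ∂(haarUnitary d) := by
  have : IsProbabilityMeasure ((haarUnitary d).map (· * V)) :=
    Measure.isProbabilityMeasure_map (by fun_prop)
  have h : (haarUnitary d).map (· * V) = haarUnitary d :=
    Measure.isHaarMeasure_eq_of_isProbabilityMeasure _ _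
  conv_rhs => rw [← h]
  exact ((MeasurableEquiv.mulRight V).measurableEmbedding.integral_map F).symm

theorem integrable_haarUnitary {F : Matrix.unitaryGroup (Fin d) ℂ → ℝ} (hF : Continuous F) :
    Integrable F (haarUnitary d) :=
  hF.integrable_of_hasCompactSupport (HasCompactSupport.of_compactSpace F)

/-- The vector `U† φ`. -/
def rotated (φ : Fin d → ℂ) (U : Matrix.unitaryGroup (Fin d) ℂ) : Fin d → ℂ :=
  star (U : Matrix (Fin d) (Fin d) ℂ) *ᵥ φ

theorem continuous_rotated (φ : Fin d → ℂ) : Continuous (rotated φ) := by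
  unfold rotated
  have : Continuous fun U : Matrix.unitaryGroup (Fin d) ℂ => (U : Matrix (Fin d) (Fin d) ℂ) :=
    continuous_subtype_val
  fun_prop

/-- As W U†φ = (U W†)†φ, right invariance of the Haar measure makes the law of U†φ unitarily
invariant. -/
theorem integral_comp_mulVec_rotated (φ : Fin d → ℂ) (F : (Fin d → ℂ) → ℝ)
    (W : Matrix.unitaryGroup (Fin d) ℂ) :
    ∫ U, F ((W : Matrix (Fin d) (Fin d) ℂ) *ᵥ rotated φ U) ∂(haarUnitary d)
      = ∫ U, F (rotated φ U) ∂(haarUnitary d) := by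
  rw [← integral_haarUnitary_mul_right (fun U => F (rotated φ U)) (star W)]
  congr 1
  funext U
  congr 1
  simp [rotated, mulVec_mulVec]

/-- The real rotation of angle `θ` in the plane of the coordinates `i` and `j`. -/
noncomputable def planeRotation (i j : Fin d) (θ : ℝ) : Matrix (Fin d) (Fin d) ℂ :=
  1 + (Real.sin θ : ℂ) • (single i j 1 - single j i 1)
    + ((Real.cos θ : ℂ) - 1) • (single i i 1 + single j j 1)

theorem planeRotation_mem_unitaryGroup {i j : Fin d} (hij : i ≠ j) (θ : ℝ) :
    planeRotation i j θ ∈ Matrix.unitaryGroup (Fin d) ℂ := by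
  rw [mem_unitaryGroup_iff']
  obtain ⟨A, hA⟩ : ∃ A : Matrix (Fin d) (Fin d) ℂ, A = single i j 1 - single j i 1 := ⟨_, rfl⟩
  obtain ⟨P, hP⟩ : ∃ P : Matrix (Fin d) (Fin d) ℂ, P = single i i 1 + single j j 1 := ⟨_, rfl⟩
  have hAA : A * A = -P := by
    rw [hA, hP]
    simp [sub_mul, mul_sub, hij, hij.symm]
    abel
  have hAP : A * P = A := by
    rw [hA, hP]
    simp [sub_mul, mul_add, hij, hij.symm]
    abel
  have hPA : P * A = A := by
    rw [hA, hP]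
    simp [add_mul, mul_sub, hij, hij.symm]
  have hPP : P * P = P := by
    rw [hP]
    simp [add_mul, mul_add, hij, hij.symm]
  have hsA : star A = -A := by
    rw [hA]
    simp [star_eq_conjTranspose]
  have hsP : star P = P := by
    rw [hP]
    simp [star_eq_conjTranspose]
  have hcs : (Real.sin θ : ℂ) ^ 2 + (Real.cos θ : ℂ) ^ 2 = 1 := by
    exact_mod_cast Real.sin_sq_add_cos_sq θ
  have e : planeRotation i j θ = 1 + (Real.sin θ : ℂ) • A + ((Real.cos θ : ℂ) - 1) • P := by
    rw [hA, hP]; rfl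
  rw [e]
  obtain ⟨s, hs⟩ : ∃ s : ℂ, s = Real.sin θ := ⟨_, rfl⟩
  obtain ⟨c, hc⟩ : ∃ c : ℂ, c = Real.cos θ := ⟨_, rfl⟩
  have hs' : star s = s := by rw [hs]; exact Complex.conj_ofReal _
  have hc' : star c = c := by rw [hc]; exact Complex.conj_ofReal _
  rw [← hs, ← hc] at hcs ⊢
  simp only [star_add, star_smul, star_one, star_sub, hsA, hsP, hs', hc', add_mul, mul_add,
    one_mul, mul_one, smul_mul_assoc, mul_smul_comm, neg_mul, hAA, hAP, hPA, hPP]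
  calc _ = 1 + (s ^ 2 + c ^ 2 - 1) • P := by module
    _ = 1 := by rw [hcs]; simp

theorem planeRotation_mulVec {i j : Fin d} (hij : i ≠ j) (θ : ℝ) (u : Fin d → ℂ) (k : Fin d) :
    (planeRotation i j θ *ᵥ u) k = if k = i then Real.cos θ * u i + Real.sin θ * u j
      else if k = j then Real.cos θ * u j - Real.sin θ * u i else u k := by
  simp only [planeRotation, add_mulVec, sub_mulVec, smul_mulVec, single_mulVec, one_mulVec,
    Pi.add_apply, Pi.sub_apply, Pi.smul_apply, smul_eq_mul, one_mul]
  rcases eq_or_ne k i with rfl | hk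
  · simp [hij]; ring
  · rcases eq_or_ne k j with rfl | hk'
    · simp [hij.symm]; ring
    · simp [hk, hk']

end Haar

/-! ### Moment recursion for diagonal quadratic forms on the complex sphere -/

section HaarMoments

open Matrix

variable {d : ℕ}

/-- The quadratic form `∑ l_i |u_i|²`. -/
def diagForm (l : Fin d → ℝ) (u : Fin d → ℂ) : ℝ := ∑ i, l i * Complex.normSq (u i)

theorem continuous_diagForm (l : Fin d → ℝ) : Continuous (diagForm l) := by
  unfold diagForm
  have := Complex.continuous_normSq
  fun_prop

/-- The half difference of two squared moduli. -/
noncomputable def halfDiff (i j : Fin d) (u : Fin d → ℂ) : ℝ :=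
  (Complex.normSq (u i) - Complex.normSq (u j)) / 2

/-- The real part of `u_i ū_j`. -/
def crossRe (i j : Fin d) (u : Fin d → ℂ) : ℝ := (u i).re * (u j).re + (u i).im * (u j).im

/-- The imaginary part of `u_i ū_j`. -/
def crossIm (i j : Fin d) (u : Fin d → ℂ) : ℝ := (u i).im * (u j).re - (u i).re * (u j).im

theorem crossRe_sq_add_crossIm_sq (i j : Fin d) (u : Fin d → ℂ) :
    crossRe i j u ^ 2 + crossIm i j u ^ 2 = Complex.normSq (u i) * Complex.normSq (u j) := by
  simp only [crossRe, crossIm, Complex.normSq_apply]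
  ring

theorem continuous_crossRe (i j : Fin d) : Continuous (crossRe i j) := by
  unfold crossRe
  have := Complex.continuous_re
  have := Complex.continuous_im
  fun_prop

theorem continuous_crossIm (i j : Fin d) : Continuous (crossIm i j) := by
  unfold crossIm
  have := Complex.continuous_re
  have := Complex.continuous_im
  fun_prop

theorem continuous_halfDiff (i j : Fin d) : Continuous (halfDiff i j) := by
  unfold halfDiff
  have := Complex.continuous_normSq
  fun_prop

theorem diagForm_eq_add {i j : Fin d} (hij : i ≠ j) (l : Fin d → ℝ) (u : Fin d → ℂ) :
    diagForm l u = l i * Complex.normSq (u i) + l j * Complex.normSq (u j)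
      + ∑ k ∈ (Finset.univ.erase i).erase j, l k * Complex.normSq (u k) := by
  unfold diagForm
  rw [← Finset.add_sum_erase _ _ (Finset.mem_univ i), ← Finset.add_sum_erase (Finset.univ.erase i)
    _ (Finset.mem_erase.mpr ⟨hij.symm, Finset.mem_univ j⟩), add_assoc]

/-- A rotation by τ/2 in the plane (i, j) rotates the pair (`halfDiff`, `crossRe`) by the angle τ
and fixes |u_i|² + |u_j|². The form depends on the pair only through (l_i − l_j) · `halfDiff`. -/
theorem diagForm_planeRotation {i j : Fin d} (hij : i ≠ j) (l : Fin d → ℝ) (u : Fin d → ℂ)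
    (τ : ℝ) : diagForm l (planeRotation i j (τ / 2) *ᵥ u)
      = diagForm l u + (l i - l j) * (Real.cos τ * halfDiff i j u
        + Real.sin τ * crossRe i j u - halfDiff i j u) := by
  have h2 : ∑ k ∈ (Finset.univ.erase i).erase j,
        l k * Complex.normSq ((planeRotation i j (τ / 2) *ᵥ u) k)
      = ∑ k ∈ (Finset.univ.erase i).erase j, l k * Complex.normSq (u k) := by
    refine Finset.sum_congr rfl fun k hk => ?_
    rw [Finset.mem_erase, Finset.mem_erase] at hk
    rw [planeRotation_mulVec hij, if_neg hk.2.1, if_neg hk.1]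
  rw [diagForm_eq_add hij, diagForm_eq_add hij, h2]
  simp only [planeRotation_mulVec hij, if_true, if_neg hij.symm, halfDiff, crossRe]
  have hc : Real.cos τ = 2 * Real.cos (τ / 2) ^ 2 - 1 := by
    rw [← Real.cos_two_mul]; ring_nf
  have hs : Real.sin τ = 2 * Real.sin (τ / 2) * Real.cos (τ / 2) := by
    rw [← Real.sin_two_mul]; ring_nf
  have hcs := Real.sin_sq_add_cos_sq (τ / 2)
  rw [hc, hs]
  simp only [Complex.normSq_apply, Complex.add_re, Complex.add_im, Complex.sub_re, Complex.sub_im,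
    Complex.re_ofReal_mul, Complex.im_ofReal_mul]
  linear_combination (l i * ((u j).re * (u j).re + (u j).im * (u j).im)
    + l j * ((u i).re * (u i).re + (u i).im * (u i).im)) * hcs

theorem crossRe_planeRotation {i j : Fin d} (hij : i ≠ j) (u : Fin d → ℂ) (τ : ℝ) :
    crossRe i j (planeRotation i j (τ / 2) *ᵥ u)
      = Real.cos τ * crossRe i j u - Real.sin τ * halfDiff i j u := by
  simp only [planeRotation_mulVec hij, if_true, if_neg hij.symm, halfDiff, crossRe]
  have hc : Real.cos τ = 2 * Real.cos (τ / 2) ^ 2 - 1 := by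
    rw [← Real.cos_two_mul]; ring_nf
  have hs : Real.sin τ = 2 * Real.sin (τ / 2) * Real.cos (τ / 2) := by
    rw [← Real.sin_two_mul]; ring_nf
  have hcs := Real.sin_sq_add_cos_sq (τ / 2)
  rw [hc, hs]
  simp only [Complex.normSq_apply, Complex.add_re, Complex.add_im, Complex.sub_re, Complex.sub_im,
    Complex.re_ofReal_mul, Complex.im_ofReal_mul]
  linear_combination (-((u i).re * (u j).re + (u i).im * (u j).im)) * hcs

/-- Infinitesimal invariance of the Haar measure under rotations of a coordinate plane. -/
theorem integral_halfDiff_mul_pow {i j : Fin d} (hij : i ≠ j) (l : Fin d → ℝ) (φ : Fin d → ℂ)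
    (k : ℕ) :
    ∫ U, halfDiff i j (rotated φ U) * diagForm l (rotated φ U) ^ k ∂(haarUnitary d)
      = k * (l i - l j) * ∫ U, crossRe i j (rotated φ U) ^ 2
          * diagForm l (rotated φ U) ^ (k - 1) ∂(haarUnitary d) := by
  have hr := continuous_rotated φ
  have cq := (continuous_diagForm l).comp hr
  have cy := (continuous_crossRe i j).comp hr
  have cD := (continuous_halfDiff i j).comp hr
  simp only [Function.comp_def] at cq cy cD
  obtain ⟨q, hq⟩ : ∃ q, q = fun U => diagForm l (rotated φ U) := ⟨_, rfl⟩
  obtain ⟨y, hy⟩ : ∃ y, y = fun U => crossRe i j (rotated φ U) := ⟨_, rfl⟩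
  obtain ⟨D, hD⟩ : ∃ D, D = fun U => halfDiff i j (rotated φ U) := ⟨_, rfl⟩
  rw [← hq] at cq
  rw [← hy] at cy
  rw [← hD] at cD
  obtain ⟨F, hF⟩ : ∃ F : ℝ → Matrix.unitaryGroup (Fin d) ℂ → ℝ, F = fun τ U =>
      (Real.cos τ * y U - Real.sin τ * D U)
        * (q U + (l i - l j) * (Real.cos τ * D U + Real.sin τ * y U - D U)) ^ k := ⟨_, rfl⟩
  obtain ⟨F', hF'⟩ : ∃ F' : ℝ → Matrix.unitaryGroup (Fin d) ℂ → ℝ, F' = fun τ U =>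
      (-Real.sin τ * y U - Real.cos τ * D U)
        * (q U + (l i - l j) * (Real.cos τ * D U + Real.sin τ * y U - D U)) ^ k
      + (Real.cos τ * y U - Real.sin τ * D U)
        * (k * (q U + (l i - l j) * (Real.cos τ * D U + Real.sin τ * y U - D U)) ^ (k - 1)
          * ((l i - l j) * (-Real.sin τ * D U + Real.cos τ * y U))) := ⟨_, rfl⟩
  have hconst : ∀ τ, ∫ U, F τ U ∂(haarUnitary d) = ∫ U, F 0 U ∂(haarUnitary d) := by
    have key : ∀ τ, ∫ U, F τ U ∂(haarUnitary d) = ∫ U, y U * q U ^ k ∂(haarUnitary d) := by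
      intro τ
      have h := integral_comp_mulVec_rotated φ (fun u => crossRe i j u * diagForm l u ^ k)
        ⟨planeRotation i j (τ / 2), planeRotation_mem_unitaryGroup hij _⟩
      simp only [crossRe_planeRotation hij, diagForm_planeRotation hij] at h
      rw [hF, hy, hD, hq]
      exact h
    intro τ
    rw [key, key]
  have hderiv : ∀ τ U, HasDerivAt (fun τ => F τ U) (F' τ U) τ := by
    intro τ U
    have h1 := ((Real.hasDerivAt_cos τ).mul_const (y U)).sub
      ((Real.hasDerivAt_sin τ).mul_const (D U))
    have h2 := (((((Real.hasDerivAt_cos τ).mul_const (D U)).add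
      ((Real.hasDerivAt_sin τ).mul_const (y U))).sub_const (D U)).const_mul (l i - l j)).const_add
        (q U)
    have h3 := h1.mul (h2.pow k)
    rw [hF, hF']
    exact h3
  have cF : ∀ τ, Continuous (F τ) := by
    intro τ
    rw [hF]
    fun_prop
  have cF' : Continuous fun p : ℝ × Matrix.unitaryGroup (Fin d) ℂ => F' p.1 p.2 := by
    rw [hF']
    have := cq.comp (continuous_snd (X := ℝ))
    have := cy.comp (continuous_snd (X := ℝ))
    have := cD.comp (continuous_snd (X := ℝ))
    simp only [Function.comp_def] at *
    fun_prop
  obtain ⟨B, hB⟩ := ((isCompact_Icc (a := (-1 : ℝ)) (b := 1)).prod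
    (isCompact_univ (X := Matrix.unitaryGroup (Fin d) ℂ))).exists_bound_of_continuousOn
      cF'.continuousOn
  have cF0 : Continuous (F' 0) := cF'.comp (Continuous.prodMk_right 0)
  have hmain := (hasDerivAt_integral_of_dominated_loc_of_deriv_le (μ := haarUnitary d)
    (F := F) (F' := F') (x₀ := 0) (bound := fun _ => B)
    (Icc_mem_nhds (by norm_num : (-1 : ℝ) < 0) (by norm_num : (0 : ℝ) < 1))
    (Filter.Eventually.of_forall fun τ => (cF τ).aestronglyMeasurable)
    (integrable_haarUnitary (cF 0)) cF0.aestronglyMeasurable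
    (Filter.Eventually.of_forall fun U τ hτ => hB (τ, U) ⟨hτ, Set.mem_univ _⟩)
    (integrable_const B)
    (Filter.Eventually.of_forall fun U τ _ => hderiv τ U)).2
  -- The average of `crossRe` · q^k along the rotation is constant in τ; its vanishing derivative at
  -- τ = 0 is the asserted identity.
  have hzero : ∫ U, F' 0 U ∂(haarUnitary d) = 0 := by
    refine hmain.unique ?_
    simp only [hconst]
    exact hasDerivAt_const 0 _
  have e : ∀ U, F' 0 U = k * (l i - l j) * (y U ^ 2 * q U ^ (k - 1)) - D U * q U ^ k := by
    intro U
    rw [hF']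
    simp
    ring
  simp only [e] at hzero
  rw [integral_sub (integrable_haarUnitary (by fun_prop)) (integrable_haarUnitary (by fun_prop)),
    integral_const_mul] at hzero
  rw [hy, hq, hD] at hzero
  linarith

/-- The diagonal unitary that multiplies the coordinate `i` by the imaginary unit. -/
def phaseShift (i : Fin d) : Matrix (Fin d) (Fin d) ℂ :=
  diagonal fun k => if k = i then Complex.I else 1

theorem phaseShift_mem_unitaryGroup (i : Fin d) :
    phaseShift i ∈ Matrix.unitaryGroup (Fin d) ℂ := by
  rw [mem_unitaryGroup_iff', phaseShift, star_eq_conjTranspose, diagonal_conjTranspose,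
    diagonal_mul_diagonal, ← diagonal_one]
  congr 1
  funext k
  by_cases h : k = i <;> simp [h]

/-- A phase i on one coordinate exchanges the squares of the real and imaginary parts of u_i ū_j and
fixes the form, so each square carries half of |u_i|²|u_j|². -/
theorem integral_crossRe_sq_mul {i j : Fin d} (hij : i ≠ j) (l : Fin d → ℝ) (φ : Fin d → ℂ)
    (k : ℕ) :
    2 * ∫ U, crossRe i j (rotated φ U) ^ 2 * diagForm l (rotated φ U) ^ k ∂(haarUnitary d)
      = ∫ U, Complex.normSq (rotated φ U i) * Complex.normSq (rotated φ U j)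
          * diagForm l (rotated φ U) ^ k ∂(haarUnitary d) := by
  have hr := continuous_rotated φ
  have cq := (continuous_diagForm l).comp hr
  have cy := (continuous_crossRe i j).comp hr
  have cz := (continuous_crossIm i j).comp hr
  simp only [Function.comp_def] at cq cy cz
  have h := integral_comp_mulVec_rotated φ (fun u => crossRe i j u ^ 2 * diagForm l u ^ k)
    ⟨phaseShift i, phaseShift_mem_unitaryGroup i⟩
  have e1 : ∀ u, crossRe i j (phaseShift i *ᵥ u) = -crossIm i j u := by
    intro u
    simp [crossRe, crossIm, phaseShift, mulVec_diagonal, hij.symm]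
    ring
  have e2 : ∀ u, diagForm l (phaseShift i *ᵥ u) = diagForm l u := by
    intro u
    unfold diagForm
    refine Finset.sum_congr rfl fun m _ => ?_
    by_cases hm : m = i <;> simp [phaseShift, mulVec_diagonal, hm]
  simp only [e1, e2, neg_sq] at h
  rw [two_mul]
  nth_rewrite 1 [← h]
  rw [← integral_add (integrable_haarUnitary (by fun_prop)) (integrable_haarUnitary (by fun_prop))]
  congr 1
  funext U
  rw [← crossRe_sq_add_crossIm_sq]
  ring

theorem integral_normSq_sub_mul_pow (i j : Fin d) (l : Fin d → ℝ) (φ : Fin d → ℂ) (k : ℕ) :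
    ∫ U, (Complex.normSq (rotated φ U i) - Complex.normSq (rotated φ U j))
        * diagForm l (rotated φ U) ^ k ∂(haarUnitary d)
      = k * (l i - l j) * ∫ U, Complex.normSq (rotated φ U i) * Complex.normSq (rotated φ U j)
          * diagForm l (rotated φ U) ^ (k - 1) ∂(haarUnitary d) := by
  rcases eq_or_ne i j with rfl | hij
  · simp
  · rw [← integral_crossRe_sq_mul hij]
    have h := integral_halfDiff_mul_pow hij l φ k
    have e : ∀ U, (Complex.normSq (rotated φ U i) - Complex.normSq (rotated φ U j))
        * diagForm l (rotated φ U) ^ k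
        = 2 * (halfDiff i j (rotated φ U) * diagForm l (rotated φ U) ^ k) := by
      intro U
      unfold halfDiff
      ring
    simp only [e]
    rw [integral_const_mul, h]
    ring

theorem sum_normSq_rotated {φ : Fin d → ℂ} (hφ : star φ ⬝ᵥ φ = 1)
    (U : Matrix.unitaryGroup (Fin d) ℂ) : ∑ i, Complex.normSq (rotated φ U i) = 1 := by
  have h : star (rotated φ U) ⬝ᵥ rotated φ U = 1 := by
    unfold rotated
    rw [star_mulVec, ← dotProduct_mulVec, mulVec_mulVec, star_eq_conjTranspose,
      conjTranspose_conjTranspose, ← star_eq_conjTranspose, Unitary.mul_star_self_of_mem U.2, one_mulVec,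
      hφ]
  have h2 : ((∑ i, Complex.normSq (rotated φ U i) : ℝ) : ℂ) = 1 := by
    rw [← h]
    simp [dotProduct, Complex.normSq_eq_conj_mul_self]
  exact_mod_cast h2

/-- The moment recursion for the uniform distribution on the complex sphere. -/
theorem integral_normSq_mul_pow {φ : Fin d → ℂ} (hφ : star φ ⬝ᵥ φ = 1) (l : Fin d → ℝ)
    (i : Fin d) (k : ℕ) :
    (d + k) * ∫ U, Complex.normSq (rotated φ U i) * diagForm l (rotated φ U) ^ k ∂(haarUnitary d)
      = ∫ U, diagForm l (rotated φ U) ^ k ∂(haarUnitary d)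
        + k * l i * ∫ U, Complex.normSq (rotated φ U i)
          * diagForm l (rotated φ U) ^ (k - 1) ∂(haarUnitary d) := by
  have hr := continuous_rotated φ
  have cq := (continuous_diagForm l).comp hr
  have cX : ∀ j, Continuous fun U => Complex.normSq (rotated φ U j) := fun j =>
    Complex.continuous_normSq.comp ((continuous_apply j).comp hr)
  simp only [Function.comp_def] at cq
  obtain ⟨q, hq⟩ : ∃ q, q = fun U => diagForm l (rotated φ U) := ⟨_, rfl⟩
  obtain ⟨X, hX⟩ : ∃ X : Fin d → Matrix.unitaryGroup (Fin d) ℂ → ℝ,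
    X = fun j U => Complex.normSq (rotated φ U j) := ⟨_, rfl⟩
  have hs : ∀ U, ∑ j, X j U = 1 := fun U => by rw [hX]; exact sum_normSq_rotated hφ U
  have hqs : ∀ U, ∑ j, l j * X j U = q U := fun U => by rw [hX, hq]; rfl
  have h : ∀ j, ∫ U, (X i U - X j U) * q U ^ k ∂(haarUnitary d)
      = k * (l i - l j) * ∫ U, X i U * X j U * q U ^ (k - 1) ∂(haarUnitary d) := fun j => by
    rw [hX, hq]; exact integral_normSq_sub_mul_pow i j l φ k
  have cX' : ∀ j, Continuous (X j) := fun j => by rw [hX]; exact cX j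
  rw [← hq] at cq
  change (d + k) * ∫ U, (fun j U => Complex.normSq (rotated φ U j)) i U
      * (fun U => diagForm l (rotated φ U)) U ^ k ∂(haarUnitary d)
    = ∫ U, (fun U => diagForm l (rotated φ U)) U ^ k ∂(haarUnitary d)
      + k * l i * ∫ U, (fun j U => Complex.normSq (rotated φ U j)) i U
        * (fun U => diagForm l (rotated φ U)) U ^ (k - 1) ∂(haarUnitary d)
  rw [← hq, ← hX]
  -- Summing the two-coordinate identity over j closes the recursion, because Σ X_j = 1 and Σ l_j
  -- X_j = q.
  have hsum : ∑ j, ∫ U, (X i U - X j U) * q U ^ k ∂(haarUnitary d)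
      = ∑ j, ∫ U, k * ((l i - l j) * (X i U * X j U * q U ^ (k - 1))) ∂(haarUnitary d) := by
    refine Finset.sum_congr rfl fun j _ => ?_
    rw [h, integral_const_mul, integral_const_mul, mul_assoc]
  rw [← integral_finsetSum _ (fun j _ => integrable_haarUnitary (by fun_prop)),
    ← integral_finsetSum _ (fun j _ => integrable_haarUnitary (by fun_prop))] at hsum
  have e1 : ∀ U, ∑ j, (X i U - X j U) * q U ^ k = d * (X i U * q U ^ k) - q U ^ k := by
    intro U
    rw [← Finset.sum_mul, Finset.sum_sub_distrib, hs]
    simp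
    ring
  have e2 : ∀ U, ∑ j, (k : ℝ) * ((l i - l j) * (X i U * X j U * q U ^ (k - 1)))
      = k * l i * (X i U * q U ^ (k - 1)) - k * (X i U * q U ^ k) := by
    intro U
    have e : ∀ j, (k : ℝ) * ((l i - l j) * (X i U * X j U * q U ^ (k - 1)))
        = k * l i * (X i U * q U ^ (k - 1)) * X j U
          - k * X i U * q U ^ (k - 1) * (l j * X j U) := fun j => by ring
    simp only [e]
    rw [Finset.sum_sub_distrib, ← Finset.mul_sum, ← Finset.mul_sum, hs, hqs]
    rcases k with _ | k
    · simp
    · rw [Nat.add_sub_cancel]; ring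
  simp only [e1, e2] at hsum
  rw [integral_sub (integrable_haarUnitary (by fun_prop)) (integrable_haarUnitary (by fun_prop)),
    integral_sub (integrable_haarUnitary (by fun_prop)) (integrable_haarUnitary (by fun_prop)),
    integral_const_mul, integral_const_mul, integral_const_mul] at hsum
  linarith

end HaarMoments

/-! ### Closed moment formulas and strict positivity of Haar averages -/

section HaarCoincidence

open Matrix

variable {d : ℕ}

theorem integral_diagForm_pow_eq_coincidenceFormula (hd : 0 < d) {φ : Fin d → ℂ}
    (hφ : star φ ⬝ᵥ φ = 1) {l : Fin d → ℝ} (hl : ∑ i, l i = 1) {k : ℕ} (hk1 : 1 ≤ k)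
    (hk5 : k ≤ 5) :
    ∫ U, diagForm l (rotated φ U) ^ k ∂(haarUnitary d)
      = coincidenceFormula d (fun j => ∑ i, l i ^ j) k := by
  have hr := continuous_rotated φ
  have cq := (continuous_diagForm l).comp hr
  have cX : ∀ j, Continuous fun U => Complex.normSq (rotated φ U j) := fun j =>
    Complex.continuous_normSq.comp ((continuous_apply j).comp hr)
  simp only [Function.comp_def] at cq
  obtain ⟨M, hM⟩ : ∃ M : ℕ → ℝ, M = fun k =>
    ∫ U, diagForm l (rotated φ U) ^ k ∂(haarUnitary d) := ⟨_, rfl⟩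
  obtain ⟨m, hm⟩ : ∃ m : ℕ → ℝ, m = fun j => ∑ i, l i ^ j := ⟨_, rfl⟩
  -- Weighting the recursion by l_i^j gives (d + k) T(j, k) = m_j M_k + k T(j + 1, k − 1). With T(1,
  -- k) = M_{k+1} it determines all moments; at k = 0 the truncated index is killed by the factor k.
  obtain ⟨T, hT⟩ : ∃ T : ℕ → ℕ → ℝ, T = fun j k => ∑ i, l i ^ j *
    ∫ U, Complex.normSq (rotated φ U i) * diagForm l (rotated φ U) ^ k ∂(haarUnitary d) :=
    ⟨_, rfl⟩
  have rec_T : ∀ j k, (d + k) * T j k = m j * M k + k * T (j + 1) (k - 1) := by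
    intro j k
    rw [hT, hm, hM]
    simp only
    rw [Finset.mul_sum, Finset.mul_sum, Finset.sum_mul, ← Finset.sum_add_distrib]
    refine Finset.sum_congr rfl fun i _ => ?_
    linear_combination l i ^ j * integral_normSq_mul_pow hφ l i k
  have hT1 : ∀ k, T 1 k = M (k + 1) := by
    intro k
    rw [hT, hM]
    simp only [pow_one, ← integral_const_mul]
    rw [← integral_finsetSum _ (fun i _ => integrable_haarUnitary (by fun_prop))]
    congr 1
    funext U
    simp only [← mul_assoc]
    rw [← Finset.sum_mul, pow_succ']
    rfl
  have hM0 : M 0 = 1 := by rw [hM]; simp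
  have hm1 : m 1 = 1 := by rw [hm]; simpa using hl
  have hd0 : (0 : ℝ) < d := by exact_mod_cast hd
  have a0 : ∀ j, T j 0 = m j / d := fun j => by
    have := rec_T j 0
    rw [hM0] at this
    rw [eq_div_iff hd0.ne']
    push_cast at this
    linarith
  have M1 : M 1 = 1 / d := by rw [← hT1, a0, hm1]
  have step : ∀ j k, T j (k + 1) = (m j * M (k + 1) + (k + 1) * T (j + 1) k) / (d + (k + 1)) := by
    intro j k
    have := rec_T j (k + 1)
    rw [Nat.add_sub_cancel] at this
    push_cast at this
    rw [eq_div_iff (by positivity), ← this]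
    ring
  have a1 := fun j => step j 0
  have a2 := fun j => step j 1
  have a3 := fun j => step j 2
  have a4 := fun j => step j 3
  norm_num at a1 a2 a3 a4
  have M2 : M 2 = (1 + m 2) / (d * (d + 1)) := by
    rw [← hT1, a1, a0, M1, hm1]
    field_simp
  have M3 : M 3 = (1 + 3 * m 2 + 2 * m 3) / (d * (d + 1) * (d + 2)) := by
    rw [← hT1, a2, a1, a0, M1, M2, hm1]
    field_simp
    ring
  have M4 : M 4 = (1 + 6 * m 2 + 3 * m 2 ^ 2 + 8 * m 3 + 6 * m 4)
      / (d * (d + 1) * (d + 2) * (d + 3)) := by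
    rw [← hT1, a3, a2, a1, a0, M1, M2, M3, hm1]
    field_simp
    ring
  have M5 : M 5 = (1 + 10 * m 2 + 15 * m 2 ^ 2 + 20 * m 3 + 30 * m 4 + 20 * m 2 * m 3 + 24 * m 5)
      / (d * (d + 1) * (d + 2) * (d + 3) * (d + 4)) := by
    rw [← hT1, a4, a3, a2, a1, a0, M1, M2, M3, M4, hm1]
    field_simp
    ring
  change (fun k => ∫ U, diagForm l (rotated φ U) ^ k ∂(haarUnitary d)) k = _
  rw [← hM, ← hm]
  interval_cases k
  · exact M1
  · exact M2
  · exact M3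
  · exact M4
  · exact M5

/-! ### Transitivity of the unitary group on the sphere -/

theorem exists_unitary_mulVec_single (i₀ : Fin d) {φ : Fin d → ℂ} (hφ : star φ ⬝ᵥ φ = 1) :
    ∃ V : Matrix.unitaryGroup (Fin d) ℂ,
      (V : Matrix (Fin d) (Fin d) ℂ) *ᵥ Pi.single i₀ 1 = φ := by
  obtain ⟨v, hv⟩ : ∃ v : Fin d → EuclideanSpace ℂ (Fin d), v = fun _ => WithLp.toLp 2 φ :=
    ⟨_, rfl⟩
  have hnorm : ‖(WithLp.toLp 2 φ : EuclideanSpace ℂ (Fin d))‖ = 1 := by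
    have h : inner ℂ (WithLp.toLp 2 φ : EuclideanSpace ℂ (Fin d)) (WithLp.toLp 2 φ) = 1 := by
      rw [EuclideanSpace.inner_eq_star_dotProduct, dotProduct_comm]
      exact hφ
    have h' : ‖(WithLp.toLp 2 φ : EuclideanSpace ℂ (Fin d))‖ ^ 2 = 1 := by
      rw [← inner_self_eq_norm_sq (𝕜 := ℂ), h, RCLike.one_re]
    exact (pow_eq_one_iff_of_nonneg (norm_nonneg _) two_ne_zero).mp h'
  have horth : Orthonormal ℂ (({i₀} : Set (Fin d)).domRestrict v) := by
    refine ⟨fun i => ?_, fun i j hij => absurd (Subsingleton.elim i j) hij⟩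
    rw [hv]
    exact hnorm
  obtain ⟨b, hb⟩ := horth.exists_orthonormalBasis_extension_of_card_eq (by simp)
  refine ⟨⟨(EuclideanSpace.basisFun (Fin d) ℂ).toBasis.toMatrix b.toBasis,
    (EuclideanSpace.basisFun (Fin d) ℂ).toMatrix_orthonormalBasis_mem_unitary b⟩, ?_⟩
  have hb' := hb i₀ rfl
  funext k
  rw [mulVec_single_one]
  simp [Module.Basis.toMatrix_apply, hb', hv]

theorem exists_rotated_eq {φ u : Fin d → ℂ} (hφ : star φ ⬝ᵥ φ = 1) (hu : star u ⬝ᵥ u = 1) :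
    ∃ U : Matrix.unitaryGroup (Fin d) ℂ, rotated φ U = u := by
  rcases Nat.eq_zero_or_pos d with rfl | hd
  · exact ⟨1, Subsingleton.elim _ _⟩
  · obtain ⟨V, hV⟩ := exists_unitary_mulVec_single ⟨0, hd⟩ hφ
    obtain ⟨W, hW⟩ := exists_unitary_mulVec_single ⟨0, hd⟩ hu
    refine ⟨V * star W, ?_⟩
    unfold rotated
    rw [← hV, mulVec_mulVec, ← hW]
    congr 1
    rw [Submonoid.coe_mul, star_mul, Unitary.coe_star, star_star, mul_assoc,
      Unitary.star_mul_self_of_mem V.2, mul_one]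

/-- The value is attained at √s e_i + √(1 − s) e_j, which U†φ reaches by transitivity on the unit
sphere. If l_i ≠ l_j, the form thus takes infinitely many values. -/
theorem exists_diagForm_eq {φ : Fin d → ℂ} (hφ : star φ ⬝ᵥ φ = 1) (l : Fin d → ℝ) {i j : Fin d}
    (hij : i ≠ j) {s : ℝ} (hs0 : 0 ≤ s) (hs1 : s ≤ 1) :
    ∃ U : Matrix.unitaryGroup (Fin d) ℂ,
      diagForm l (rotated φ U) = s * l i + (1 - s) * l j := by
  obtain ⟨u, hu⟩ : ∃ u : Fin d → ℂ, u = fun k =>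
    if k = i then (√s : ℂ) else if k = j then (√(1 - s) : ℂ) else 0 := ⟨_, rfl⟩
  have hnorm : ∀ k, Complex.normSq (u k) = (if k = i then s else 0) + if k = j then 1 - s else 0 := by
    intro k
    rw [hu]
    rcases eq_or_ne k i with rfl | hk
    · simp [hij, Complex.normSq_ofReal, Real.mul_self_sqrt hs0]
    · rcases eq_or_ne k j with rfl | hk'
      · simp [hij.symm, Complex.normSq_ofReal, Real.mul_self_sqrt (sub_nonneg.mpr hs1)]
      · simp [hk, hk']
  have hu1 : star u ⬝ᵥ u = 1 := by
    have h : star u ⬝ᵥ u = ((∑ k, Complex.normSq (u k) : ℝ) : ℂ) := by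
      simp [dotProduct, Complex.normSq_eq_conj_mul_self]
    rw [h]
    simp only [hnorm, Finset.sum_add_distrib]
    simp
  obtain ⟨U, hU⟩ := exists_rotated_eq hφ hu1
  refine ⟨U, ?_⟩
  rw [hU, diagForm]
  simp only [hnorm, mul_add, Finset.sum_add_distrib]
  simp
  ring

theorem diagForm_rotated_mem {φ : Fin d → ℂ} (hφ : star φ ⬝ᵥ φ = 1) {l : Fin d → ℝ}
    (hl0 : ∀ i, 0 ≤ l i) (hl : ∑ i, l i = 1) (U : Matrix.unitaryGroup (Fin d) ℂ) :
    0 ≤ diagForm l (rotated φ U) ∧ diagForm l (rotated φ U) ≤ 1 := by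
  refine ⟨Finset.sum_nonneg fun i _ => mul_nonneg (hl0 i) (Complex.normSq_nonneg _), ?_⟩
  rw [← sum_normSq_rotated hφ U, diagForm]
  refine Finset.sum_le_sum fun i _ => mul_le_of_le_one_left (Complex.normSq_nonneg _) ?_
  rw [← hl]
  exact Finset.single_le_sum (fun i _ => hl0 i) (Finset.mem_univ i)

/-- A nonzero polynomial that is nonnegative on `[0, 1]` has positive Haar average. -/
theorem integral_eval_diagForm_pos {φ : Fin d → ℂ} (hφ : star φ ⬝ᵥ φ = 1) {l : Fin d → ℝ}
    (hl0 : ∀ i, 0 ≤ l i) (hl : ∑ i, l i = 1) {i j : Fin d} (hij : l i ≠ l j) {p : Polynomial ℝ}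
    (hp : p ≠ 0) (hnn : ∀ x, 0 ≤ x → x ≤ 1 → 0 ≤ p.eval x) :
    0 < ∫ U, p.eval (diagForm l (rotated φ U)) ∂(haarUnitary d) := by
  have hne : i ≠ j := fun h => hij (h ▸ rfl)
  have hex : ∃ U : Matrix.unitaryGroup (Fin d) ℂ, p.eval (diagForm l (rotated φ U)) ≠ 0 := by
    by_contra! hcon
    refine hp (Polynomial.eq_zero_of_infinite_isRoot p ?_)
    have hinj : Function.Injective fun s : ℝ => s * l i + (1 - s) * l j := by
      intro s s' h
      have h' : (s - s') * (l i - l j) = 0 := by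
        simp only at h
        linarith
      rcases mul_eq_zero.mp h' with h' | h'
      · linarith
      · exact absurd (sub_eq_zero.mp h') hij
    refine ((Set.Icc_infinite (zero_lt_one (α := ℝ))).image hinj.injOn).mono ?_
    rintro _ ⟨s, hs, rfl⟩
    obtain ⟨U, hU⟩ := exists_diagForm_eq hφ l hne hs.1 hs.2
    have := hcon U
    rw [hU] at this
    exact this
  obtain ⟨U, hU⟩ := hex
  have hc : Continuous fun U => p.eval (diagForm l (rotated φ U)) :=
    p.continuous.comp ((continuous_diagForm l).comp (continuous_rotated φ))
  exact hc.integral_pos_of_hasCompactSupport_nonneg_nonzero (HasCompactSupport.of_compactSpace _)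
    (fun U => hnn _ (diagForm_rotated_mem hφ hl0 hl U).1 (diagForm_rotated_mem hφ hl0 hl U).2) hU

end HaarCoincidence

/-! ### Indices of coincidence of mixed designs -/

section Coincidence

open Matrix

/-- The power is Tr[M^{⊗t}(|φ⟩⟨φ|^{⊗k} ⊗ 1^{⊗(t−k)})], the idle factors contributing Tr M = 1. Hence
the design identity of order t fixes every index of coincidence with k ≤ t. -/
theorem ofReal_expectation_pow {ι : Type*} [Fintype ι] [DecidableEq ι] {M : Matrix ι ι ℂ}
    (hM : IsState M) (φ : ι → ℂ) {k t : ℕ} (hk : k ≤ t) :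
    (((star φ ⬝ᵥ M *ᵥ φ).re ^ k : ℝ) : ℂ) = ∑ h : Fin t → ι × ι,
      (∏ a : Fin t, if (a : ℕ) < k then star φ (h a).1 * φ (h a).2
        else if (h a).1 = (h a).2 then 1 else 0)
      * tensorProd (fun _ : Fin t => M) (fun a => (h a).1) fun a => (h a).2 := by
  have hre : (((star φ ⬝ᵥ M *ᵥ φ).re : ℝ) : ℂ) = star φ ⬝ᵥ M *ᵥ φ := by
    have h := hM.1.dotProduct_mulVec_nonneg φ
    exact Complex.ext rfl (Complex.le_def.mp h).2
  have h1 : ∀ a : Fin t, ∑ p : ι × ι, (if (a : ℕ) < k then star φ p.1 * φ p.2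
        else if p.1 = p.2 then 1 else 0) * M p.1 p.2
      = if (a : ℕ) < k then star φ ⬝ᵥ M *ᵥ φ else 1 := by
    intro a
    split_ifs
    · rw [Fintype.sum_prod_type]
      simp only [dotProduct, mulVec, Finset.mul_sum]
      refine Finset.sum_congr rfl fun i _ => Finset.sum_congr rfl fun j _ => ?_
      ring
    · rw [Fintype.sum_prod_type]
      simpa [trace] using hM.2
  have h2 : (star φ ⬝ᵥ M *ᵥ φ) ^ k
      = ∏ a : Fin t, if (a : ℕ) < k then star φ ⬝ᵥ M *ᵥ φ else 1 := by
    rw [Finset.prod_ite, Finset.prod_const, Finset.prod_const_one, mul_one]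
    congr 1
    rw [Fin.card_filter_val_lt]
    omega
  push_cast
  rw [hre, h2]
  simp only [← h1]
  rw [Finset.prod_univ_sum, Fintype.piFinset_univ]
  refine Finset.sum_congr rfl fun h _ => ?_
  rw [Finset.prod_mul_distrib]
  rfl

theorem ofReal_integral_expectation_pow {ι Ω : Type*} [Fintype ι] [DecidableEq ι]
    [MeasurableSpace Ω] {P : Measure Ω} [IsProbabilityMeasure P] {M : Ω → Matrix ι ι ℂ}
    (hM : ∀ ω, IsState (M ω)) (hm : ∀ i j, Measurable fun ω => M ω i j) (φ : ι → ℂ) {k t : ℕ}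
    (hk : k ≤ t) :
    ((∫ ω, (star φ ⬝ᵥ M ω *ᵥ φ).re ^ k ∂P : ℝ) : ℂ) = ∑ h : Fin t → ι × ι,
      (∏ a : Fin t, if (a : ℕ) < k then star φ (h a).1 * φ (h a).2
        else if (h a).1 = (h a).2 then 1 else 0)
      * ∫ ω, tensorProd (fun _ : Fin t => M ω) (fun a => (h a).1) (fun a => (h a).2) ∂P := by
  rw [← integral_complex_ofReal]
  simp only [fun ω => ofReal_expectation_pow (hM ω) φ hk]
  rw [integral_finsetSum]
  · simp only [integral_const_mul]
  · intro h _
    refine Integrable.const_mul ?_ _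
    refine Integrable.of_bound (C := 1) ?_ (Filter.Eventually.of_forall fun ω => ?_)
    · simp only [tensorProd, of_apply]
      exact (Finset.measurable_prod _ fun a _ => hm _ _).aestronglyMeasurable
    · simp only [tensorProd, of_apply, norm_prod]
      exact Finset.prod_le_one (fun _ _ => norm_nonneg _)
        fun a _ => norm_apply_le_one_of_isState (hM ω) _ _

variable {d : ℕ} {A : Type*} [MeasurableSpace A] {μ : Measure A} {π : StateFamily (Fin d) μ}
  {t : ℕ} {seed : Matrix (Fin d) (Fin d) ℂ}

theorem isState_unitary_conj (hs : IsState seed) (U : Matrix.unitaryGroup (Fin d) ℂ) :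
    IsState ((U : Matrix (Fin d) (Fin d) ℂ) * seed * star (U : Matrix (Fin d) (Fin d) ℂ)) :=
  ⟨hs.1.mul_mul_conjTranspose_same _, by rw [trace_unitary_conj, hs.2]⟩

theorem coincidence_eq_integral_haar (ht : IsMixedDesign t π seed) (φ : Fin d → ℂ) {k : ℕ}
    (hk : k ≤ t) :
    coincidence π φ k = ∫ U : Matrix.unitaryGroup (Fin d) ℂ,
      (star φ ⬝ᵥ ((U : Matrix (Fin d) (Fin d) ℂ) * seed
        * star (U : Matrix (Fin d) (Fin d) ℂ)) *ᵥ φ).re ^ k ∂(haarUnitary d) := by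
  have := law_isProbabilityMeasure π
  have hcont : Continuous fun U : Matrix.unitaryGroup (Fin d) ℂ =>
      (U : Matrix (Fin d) (Fin d) ℂ) * seed * star (U : Matrix (Fin d) (Fin d) ℂ) := by
    have : Continuous fun U : Matrix.unitaryGroup (Fin d) ℂ => (U : Matrix (Fin d) (Fin d) ℂ) :=
      continuous_subtype_val
    fun_prop
  apply Complex.ofReal_injective
  unfold coincidence
  rw [ofReal_integral_expectation_pow π.isState_hat π.measurable_hat φ hk,
    ofReal_integral_expectation_pow (fun U => isState_unitary_conj ht.1 U)
      (fun i j => ((continuous_apply j).comp ((continuous_apply i).comp hcont)).measurable) φ hk]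
  simp only [ht.2]

/-- The spectrum of the seed state describes the indices of coincidence and the moments. -/
theorem exists_spectrum (hs : IsState seed) :
    ∃ l : Fin d → ℝ, (∀ i, 0 ≤ l i) ∧ ∑ i, l i = 1 ∧
      (∀ j : ℕ, (seed ^ j).trace.re = ∑ i, l i ^ j) ∧
      (seed ≠ (d : ℂ)⁻¹ • (1 : Matrix (Fin d) (Fin d) ℂ) → ∃ i j, l i ≠ l j) ∧
      ∀ (φ : Fin d → ℂ) (k : ℕ), ∫ U : Matrix.unitaryGroup (Fin d) ℂ,
        (star φ ⬝ᵥ ((U : Matrix (Fin d) (Fin d) ℂ) * seed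
          * star (U : Matrix (Fin d) (Fin d) ℂ)) *ᵥ φ).re ^ k ∂(haarUnitary d)
        = ∫ U, diagForm l (rotated φ U) ^ k ∂(haarUnitary d) := by
  obtain ⟨V, l, hl0, hV⟩ := exists_unitary_diagonal hs.1
  have htr := hs.2
  have hpow : ∀ j : ℕ, seed ^ j = (V : Matrix (Fin d) (Fin d) ℂ)
      * diagonal (fun i => ((l i ^ j : ℝ) : ℂ)) * star (V : Matrix (Fin d) (Fin d) ℂ) := by
    intro j
    induction j with
    | zero =>
      simp only [pow_zero, Complex.ofReal_one, diagonal_one, mul_one]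
      exact (Unitary.mul_star_self_of_mem V.2).symm
    | succ j ih =>
      rw [pow_succ, ih]
      conv_lhs => rw [hV]
      have e : (V : Matrix (Fin d) (Fin d) ℂ) * diagonal (fun i => ((l i ^ j : ℝ) : ℂ))
          * star (V : Matrix (Fin d) (Fin d) ℂ)
          * ((V : Matrix (Fin d) (Fin d) ℂ) * diagonal (fun i => (l i : ℂ))
            * star (V : Matrix (Fin d) (Fin d) ℂ))
          = (V : Matrix (Fin d) (Fin d) ℂ) * (diagonal (fun i => ((l i ^ j : ℝ) : ℂ))
          * (star (V : Matrix (Fin d) (Fin d) ℂ)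
          * (V : Matrix (Fin d) (Fin d) ℂ)) * diagonal (fun i => (l i : ℂ)))
            * star (V : Matrix (Fin d) (Fin d) ℂ) := by
        simp only [mul_assoc]
      rw [e, Unitary.star_mul_self_of_mem V.2, mul_one, diagonal_mul_diagonal]
      congr 3
      funext i
      push_cast
      rw [pow_succ]
  have hmom : ∀ j : ℕ, (seed ^ j).trace.re = ∑ i, l i ^ j := by
    intro j
    rw [hpow, trace_unitary_conj, trace_diagonal]
    exact_mod_cast Complex.ofReal_re _
  have hl1 : ∑ i, l i = 1 := by
    have := hmom 1
    rw [pow_one, htr] at this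
    simpa using this.symm
  refine ⟨l, hl0, hl1, hmom, fun hne => ?_, fun φ k => ?_⟩
  · by_contra! hcon
    refine hne ?_
    have hli : ∀ i, l i = (d : ℝ)⁻¹ := by
      intro i
      have hsum : ∑ j, l j = d * l i := by
        rw [Finset.sum_congr rfl fun j _ => hcon j i]
        simp
      rw [hl1] at hsum
      exact eq_inv_of_mul_eq_one_right hsum.symm
    rw [hV]
    simp only [hli]
    have e : (diagonal fun _ : Fin d => (((d : ℝ)⁻¹ : ℝ) : ℂ))
        = (d : ℂ)⁻¹ • (1 : Matrix (Fin d) (Fin d) ℂ) := by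
      rw [smul_one_eq_diagonal]
      push_cast
      rfl
    rw [e, mul_smul_comm, mul_one, smul_mul_assoc, Unitary.mul_star_self_of_mem V.2]
  -- Right invariance absorbs the diagonalizing unitary V of the seed into U.
  · rw [← integral_haarUnitary_mul_right (fun U => diagForm l (rotated φ U) ^ k) V]
    congr 1
    funext U
    congr 1
    have e : (U : Matrix (Fin d) (Fin d) ℂ) * seed * star (U : Matrix (Fin d) (Fin d) ℂ)
        = (star ((U * V : Matrix.unitaryGroup (Fin d) ℂ) : Matrix (Fin d) (Fin d) ℂ))ᴴ
          * (diagonal (fun i => (l i : ℂ))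
          * star ((U * V : Matrix.unitaryGroup (Fin d) ℂ) : Matrix (Fin d) (Fin d) ℂ)) := by
      rw [hV, star_eq_conjTranspose ((U * V : Matrix.unitaryGroup (Fin d) ℂ) :
        Matrix (Fin d) (Fin d) ℂ), conjTranspose_conjTranspose, ← star_eq_conjTranspose,
        Submonoid.coe_mul, star_mul]
      simp only [mul_assoc]
    rw [e, ← mulVec_mulVec, dotProduct_mulVec, ← star_mulVec, ← mulVec_mulVec]
    change (star (rotated φ (U * V)) ⬝ᵥ diagonal (fun i => (l i : ℂ)) *ᵥ rotated φ (U * V)).re = _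
    rw [dotProduct, Complex.re_sum, diagForm]
    refine Finset.sum_congr rfl fun i _ => ?_
    rw [mulVec_diagonal, Pi.star_apply, Complex.normSq_apply]
    simp
    ring

end Coincidence

/-! ### Entropy estimates from indices of coincidence -/

section Expectation

open Matrix

variable {d : ℕ} {A : Type*} [MeasurableSpace A] {μ : Measure A} {π : StateFamily (Fin d) μ}
  {t : ℕ} {seed : Matrix (Fin d) (Fin d) ℂ} {v : Fin d → ℂ}

theorem expectation_mem (hv : star v ⬝ᵥ v = 1) {M : Matrix (Fin d) (Fin d) ℂ} (hM : IsState M) :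
    0 ≤ (star v ⬝ᵥ M *ᵥ v).re ∧ (star v ⬝ᵥ M *ᵥ v).re ≤ 1 := by
  refine ⟨(Complex.le_def.mp (hM.1.dotProduct_mulVec_nonneg v)).1, ?_⟩
  obtain ⟨V, l, hl, rfl⟩ := exists_unitary_diagonal hM.1
  have ht := hM.2
  rw [trace_unitary_conj, trace_diagonal] at ht
  have ht' : ∑ k, l k = 1 := by exact_mod_cast ht
  have e : (star v ⬝ᵥ ((V : Matrix (Fin d) (Fin d) ℂ) * diagonal (fun i => (l i : ℂ))
      * star (V : Matrix (Fin d) (Fin d) ℂ)) *ᵥ v).re = diagForm l (rotated v V) := by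
    rw [mul_assoc, ← mulVec_mulVec, dotProduct_mulVec, ← mulVec_mulVec]
    have h : star v ᵥ* (V : Matrix (Fin d) (Fin d) ℂ) = star (rotated v V) := by
      rw [rotated, star_mulVec, star_eq_conjTranspose, conjTranspose_conjTranspose]
    rw [h]
    change (star (rotated v V) ⬝ᵥ diagonal (fun i => (l i : ℂ)) *ᵥ rotated v V).re = _
    rw [dotProduct, Complex.re_sum, diagForm]
    refine Finset.sum_congr rfl fun i _ => ?_
    rw [mulVec_diagonal, Pi.star_apply, Complex.normSq_apply]
    simp
    ring
  rw [e]
  exact (diagForm_rotated_mem hv hl ht' V).2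

theorem measurable_expectation (π : StateFamily (Fin d) μ) (v : Fin d → ℂ) :
    Measurable fun y => (star v ⬝ᵥ π.hat y *ᵥ v).re := by
  have := π.measurable_hat
  simp only [dotProduct, mulVec]
  fun_prop

theorem integrable_comp_expectation (π : StateFamily (Fin d) μ) (hv : star v ⬝ᵥ v = 1)
    {F : ℝ → ℝ} (hF : Continuous F) :
    Integrable (fun y => F (star v ⬝ᵥ π.hat y *ᵥ v).re) π.law := by
  have := law_isProbabilityMeasure π
  refine integrable_comp_of_bounded hF (measurable_expectation π v) (B := 1) fun y => ?_
  have := expectation_mem hv (π.isState_hat y)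
  rw [abs_of_nonneg this.1]
  exact this.2

theorem integral_quintic (π : StateFamily (Fin d) μ) (hv : star v ⬝ᵥ v = 1)
    (c₀ c₁ c₂ c₃ c₄ c₅ : ℝ) :
    ∫ y, (c₀ + c₁ * (star v ⬝ᵥ π.hat y *ᵥ v).re + c₂ * (star v ⬝ᵥ π.hat y *ᵥ v).re ^ 2
      + c₃ * (star v ⬝ᵥ π.hat y *ᵥ v).re ^ 3 + c₄ * (star v ⬝ᵥ π.hat y *ᵥ v).re ^ 4
      + c₅ * (star v ⬝ᵥ π.hat y *ᵥ v).re ^ 5) ∂π.law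
    = c₀ + c₁ * coincidence π v 1 + c₂ * coincidence π v 2 + c₃ * coincidence π v 3
      + c₄ * coincidence π v 4 + c₅ * coincidence π v 5 := by
  have := law_isProbabilityMeasure π
  have hi : ∀ (c : ℝ) (k : ℕ), Integrable
      (fun y => c * (star v ⬝ᵥ π.hat y *ᵥ v).re ^ k) π.law := fun c k =>
    integrable_comp_expectation π hv (F := fun x => c * x ^ k) (by fun_prop)
  have h1 := hi c₁ 1
  simp only [pow_one] at h1
  have i1 := (integrable_const (μ := π.law) c₀).add h1
  have i2 := i1.add (hi c₂ 2)
  have i3 := i2.add (hi c₃ 3)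
  have i4 := i3.add (hi c₄ 4)
  simp only [Pi.add_def] at i1 i2 i3 i4
  rw [integral_add i4 (hi c₅ 5), integral_add i3 (hi c₄ 4), integral_add i2 (hi c₃ 3),
    integral_add i1 (hi c₂ 2), integral_add (integrable_const _) h1]
  simp only [integral_const_mul, coincidence, pow_one]
  simp

theorem sum_coincidence_nonneg (π : StateFamily (Fin d) μ) (hv : star v ⬝ᵥ v = 1)
    {c₀ c₁ c₂ c₃ c₄ c₅ : ℝ}
    (h : ∀ x, 0 ≤ x → x ≤ 1 →
      0 ≤ c₀ + c₁ * x + c₂ * x ^ 2 + c₃ * x ^ 3 + c₄ * x ^ 4 + c₅ * x ^ 5) :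
    0 ≤ c₀ + c₁ * coincidence π v 1 + c₂ * coincidence π v 2 + c₃ * coincidence π v 3
      + c₄ * coincidence π v 4 + c₅ * coincidence π v 5 := by
  rw [← integral_quintic π hv]
  refine integral_nonneg fun y => ?_
  have := expectation_mem hv (π.isState_hat y)
  exact h _ this.1 this.2

theorem sum_coincidence_le_integral_negMulLog (π : StateFamily (Fin d) μ)
    (hv : star v ⬝ᵥ v = 1) {c₁ c₂ c₃ c₄ c₅ : ℝ}
    (h : ∀ x, 0 ≤ x → x ≤ 1 →
      c₁ * x + c₂ * x ^ 2 + c₃ * x ^ 3 + c₄ * x ^ 4 + c₅ * x ^ 5 ≤ Real.negMulLog x) :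
    c₁ * coincidence π v 1 + c₂ * coincidence π v 2 + c₃ * coincidence π v 3
      + c₄ * coincidence π v 4 + c₅ * coincidence π v 5
      ≤ ∫ y, Real.negMulLog (star v ⬝ᵥ π.hat y *ᵥ v).re ∂π.law := by
  have e := integral_quintic π hv 0 c₁ c₂ c₃ c₄ c₅
  simp only [zero_add] at e
  rw [← e]
  refine integral_mono (integrable_comp_expectation π hv (F := fun x =>
    c₁ * x + c₂ * x ^ 2 + c₃ * x ^ 3 + c₄ * x ^ 4 + c₅ * x ^ 5) (by fun_prop))
    (integrable_comp_expectation π hv Real.continuous_negMulLog) fun y => ?_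
  have := expectation_mem hv (π.isState_hat y)
  exact h _ this.1 this.2

/-- Multiplication by x shifts the index: the coefficient of x^{k−1} in a minorant of −ln is paired
with γ_k. -/
theorem sum_coincidence_le_of_le_neg_log (π : StateFamily (Fin d) μ)
    (hv : star v ⬝ᵥ v = 1) {c₁ c₂ c₃ c₄ : ℝ}
    (h : ∀ x, 0 < x → x ≤ 1 → c₁ + c₂ * x + c₃ * x ^ 2 + c₄ * x ^ 3 ≤ -Real.log x) :
    c₁ * coincidence π v 1 + c₂ * coincidence π v 2 + c₃ * coincidence π v 3
      + c₄ * coincidence π v 4 ≤ ∫ y, Real.negMulLog (star v ⬝ᵥ π.hat y *ᵥ v).re ∂π.law := by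
  refine le_trans (le_of_eq ?_) (sum_coincidence_le_integral_negMulLog π hv (c₁ := c₁) (c₂ := c₂)
    (c₃ := c₃) (c₄ := c₄) (c₅ := 0) fun x hx hx' => ?_)
  · ring
  · rcases hx.eq_or_lt with rfl | hx
    · simp
    · have := mul_le_mul_of_nonneg_left (h x hx hx') hx.le
      rw [Real.negMulLog]
      linarith

/-- The capacity is bounded through the minimal outcome entropy of pure states. -/
theorem capacity_le_of_entropy (hd : 0 < d) (hπ : IsPOVM π) {C : ℝ}
    (h1 : ∀ v : Fin d → ℂ, star v ⬝ᵥ v = 1 → coincidence π v 1 = 1 / d)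
    (hC : ∀ v : Fin d → ℂ, star v ⬝ᵥ v = 1 →
      Real.log d - d * ∫ y, Real.negMulLog (star v ⬝ᵥ π.hat y *ᵥ v).re ∂π.law ≤ C) :
    (capacity π : EReal) ≤ (C : EReal) := by
  have hd0 : (d : ℝ) ≠ 0 := by exact_mod_cast hd.ne'
  refine capacity_le hd hπ fun v hv => ?_
  refine le_trans (le_of_eq ?_) (hC v hv)
  have e : ∀ y, (d * (star v ⬝ᵥ π.hat y *ᵥ v).re) * Real.log (d * (star v ⬝ᵥ π.hat y *ᵥ v).re)
      = d * Real.log d * (star v ⬝ᵥ π.hat y *ᵥ v).re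
        - d * Real.negMulLog (star v ⬝ᵥ π.hat y *ᵥ v).re := by
    intro y
    by_cases h : (star v ⬝ᵥ π.hat y *ᵥ v).re = 0
    · simp [h]
    · rw [Real.log_mul hd0 h, Real.negMulLog]
      ring
  simp only [e]
  rw [integral_sub (integrable_comp_expectation π hv (F := fun x => d * Real.log d * x)
      (by fun_prop))
    (integrable_comp_expectation π hv (F := fun x => d * Real.negMulLog x)
      (by have := Real.continuous_negMulLog; fun_prop)), integral_const_mul, integral_const_mul]
  have h1' := h1 v hv
  simp only [coincidence, pow_one] at h1'
  rw [h1']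
  field_simp

theorem coincidence_eq_formula (hd : 0 < d) (ht : IsMixedDesign t π seed)
    (hv : star v ⬝ᵥ v = 1) {k : ℕ} (hk1 : 1 ≤ k) (hkt : k ≤ t) (hk5 : k ≤ 5) :
    coincidence π v k = coincidenceFormula d (fun j => ((seed ^ j).trace).re) k := by
  obtain ⟨l, -, hl1, hmom, -, hint⟩ := exists_spectrum ht.1
  rw [coincidence_eq_integral_haar ht v hkt, hint,
    integral_diagForm_pow_eq_coincidenceFormula hd hv hl1 hk1 hk5]
  simp only [hmom]

theorem sum_coincidence_pos (hs : IsState seed)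
    (hne : seed ≠ (d : ℂ)⁻¹ • (1 : Matrix (Fin d) (Fin d) ℂ))
    (hv : star v ⬝ᵥ v = 1) {c₁ c₂ c₃ c₄ c₅ : ℝ}
    (hc : c₁ ≠ 0 ∨ c₂ ≠ 0 ∨ c₃ ≠ 0 ∨ c₄ ≠ 0 ∨ c₅ ≠ 0)
    (h : ∀ x, 0 ≤ x → x ≤ 1 →
      0 ≤ c₁ * x + c₂ * x ^ 2 + c₃ * x ^ 3 + c₄ * x ^ 4 + c₅ * x ^ 5)
    {M : ℕ → ℝ} (hM : M = fun k => ∫ U : Matrix.unitaryGroup (Fin d) ℂ,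
        (star v ⬝ᵥ ((U : Matrix (Fin d) (Fin d) ℂ) * seed
          * star (U : Matrix (Fin d) (Fin d) ℂ)) *ᵥ v).re ^ k ∂(haarUnitary d)) :
    0 < c₁ * M 1 + c₂ * M 2 + c₃ * M 3 + c₄ * M 4 + c₅ * M 5 := by
  obtain ⟨l, hl0, hl1, -, hlne, hint⟩ := exists_spectrum hs
  obtain ⟨i, j, hij⟩ := hlne hne
  obtain ⟨p, hp⟩ : ∃ p : Polynomial ℝ, p = Polynomial.C c₁ * Polynomial.X
      + Polynomial.C c₂ * Polynomial.X ^ 2 + Polynomial.C c₃ * Polynomial.X ^ 3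
      + Polynomial.C c₄ * Polynomial.X ^ 4 + Polynomial.C c₅ * Polynomial.X ^ 5 := ⟨_, rfl⟩
  have hev : ∀ x, p.eval x = c₁ * x + c₂ * x ^ 2 + c₃ * x ^ 3 + c₄ * x ^ 4 + c₅ * x ^ 5 := by
    intro x
    rw [hp]
    simp
  have hp0 : p ≠ 0 := by
    intro h0
    have hcoeff : ∀ k, p.coeff k = 0 := fun k => by rw [h0]; simp
    have k1 := hcoeff 1
    have k2 := hcoeff 2
    have k3 := hcoeff 3
    have k4 := hcoeff 4
    have k5 := hcoeff 5
    rw [hp] at k1 k2 k3 k4 k5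
    simp [Polynomial.coeff_X_pow] at k1 k2 k3 k4 k5
    simp [k1, k2, k3, k4, k5] at hc
  have hpos := integral_eval_diagForm_pos hv hl0 hl1 hij hp0 fun x hx hx' => by
    rw [hev]; exact h x hx hx'
  have cq := (continuous_diagForm l).comp (continuous_rotated v)
  simp only [Function.comp_def] at cq
  simp only [hev] at hpos
  rw [integral_add (integrable_haarUnitary (by fun_prop)) (integrable_haarUnitary (by fun_prop)),
    integral_add (integrable_haarUnitary (by fun_prop)) (integrable_haarUnitary (by fun_prop)),
    integral_add (integrable_haarUnitary (by fun_prop)) (integrable_haarUnitary (by fun_prop)),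
    integral_add (integrable_haarUnitary (by fun_prop)) (integrable_haarUnitary (by fun_prop))]
    at hpos
  simp only [integral_const_mul] at hpos
  have h1 := hint v 1
  simp only [pow_one] at h1
  rw [hM]
  simp only [pow_one, h1, hint]
  exact hpos

/-! ### The capacity bounds -/

theorem capacity_le_bound1 (hd : 0 < d) (hπ : IsPOVM π) (ht : IsMixedDesign t π seed)
    (h1 : 1 ≤ t) : (capacity π : EReal) ≤ (bound1 d : EReal) := by
  refine capacity_le_of_entropy hd hπ
    (fun v hv => coincidence_eq_formula hd ht hv le_rfl h1 (by norm_num)) fun v hv => ?_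
  have h := sum_coincidence_le_of_le_neg_log π hv (c₁ := 0) (c₂ := 0) (c₃ := 0) (c₄ := 0)
    fun x hx hx' => by simpa using Real.log_nonpos hx.le hx'
  simp only [zero_mul, add_zero] at h
  have := mul_nonneg (Nat.cast_nonneg (α := ℝ) d) h
  unfold bound1
  linarith

theorem trace_sq_re_nonneg (hs : IsState seed) : 0 ≤ ((seed ^ 2).trace).re := by
  obtain ⟨l, -, -, hmom, -⟩ := exists_spectrum hs
  rw [hmom]
  positivity

theorem trace_sq_re_le_one (hs : IsState seed) : ((seed ^ 2).trace).re ≤ 1 := by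
  obtain ⟨l, hl0, hl1, hmom, -⟩ := exists_spectrum hs
  rw [hmom, ← hl1]
  refine Finset.sum_le_sum fun i _ => ?_
  have : l i ≤ 1 := hl1 ▸ Finset.single_le_sum (fun i _ => hl0 i) (Finset.mem_univ i)
  rw [sq]
  exact mul_le_of_le_one_left (hl0 i) this

variable {φ : Fin d → ℂ}

theorem coincidence_two_pos (hd : 0 < d) (ht : IsMixedDesign t π seed) (h2 : 2 ≤ t)
    (hφ : star φ ⬝ᵥ φ = 1) : 0 < coincidence π φ 2 := by
  rw [coincidence_eq_formula hd ht hφ (by norm_num) h2 (by norm_num)]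
  have h := trace_sq_re_nonneg ht.1
  have hd0 : (0 : ℝ) < d := by exact_mod_cast hd
  simp only [coincidenceFormula]
  positivity

theorem coincidence_eq_of_design (hd : 0 < d) (ht : IsMixedDesign t π seed)
    (hφ : star φ ⬝ᵥ φ = 1) (hv : star v ⬝ᵥ v = 1) {k : ℕ} (hk1 : 1 ≤ k) (hkt : k ≤ t)
    (hk5 : k ≤ 5) : coincidence π v k = coincidence π φ k := by
  rw [coincidence_eq_formula hd ht hφ hk1 hkt hk5, coincidence_eq_formula hd ht hv hk1 hkt hk5]

theorem capacity_le_bound2 (hd : 0 < d) (hπ : IsPOVM π) (ht : IsMixedDesign t π seed)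
    (h2 : 2 ≤ t) (hφ : star φ ⬝ᵥ φ = 1) :
    (capacity π : EReal) ≤ (bound2 d (coincidence π φ) : EReal) := by
  have h1 : ∀ v : Fin d → ℂ, star v ⬝ᵥ v = 1 → coincidence π v 1 = 1 / d := fun v hv =>
    coincidence_eq_formula hd ht hv le_rfl (by omega) (by norm_num)
  refine capacity_le_of_entropy hd hπ h1 fun v hv => ?_
  refine log_sub_le_bound2 hd (h1 φ hφ) (coincidence_two_pos hd ht h2 hφ) fun c₁ c₂ hc => ?_
  have h := sum_coincidence_le_of_le_neg_log π hv (c₁ := c₁) (c₂ := c₂) (c₃ := 0) (c₄ := 0)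
    fun x hx hx' => by simpa using hc x hx hx'
  rw [coincidence_eq_of_design hd ht hφ hv (k := 1) (by omega) (by omega) (by omega),
    coincidence_eq_of_design hd ht hφ hv (k := 2) (by omega) (by omega) (by omega)] at h
  simpa using h

/-- The formulas give γ₁ > γ₂ from m₂ ≤ 1 < d. Cauchy–Schwarz then gives γ₁(γ₁ − 2γ₂ + γ₃) ≥ (γ₁ −
γ₂)² and (1 − γ₁)(γ₂ − γ₃) ≥ (γ₁ − γ₂)². No assumption on the seed is needed, unlike for t = 4, 5.
-/
theorem coincidence_differences_pos (hd : 2 ≤ d) (ht : IsMixedDesign t π seed) (h3 : 3 ≤ t)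
    (hφ : star φ ⬝ᵥ φ = 1) :
    0 < coincidence π φ 1 - 2 * coincidence π φ 2 + coincidence π φ 3 ∧
      0 < coincidence π φ 1 - coincidence π φ 2 ∧ 0 < coincidence π φ 2 - coincidence π φ 3 := by
  have hd0 : (2 : ℝ) ≤ d := by exact_mod_cast hd
  have e1 := coincidence_eq_formula (by omega) ht hφ (k := 1) (by omega) (by omega) (by omega)
  have e2 := coincidence_eq_formula (by omega) ht hφ (k := 2) (by omega) (by omega) (by omega)
  simp only [coincidenceFormula] at e1 e2
  have hm := trace_sq_re_le_one ht.1
  have p1 : 0 < coincidence π φ 1 := by rw [e1]; positivity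
  have p1' : 0 < 1 - coincidence π φ 1 := by
    rw [e1, sub_pos, div_lt_one (by linarith)]
    linarith
  obtain ⟨u, hu⟩ : ∃ u, u = coincidence π φ 1 - coincidence π φ 2 := ⟨_, rfl⟩
  have hu0 : 0 < u := by
    have e : u = (d - ((seed ^ 2).trace).re) / (d * (d + 1)) := by
      rw [hu, e1, e2]
      field_simp
      ring
    rw [e]
    exact div_pos (by linarith) (by positivity)
  rw [← hu]
  refine ⟨?_, hu0, ?_⟩
  · obtain ⟨a, ha⟩ : ∃ a, a = coincidence π φ 1 := ⟨_, rfl⟩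
    -- First Cauchy–Schwarz test polynomial: x(a(1 − x) − u)². The other difference uses (1 − x)(b x
    -- − u)².
    have h := sum_coincidence_nonneg π hφ (c₀ := 0) (c₁ := (a - u) ^ 2)
      (c₂ := -2 * a * (a - u)) (c₃ := a ^ 2) (c₄ := 0) (c₅ := 0) fun x hx _ => by
        have : 0 ≤ x * (a * (1 - x) - u) ^ 2 := mul_nonneg hx (sq_nonneg _)
        linarith
    rw [← ha] at p1 h hu ⊢
    have hb : coincidence π φ 2 = a - u := by linarith
    rw [hb] at h ⊢
    have h' : a * u ^ 2 ≤ a ^ 2 * (a - 2 * (a - u) + coincidence π φ 3) := by linarith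
    exact pos_of_mul_pos_right (lt_of_lt_of_le (by positivity) h') (by positivity)
  · obtain ⟨b, hb⟩ : ∃ b, b = 1 - coincidence π φ 1 := ⟨_, rfl⟩
    have h := sum_coincidence_nonneg π hφ (c₀ := u ^ 2) (c₁ := -2 * b * u - u ^ 2)
      (c₂ := b ^ 2 + 2 * b * u) (c₃ := -b ^ 2) (c₄ := 0) (c₅ := 0) fun x _ hx' => by
        have : 0 ≤ (1 - x) * (b * x - u) ^ 2 := mul_nonneg (sub_nonneg.mpr hx') (sq_nonneg _)
        linarith
    rw [← hb] at p1'
    have ha : coincidence π φ 1 = 1 - b := by linarith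
    have hc : coincidence π φ 2 = 1 - b - u := by linarith
    rw [ha, hc] at h
    rw [hc]
    have h' : b * u ^ 2 ≤ b ^ 2 * (1 - b - u - coincidence π φ 3) := by linarith
    exact pos_of_mul_pos_right (lt_of_lt_of_le (by positivity) h') (by positivity)

theorem capacity_le_bound3 (hd : 2 ≤ d) (hπ : IsPOVM π) (ht : IsMixedDesign t π seed)
    (h3 : 3 ≤ t) (hφ : star φ ⬝ᵥ φ = 1) :
    (capacity π : EReal) ≤ (bound3 d (coincidence π φ) : EReal) := by
  have hd0 : 0 < d := by omega
  refine capacity_le_of_entropy hd0 hπ (fun v hv =>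
    coincidence_eq_formula hd0 ht hv le_rfl (by omega) (by norm_num)) fun v hv => ?_
  obtain ⟨p1, p2, p3⟩ := coincidence_differences_pos hd ht h3 hφ
  refine log_sub_le_bound3 p2 p3 p1 fun c₁ c₂ c₃ hc => ?_
  have h := sum_coincidence_le_of_le_neg_log π hv (c₁ := c₁) (c₂ := c₂) (c₃ := c₃) (c₄ := 0)
    fun x hx hx' => by simpa using hc x hx hx'
  rw [coincidence_eq_of_design hd0 ht hφ hv (k := 1) (by omega) (by omega) (by omega),
    coincidence_eq_of_design hd0 ht hφ hv (k := 2) (by omega) (by omega) (by omega),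
    coincidence_eq_of_design hd0 ht hφ hv (k := 3) (by omega) (by omega) (by omega)] at h
  simpa using h

theorem coincidence_quadrature4 (ht : IsMixedDesign t π seed) (h4 : 4 ≤ t)
    (hφ : star φ ⬝ᵥ φ = 1) (hne : seed ≠ (d : ℂ)⁻¹ • (1 : Matrix (Fin d) (Fin d) ℂ)) :
    0 < coincidence π φ 1 * coincidence π φ 3 - coincidence π φ 2 ^ 2 ∧
      0 < coincidence π φ 2 * coincidence π φ 4 - coincidence π φ 3 ^ 2 ∧
      0 < disc4 (coincidence π φ) ∧
      √(disc4 (coincidence π φ)) < coincidence π φ 1 * coincidence π φ 4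
        - coincidence π φ 2 * coincidence π φ 3 := by
  refine quadrature4 fun c₁ c₂ c₃ c₄ hc h => ?_
  have := sum_coincidence_pos ht.1 hne hφ (c₁ := c₁) (c₂ := c₂) (c₃ := c₃) (c₄ := c₄) (c₅ := 0)
    (by tauto) (fun x hx hx' => by simpa using h x hx hx') rfl
  simp only [zero_mul, add_zero] at this
  rw [coincidence_eq_integral_haar ht φ (k := 1) (by omega),
    coincidence_eq_integral_haar ht φ (k := 2) (by omega),
    coincidence_eq_integral_haar ht φ (k := 3) (by omega),
    coincidence_eq_integral_haar ht φ (k := 4) (by omega)]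
  exact this

theorem capacity_le_bound4 (hd : 0 < d) (hπ : IsPOVM π) (ht : IsMixedDesign t π seed)
    (h4 : 4 ≤ t) (hφ : star φ ⬝ᵥ φ = 1)
    (hne : seed ≠ (d : ℂ)⁻¹ • (1 : Matrix (Fin d) (Fin d) ℂ)) :
    (capacity π : EReal) ≤ (bound4 d (coincidence π φ) : EReal) := by
  have h1 : ∀ v : Fin d → ℂ, star v ⬝ᵥ v = 1 → coincidence π v 1 = 1 / d := fun v hv =>
    coincidence_eq_formula hd ht hv le_rfl (by omega) (by norm_num)
  refine capacity_le_of_entropy hd hπ h1 fun v hv => ?_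
  obtain ⟨p1, -, p3, p4⟩ := coincidence_quadrature4 ht h4 hφ hne
  refine log_sub_le_bound4 hd (h1 φ hφ) p1 p3 p4 fun c₁ c₂ c₃ c₄ hc => ?_
  have h := sum_coincidence_le_of_le_neg_log π hv hc
  rw [coincidence_eq_of_design hd ht hφ hv (k := 1) (by omega) (by omega) (by omega),
    coincidence_eq_of_design hd ht hφ hv (k := 2) (by omega) (by omega) (by omega),
    coincidence_eq_of_design hd ht hφ hv (k := 3) (by omega) (by omega) (by omega),
    coincidence_eq_of_design hd ht hφ hv (k := 4) (by omega) (by omega) (by omega)] at h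
  exact h

theorem coincidence_quadrature5 (ht : IsMixedDesign t π seed) (h5 : 5 ≤ t)
    (hφ : star φ ⬝ᵥ φ = 1) (hne : seed ≠ (d : ℂ)⁻¹ • (1 : Matrix (Fin d) (Fin d) ℂ)) :
    den5 (coincidence π φ) < 0 ∧ 0 < disc5 (coincidence π φ) ∧
      0 < node5p (coincidence π φ) ∧ node5p (coincidence π φ) < node5m (coincidence π φ) ∧
      node5m (coincidence π φ) < 1 := by
  refine quadrature5 fun c₁ c₂ c₃ c₄ c₅ hc h => ?_
  have := sum_coincidence_pos ht.1 hne hφ hc h rfl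
  rw [coincidence_eq_integral_haar ht φ (k := 1) (by omega),
    coincidence_eq_integral_haar ht φ (k := 2) (by omega),
    coincidence_eq_integral_haar ht φ (k := 3) (by omega),
    coincidence_eq_integral_haar ht φ (k := 4) (by omega),
    coincidence_eq_integral_haar ht φ (k := 5) (by omega)]
  exact this

theorem capacity_le_of_polynomial (hd : 0 < d) (hπ : IsPOVM π) (ht : IsMixedDesign t π seed)
    (h5 : 5 ≤ t) (hφ : star φ ⬝ᵥ φ = 1) {r : Polynomial ℝ} (hdeg : r.natDegree ≤ 5)
    (h0 : r.coeff 0 = 0) (hr : ∀ x, 0 ≤ x → x ≤ 1 → r.eval x ≤ Real.negMulLog x) :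
    (capacity π : EReal) ≤
      ((Real.log d - d * ∑ i ∈ Finset.Icc 1 5, r.coeff i * coincidence π φ i : ℝ) : EReal) := by
  refine capacity_le_of_entropy hd hπ (fun v hv =>
    coincidence_eq_formula hd ht hv le_rfl (by omega) (by norm_num)) fun v hv => ?_
  have h := sum_coincidence_le_integral_negMulLog π hv (c₁ := r.coeff 1) (c₂ := r.coeff 2)
    (c₃ := r.coeff 3) (c₄ := r.coeff 4) (c₅ := r.coeff 5) fun x hx hx' => by
      have := hr x hx hx'
      rw [Polynomial.eval_eq_sum_range' (Nat.lt_succ_of_le hdeg)] at this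
      simpa [Finset.sum_range_succ, h0] using this
  rw [coincidence_eq_of_design hd ht hφ hv (k := 1) (by omega) (by omega) (by omega),
    coincidence_eq_of_design hd ht hφ hv (k := 2) (by omega) (by omega) (by omega),
    coincidence_eq_of_design hd ht hφ hv (k := 3) (by omega) (by omega) (by omega),
    coincidence_eq_of_design hd ht hφ hv (k := 4) (by omega) (by omega) (by omega),
    coincidence_eq_of_design hd ht hφ hv (k := 5) (by omega) (by omega) (by omega)] at h
  have e : ∑ i ∈ Finset.Icc 1 5, r.coeff i * coincidence π φ i
      = r.coeff 1 * coincidence π φ 1 + r.coeff 2 * coincidence π φ 2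
        + r.coeff 3 * coincidence π φ 3 + r.coeff 4 * coincidence π φ 4
        + r.coeff 5 * coincidence π φ 5 := by
    rw [show Finset.Icc 1 5 = ({1, 2, 3, 4, 5} : Finset ℕ) from rfl]
    simp
    ring
  rw [e]
  have := mul_le_mul_of_nonneg_left h (Nat.cast_nonneg (α := ℝ) d)
  linarith

theorem capacity_eq_zero_of_le (h : (capacity π : EReal) ≤ ((0 : ℝ) : EReal)) :
    capacity π = 0 := by
  have h' : (capacity π : EReal) ≤ ((0 : ℝ≥0∞) : EReal) := by simpa using h
  exact le_antisymm (EReal.coe_ennreal_le_coe_ennreal_iff.mp h') bot_le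

/-- Here m₂ = 1/d, so γ₂/γ₁ = 1/d and the bound C_2, available for every t ≥ 2, is already zero. -/
theorem capacity_eq_zero_of_maximally_mixed (hd : 0 < d) (hπ : IsPOVM π)
    (ht : IsMixedDesign t π seed) (h2 : 2 ≤ t) (hφ : star φ ⬝ᵥ φ = 1)
    (hs : seed = (d : ℂ)⁻¹ • (1 : Matrix (Fin d) (Fin d) ℂ)) : capacity π = 0 := by
  have hd0 : (0 : ℝ) < d := by exact_mod_cast hd
  have h := capacity_le_bound2 hd hπ ht h2 hφ
  have e1 := coincidence_eq_formula hd ht hφ (k := 1) (by omega) (by omega) (by omega)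
  have e2 := coincidence_eq_formula hd ht hφ (k := 2) (by omega) (by omega) (by omega)
  have hm : ((seed ^ 2).trace).re = 1 / d := by
    have : (seed ^ 2).trace = ((1 / d : ℝ) : ℂ) := by
      rw [hs, smul_pow, one_pow, trace_smul, trace_one, Fintype.card_fin, smul_eq_mul]
      push_cast
      field_simp
    rw [this, Complex.ofReal_re]
  simp only [coincidenceFormula, hm] at e1 e2
  have hb : bound2 d (coincidence π φ) = 0 := by
    unfold bound2
    rw [e1, e2, show (1 + 1 / (d : ℝ)) / (d * (d + 1)) / (1 / d) = (d : ℝ)⁻¹ by field_simp,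
      Real.log_inv]
    ring
  rw [hb] at h
  exact capacity_eq_zero_of_le h

end Expectation

end MixedDesign


/-! ### Capacity bounds for mixed designs of order one to five -/

theorem theorem1 (d : ℕ) (hd : 0 < d) {A : Type*} [MeasurableSpace A] (μ : Measure A)
    (π : StateFamily (Fin d) μ) (hπ : IsPOVM π) (t : ℕ)
    (seed : Matrix (Fin d) (Fin d) ℂ) (ht : IsMixedDesign t π seed)
    (φ : Fin d → ℂ) (hφ : star φ ⬝ᵥ φ = 1)
    (γ : ℕ → ℝ) (hγ : ∀ k, γ k = coincidence π φ k) :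
    -- the indices of coincidence are fixed by the moments of the seed state
    (∀ k, 1 ≤ k → k ≤ t → k ≤ 5 →
      γ k = coincidenceFormula d (fun j => ((seed ^ j).trace).re) k) ∧
    -- `t = 1`
    (t = 1 → (capacity π : EReal) ≤ (bound1 d : EReal)) ∧
    -- `t = 2`
    (t = 2 → 0 < γ 1 ∧ 0 < γ 2 ∧ (capacity π : EReal) ≤ (bound2 d γ : EReal)) ∧
    -- `t = 3`, the expression being undefined for `d = 1`
    (t = 3 →
      (2 ≤ d → 0 < γ 1 - 2 * γ 2 + γ 3 ∧ 0 < γ 1 - γ 2 ∧ 0 < γ 2 - γ 3 ∧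
        (capacity π : EReal) ≤ (bound3 d γ : EReal)) ∧
      (d = 1 → capacity π = 0)) ∧
    -- `t = 4`, the expression being undefined for the maximally mixed seed state
    (t = 4 →
      (seed ≠ (d : ℂ)⁻¹ • (1 : Matrix (Fin d) (Fin d) ℂ) →
        0 < γ 1 * γ 3 - γ 2 ^ 2 ∧ 0 < γ 2 * γ 4 - γ 3 ^ 2 ∧ 0 < disc4 γ ∧
        √(disc4 γ) < γ 1 * γ 4 - γ 2 * γ 3 ∧
        (capacity π : EReal) ≤ (bound4 d γ : EReal)) ∧
      (seed = (d : ℂ)⁻¹ • (1 : Matrix (Fin d) (Fin d) ℂ) → capacity π = 0)) ∧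
    -- `t = 5`, the nodes being undefined for the maximally mixed seed state
    (t = 5 →
      (seed ≠ (d : ℂ)⁻¹ • (1 : Matrix (Fin d) (Fin d) ℂ) →
        den5 γ < 0 ∧ 0 < disc5 γ ∧
        0 < node5p γ ∧ node5p γ < node5m γ ∧ node5m γ < 1 ∧
        ∃ r : Polynomial ℝ, IsHermite5 r (node5p γ) (node5m γ) ∧
          (capacity π : EReal) ≤
            ((Real.log d - d * ∑ i ∈ Finset.Icc 1 5, r.coeff i * γ i : ℝ) : EReal)) ∧
      (seed = (d : ℂ)⁻¹ • (1 : Matrix (Fin d) (Fin d) ℂ) → capacity π = 0)) := by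
  obtain rfl : γ = coincidence π φ := funext hγ
  have hd0 : (0 : ℝ) < d := by exact_mod_cast hd
  refine ⟨fun k hk hkt hk5 => coincidence_eq_formula hd ht hφ hk hkt hk5, ?_, ?_, ?_, ?_, ?_⟩
  · rintro rfl
    exact capacity_le_bound1 hd hπ ht le_rfl
  · rintro rfl
    refine ⟨?_, coincidence_two_pos hd ht le_rfl hφ, capacity_le_bound2 hd hπ ht le_rfl hφ⟩
    rw [coincidence_eq_formula hd ht hφ (k := 1) le_rfl (by norm_num) (by norm_num)]
    simp only [coincidenceFormula]
    positivity
  · rintro rfl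
    refine ⟨fun h2 => ?_, fun h1 => ?_⟩
    · obtain ⟨p1, p2, p3⟩ := coincidence_differences_pos h2 ht le_rfl hφ
      exact ⟨p1, p2, p3, capacity_le_bound3 h2 hπ ht le_rfl hφ⟩
    -- In dimension one the bound ln d is zero.
    · have h := capacity_le_bound1 hd hπ ht (by norm_num)
      have hb : bound1 d = 0 := by simp [bound1, h1]
      exact capacity_eq_zero_of_le (hb ▸ h)
  · rintro rfl
    refine ⟨fun hne => ?_,
      fun hs => capacity_eq_zero_of_maximally_mixed hd hπ ht (by norm_num) hφ hs⟩
    obtain ⟨p1, p2, p3, p4⟩ := coincidence_quadrature4 ht le_rfl hφ hne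
    exact ⟨p1, p2, p3, p4, capacity_le_bound4 hd hπ ht le_rfl hφ hne⟩
  · rintro rfl
    refine ⟨fun hne => ?_,
      fun hs => capacity_eq_zero_of_maximally_mixed hd hπ ht (by norm_num) hφ hs⟩
    obtain ⟨p1, p2, p3, p4, p5⟩ := coincidence_quadrature5 ht le_rfl hφ hne
    obtain ⟨r, hr, h0, hle⟩ := exists_isHermite5 p3 p4 p5
    exact ⟨p1, p2, p3, p4, p5, r, hr, capacity_le_of_polynomial hd hπ ht le_rfl hφ hr.1 h0 hle⟩
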